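/- Let $A,g_0>0$, $6/5<\gamma\le 2$, and let $\rho$ be an equilibrium of radius $R>0$ with central density $\rho_c>0$: with $P=A\rho^\gamma$, $\rho$ is positive and twice continuously differentiable on $(0,R)$, $$-\frac1{r^2}\frac{d}{dr}\Big(\frac{r^2}{\rho}\frac{dP}{dr}\Big)=4\pi g_0\rho\quad(0<r<R),\qquad \rho\to\rho_c\ (r\to0),\qquad \rho\to0\ (r\to R).$$ Put $$\mathcal L y=-\frac{1}{\rho r^4}\frac{d}{dr}\Big(\gamma r^4P\frac{dy}{dr}\Big)+\frac{1}{\rho r}(4-3\gamma)\frac{dP}{dr}\,y ,$$ $$x=\frac{\tan^2\theta}{1+\tan^2\theta},\qquad \theta(r)=\frac{\pi}{2}\,\frac{\int_0^r\sqrt{\rho/(\gamma P)}\,dr'}{\int_0^R\sqrt{\rho/(\gamma P)}\,dr'},\qquad N=\frac{2\gamma}{\gamma-1}.$$ Write $[X]_1$ (respectively $[X,Y]_1$) for a convergent power series $\sum_{j\ge1}a_jX^j$ (respectively $\sum_{j+k\ge1}a_{jk}X^jY^k$). Let $\Phi$ be an eigenfunction, with real eigenvalue $\lambda$, of the Friedrichs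 extension of $\mathcal L|_{C_0^\infty(0,R)}$ in $L^2((0,R),r^4\rho\,dr)$. Then (after modification on a null set) $\Phi$ is a $C^2$ solution of $\mathcal L\Phi=\lambda\Phi$ on $(0,R)$, and there are nonzero constants $C_0,C_1$ such that $$\Phi=C_0(1+[r^2]_1)\ \text{ as } r\to0,\qquad \Phi=C_0(1+[x]_1)\ \text{ as } x\to 0,$$ $$\Phi=C_1(1+[R-r,(R-r)^{\gamma/(\gamma-1)}]_1)\ \text{ as } r\to R,\qquad \Phi=C_1(1+[1-x,(1-x)^{N/2}]_1)\ \text{ as } x\to1.$$ Moreover, for $0\le s<R$, every $C^2$ solution $y$ of $\mathcal Ly=\lambda y$ on $(s,R)$ that is not a constant multiple of $\Phi$ there fails to belong to $L^2((t,R),r^4\rho\,dr)$ for every $t\in[s,R)$. -/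

import Mathlib

open MeasureTheory Filter Topology Set

namespace Stellar

noncomputable section

/-- The pressure `P = A ρ^γ` along a density profile `ρ`. -/
def pressure (A γ : ℝ) (ρ : ℝ → ℝ) (r : ℝ) : ℝ := A * ρ r ^ γ

/-- `ρ` is a spherically symmetric equilibrium of radius `R` and central density `ρc`: it is
positive on `0 < r < R`, satisfies `-(1/r²) d/dr ((r²/ρ) dP/dr) = 4π g₀ ρ` there, tends to `ρc`
at the centre and vanishes at the surface. Values of `ρ` outside `(0, R)` are irrelevant. -/
structure IsEquilibrium (A γ g₀ R ρc : ℝ) (ρ : ℝ → ℝ) : Prop where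
  radius_pos : 0 < R
  central_pos : 0 < ρc
  contDiffOn : ContDiffOn ℝ 2 ρ (Ioo 0 R)
  pos : ∀ r ∈ Ioo 0 R, 0 < ρ r
  equation : ∀ r ∈ Ioo 0 R,
    -(1 / r ^ 2) * deriv (fun s => s ^ 2 / ρ s * deriv (pressure A γ ρ) s) r
      = 4 * Real.pi * g₀ * ρ r
  tendsto_center : Tendsto ρ (𝓝[>] 0) (𝓝 ρc)
  tendsto_surface : Tendsto ρ (𝓝[<] R) (𝓝 0)

/-- The differential expression
`𝓛 y = -(1/(ρ r⁴)) (γ r⁴ P y')' + (1/(ρ r)) (4 - 3γ) P' y`. -/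
def opL (A γ : ℝ) (ρ y : ℝ → ℝ) (r : ℝ) : ℝ :=
  -(1 / (ρ r * r ^ 4)) * deriv (fun s => γ * s ^ 4 * pressure A γ ρ s * deriv y s) r
    + 1 / (ρ r * r) * (4 - 3 * γ) * deriv (pressure A γ ρ) r * y r

/-- The measure `r⁴ ρ(r) dr` on `(0, R)`. -/
def weight (R : ℝ) (ρ : ℝ → ℝ) : Measure ℝ :=
  (volume.restrict (Ioo 0 R)).withDensity (fun r => ENNReal.ofReal (r ^ 4 * ρ r))

/-- `φ ∈ C₀^∞(0, R)`. -/
def IsTest (R : ℝ) (φ : ℝ → ℝ) : Prop :=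
  ContDiff ℝ (⊤ : ℕ∞) φ ∧ HasCompactSupport φ ∧ tsupport φ ⊆ Ioo 0 R

/-- The quadratic form `(𝓛 φ | φ)` in `L²((0, R), r⁴ ρ dr)` of a test function `φ`. -/
def form (A γ R : ℝ) (ρ φ : ℝ → ℝ) : ℝ :=
  ∫ r, opL A γ ρ φ r * φ r ∂(weight R ρ)

/-- The pair `(u, f)` belongs to the graph of the Friedrichs extension in `L²((0, R), r⁴ ρ dr)` of
`𝓛` with domain `C₀^∞(0, R)`: `u` and `f` are in `L²`, `u` is the `L²`-limit of test functions that
form a Cauchy sequence for the quadratic form, and `𝓛 u = f` in the sense of distributions.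
(Adding `c ‖φ‖²` to the form, to make it positive, would change nothing, because the sequence
is already Cauchy in `L²`.) -/
def FriedrichsGraph (A γ R : ℝ) (ρ u f : ℝ → ℝ) : Prop :=
  MemLp u 2 (weight R ρ) ∧ MemLp f 2 (weight R ρ) ∧
  (∃ φ : ℕ → ℝ → ℝ, (∀ n, IsTest R (φ n)) ∧
    Tendsto (fun n => eLpNorm (fun r => φ n r - u r) 2 (weight R ρ)) atTop (𝓝 0) ∧
    Tendsto (fun p : ℕ × ℕ => form A γ R ρ (fun r => φ p.1 r - φ p.2 r)) atTop (𝓝 0)) ∧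
  ∀ φ : ℝ → ℝ, IsTest R φ →
    ∫ r, u r * opL A γ ρ φ r ∂(weight R ρ) = ∫ r, f r * φ r ∂(weight R ρ)

/-- `Φ` is an eigenfunction, with eigenvalue `lam`, of the Friedrichs extension of `𝓛`. -/
def IsEigenfunction (A γ R : ℝ) (ρ : ℝ → ℝ) (lam : ℝ) (Φ : ℝ → ℝ) : Prop :=
  FriedrichsGraph A γ R ρ Φ (fun r => lam * Φ r) ∧ ¬ (Φ =ᵐ[weight R ρ] fun _ => 0)

/-- `y` is a (classical) solution of `𝓛 y = lam y` on the interval `(s, R)`. -/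
def IsSolution (A γ R : ℝ) (ρ : ℝ → ℝ) (lam s : ℝ) (y : ℝ → ℝ) : Prop :=
  ContDiffOn ℝ 2 y (Ioo s R) ∧ ∀ r ∈ Ioo s R, opL A γ ρ y r = lam * y r

/-- The Liouville variable `ξ(r) = ∫₀^r √(ρ / (γ P)) dr`; `ξ(R)` is `ξ₊`. -/
def xi (A γ : ℝ) (ρ : ℝ → ℝ) (r : ℝ) : ℝ :=
  ∫ s in (0 : ℝ)..r, √(ρ s / (γ * pressure A γ ρ s))

/-- The angle `θ = κ ξ / 2` with `κ = π / ξ₊`. -/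
def angle (A γ R : ℝ) (ρ : ℝ → ℝ) (r : ℝ) : ℝ :=
  Real.pi / xi A γ ρ R * xi A γ ρ r / 2

/-- The variable `x = tan²θ / (1 + tan²θ)`, which runs over `(0, 1)` while `r` runs over
`(0, R)`. -/
def xvar (A γ R : ℝ) (ρ : ℝ → ℝ) (r : ℝ) : ℝ :=
  Real.tan (angle A γ R ρ r) ^ 2 / (1 + Real.tan (angle A γ R ρ r) ^ 2)

/-- The parameter `N = 2γ / (γ - 1)`. -/
def indexN (γ : ℝ) : ℝ := 2 * γ / (γ - 1)

/-- `f(X) = [X]₁`: a convergent power series in `X` without constant term. -/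
def IsSeriesOne (f : ℝ → ℝ) : Prop := AnalyticAt ℝ f 0 ∧ f 0 = 0

/-- `g(X, Y) = [X, Y]₁`: a convergent double power series in `X, Y` without constant term. -/
def IsSeriesTwo (g : ℝ × ℝ → ℝ) : Prop := AnalyticAt ℝ g (0, 0) ∧ g (0, 0) = 0

end

end Stellar

/-! Put h = Aγ/(γ-1) ρ^(γ-1), the enthalpy. The structure equation becomes h' = -r·`grav`, where
r³·`grav` = 4πg₀ ∫₀ʳ ρ s² ds. Integration gives closed integral equations at both ends. At the
centre the small parameter is r². At depth z = R - r the enthalpy vanishes linearly, so ρ is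
z^(1/(γ-1)) times a positive function. The mass of the outer shell then brings in z^(γ/(γ-1)), and
the parameters are the pair (z, z^(γ/(γ-1))).

Analyticity in such parameters is obtained in the Banach algebra `C(I01, ℝ)`. The path t ↦ f(tz) is
viewed as an analytic function of the parameter p(z). Averages ∫₀¹ uᵃ f(uz) du are bounded linear
operators on paths, and powers act by power series. Each integral equation thus reads W = g(p) +
ℓ(p) T(p, W) with g, T analytic, ℓ linear and p(z) → 0. The analytic inverse function theorem
(`exists_analytic_fixedPoint`) gives a locally unique solution analytic in p, and uniqueness
identifies it with the given function (`IsAn.of_fixedPoint`).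

The eigenvalue equation takes, near each end, the form (zᵐ c y')' = zⁿ e y with c, e analytic in the
parameters and c(0) > 0. Here m = n = 4 at the centre, and n = 1/(γ-1), m = n + 1 at the surface.
There is a regular solution y₁ with y₁(0) = 1 (`exists_regular_solution`). For any solution y the
Wronskian w is constant and (y/y₁)' = w/(zᵐ c y₁²). If w ≠ 0, then y is at least of size z^(1-m),
which is not square integrable with weight zⁿ once 2m ≥ n + 3 (`eq_mul_regular_solution`). This
inequality is 8 ≥ 7 at the centre and amounts to γ ≤ 2 at the surface. Both ends are therefore of
limit point type, and square integrability forces a multiple of y₁. This gives the expansions, and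
also the last claim, since two L² solutions near R are multiples of the same y₁.

An eigenfunction is first a distributional solution. A du Bois-Reymond argument
(`exists_classical_solution`) makes it classical, and ODE uniqueness makes C₀ and C₁ nonzero.
Finally x = sin²θ, so x is r² times a positive analytic function of r², and 1 - x is z times a
positive analytic function of (z, z^(γ/(γ-1))). Inverting these changes of parameter transfers the
expansions to x. -/

namespace Stellar

noncomputable section

/-! ### Analytic maps on spaces of continuous functions -/

section

/-- Local analytic left inverse of an analytic map with invertible derivative. -/
theorem exists_analytic_inverse {E F : Type*} [NormedAddCommGroup E] [NormedSpace ℝ E]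
    [CompleteSpace E] [NormedAddCommGroup F] [NormedSpace ℝ F] [CompleteSpace F]
    {H : E → F} {a : E} (hH : AnalyticAt ℝ H a) (L : E ≃L[ℝ] F)
    (hL : HasFDerivAt H (L : E →L[ℝ] F) a) :
    ∃ K : F → E, AnalyticAt ℝ K (H a) ∧ (∀ᶠ p in 𝓝 a, K (H p) = p) ∧
      (∀ᶠ q in 𝓝 (H a), H (K q) = q) ∧ K (H a) = a := by
  have hs : HasStrictFDerivAt H (L : E →L[ℝ] F) a := by
    have := hH.hasStrictFDerivAt
    rwa [hL.fderiv] at this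
  let e := hs.toOpenPartialHomeomorph H
  have ha : a ∈ e.source := hs.mem_toOpenPartialHomeomorph_source
  refine ⟨e.symm, ?_, ?_, ?_, ?_⟩
  · exact e.analyticAt_symm' ha hH hL.fderiv
  · exact hs.eventually_left_inverse
  · exact hs.eventually_right_inverse
  · exact e.left_inv ha

/-- Analytic dependence on parameters of the solution of `W = g p + ℓ p • T (p, W)`. -/
theorem exists_analytic_fixedPoint {P E : Type*} [NormedAddCommGroup P] [NormedSpace ℝ P]
    [CompleteSpace P] [NormedAddCommGroup E] [NormedSpace ℝ E] [CompleteSpace E]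
    (g : P → E) (ℓ : P →L[ℝ] ℝ) (T : P × E → E) (hg : AnalyticAt ℝ g 0)
    (hT : AnalyticAt ℝ T (0, g 0)) :
    ∃ Ω : P → E, AnalyticAt ℝ Ω 0 ∧ Ω 0 = g 0 ∧
      (∀ᶠ p in 𝓝 (0 : P), Ω p = g p + ℓ p • T (p, Ω p)) ∧
      ∀ᶠ q in 𝓝 ((0 : P), g 0), q.2 = g q.1 + ℓ q.1 • T q → q.2 = Ω q.1 := by
  -- The fixed points over p are exactly the solutions of H(p, W) = (p, 0).
  let H : P × E → P × E := fun q => (q.1, q.2 - g q.1 - ℓ q.1 • T q)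
  have hg1 : AnalyticAt ℝ (fun q : P × E => g q.1) (0, g 0) :=
    AnalyticAt.fun_comp (g := g) hg analyticAt_fst
  have hl1 : AnalyticAt ℝ (fun q : P × E => ℓ q.1) (0, g 0) :=
    AnalyticAt.fun_comp (g := ℓ) (ℓ.analyticAt _) analyticAt_fst
  have hH : AnalyticAt ℝ H (0, g 0) :=
    analyticAt_fst.prod ((analyticAt_snd.sub hg1).sub (hl1.smul hT))
  obtain ⟨g', hg'⟩ := hg.differentiableAt
  obtain ⟨T', hT'⟩ := hT.differentiableAt
  let B : P →L[ℝ] E := g' + ℓ.smulRight (T (0, g 0))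
  -- Since ℓ 0 = 0, the derivative of T drops out at the base point. The derivative of H is
  -- unipotent, (p, W) ↦ (p, W - B p), and is inverted by changing a sign.
  let L : (P × E) ≃L[ℝ] (P × E) :=
    ContinuousLinearEquiv.equivOfInverse
      ((ContinuousLinearMap.fst ℝ P E).prod
        (ContinuousLinearMap.snd ℝ P E - B.comp (ContinuousLinearMap.fst ℝ P E)))
      ((ContinuousLinearMap.fst ℝ P E).prod
        (ContinuousLinearMap.snd ℝ P E + B.comp (ContinuousLinearMap.fst ℝ P E)))
      (fun x => by ext <;> simp) (fun x => by ext <;> simp)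
  have hL : HasFDerivAt H (L : (P × E) →L[ℝ] (P × E)) (0, g 0) := by
    have h1 : HasFDerivAt (fun q : P × E => q.1) (ContinuousLinearMap.fst ℝ P E) (0, g 0) :=
      hasFDerivAt_fst
    have h2 : HasFDerivAt (fun q : P × E => q.2) (ContinuousLinearMap.snd ℝ P E) (0, g 0) :=
      hasFDerivAt_snd
    have h3 : HasFDerivAt (fun q : P × E => g q.1) (g'.comp (ContinuousLinearMap.fst ℝ P E))
        (0, g 0) := HasFDerivAt.comp (g := g) (0, g 0) hg' h1
    have h4 : HasFDerivAt (fun q : P × E => ℓ q.1) (ℓ.comp (ContinuousLinearMap.fst ℝ P E))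
        (0, g 0) := HasFDerivAt.comp (g := ℓ) (0, g 0) ℓ.hasFDerivAt h1
    have h5 := h1.prodMk ((h2.sub h3).sub (h4.smul hT'))
    refine h5.congr_fderiv ?_
    ext q
    · simp [L, B]
    · simp [L, B, sub_eq_add_neg, add_comm]
    · simp [L, B]
    · simp [L, B]
  obtain ⟨K, hK, hl, hr, h0⟩ := exists_analytic_inverse hH L hL
  have H0 : H (0, g 0) = (0, 0) := by simp [H]
  rw [H0] at hK hr h0
  have hK0 : AnalyticAt ℝ (fun p : P => K (p, 0)) 0 :=
    AnalyticAt.fun_comp (g := K) hK (analyticAt_id.prod analyticAt_const)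
  refine ⟨fun p => (K (p, 0)).2, analyticAt_snd.fun_comp hK0, by simp [h0], ?_, ?_⟩
  · have ht : Tendsto (fun p : P => (p, (0 : E))) (𝓝 0) (𝓝 (0, 0)) :=
      (Continuous.prodMk continuous_id continuous_const).tendsto' _ _ rfl
    filter_upwards [ht.eventually hr] with p hp
    have e1 := congrArg Prod.fst hp
    have e2 := congrArg Prod.snd hp
    simp only [H] at e1 e2
    have e3 : K (p, 0) = (p, (K (p, 0)).2) := Prod.ext e1 rfl
    rw [e1, sub_sub, sub_eq_zero] at e2
    rw [← e3]
    exact e2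
  · filter_upwards [hl] with q hq hfix
    have : H q = (q.1, 0) := by
      simp only [H, Prod.mk.injEq, true_and]
      rw [sub_sub, sub_eq_zero]; exact hfix
    rw [this] at hq
    rw [hq]

abbrev I01 : Type := unitInterval

/-- Superposition by an analytic function is analytic on `C(I, ℝ)` at constants. -/
theorem exists_analytic_superposition {f : ℝ → ℝ} {x₀ : ℝ} (hf : AnalyticAt ℝ f x₀) :
    ∃ F : C(I01, ℝ) → C(I01, ℝ), AnalyticAt ℝ F (ContinuousMap.const _ x₀) ∧
      F (ContinuousMap.const _ x₀) = ContinuousMap.const _ (f x₀) ∧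
      ∀ᶠ W in 𝓝 (ContinuousMap.const I01 x₀), ∀ t, F W t = f (W t) := by
  obtain ⟨p, hp⟩ := hf
  -- The same Taylor coefficients, now with powers taken in the Banach algebra; evaluation at t
  -- recovers the scalar series.
  let s := FormalMultilinearSeries.ofScalars C(I01, ℝ) (𝕜 := ℝ) p.coeff
  obtain ⟨r, hr⟩ := hp
  have hrad : p.radius ≤ s.radius := by
    apply ENNReal.le_of_forall_nnreal_lt
    intro r hr
    obtain ⟨C, -, hC⟩ := p.norm_mul_pow_le_of_lt_radius hr
    refine s.le_radius_of_bound C fun n => ?_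
    have := hC n
    rw [p.norm_apply_eq_norm_coef] at this
    simpa [s, FormalMultilinearSeries.ofScalars_norm] using this
  have hspos : 0 < s.radius := lt_of_lt_of_le (lt_of_lt_of_le hr.r_pos hr.r_le) hrad
  have hs := s.hasFPowerSeriesOnBall hspos
  have hev : ∀ᶠ W in 𝓝 (ContinuousMap.const I01 x₀), ∀ t,
      s.sum (W - ContinuousMap.const I01 x₀) t = f (W t) := by
    have hmem : Metric.eball (ContinuousMap.const I01 x₀) r ∈ 𝓝 (ContinuousMap.const I01 x₀) :=
      Metric.eball_mem_nhds _ hr.r_pos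
    filter_upwards [hmem] with W hW t
    have hW' : W - ContinuousMap.const I01 x₀ ∈ Metric.eball (0 : C(I01, ℝ)) r := by
      rw [Metric.mem_eball, edist_eq_enorm_sub] at hW ⊢
      simpa using hW
    have h1 := hs.hasSum (Metric.eball_subset_eball (hr.r_le.trans hrad) hW')
    have h2 := h1.mapL (ContinuousMap.evalCLM ℝ t)
    have hWt : W t - x₀ ∈ Metric.eball (0 : ℝ) r := by
      rw [Metric.mem_eball, edist_eq_enorm_sub, sub_zero] at hW' ⊢
      refine lt_of_le_of_lt ?_ hW'
      rw [← ofReal_norm, ← ofReal_norm]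
      exact ENNReal.ofReal_le_ofReal
        ((W - ContinuousMap.const I01 x₀).norm_coe_le_norm t)
    have h3 := hr.hasSum hWt
    rw [add_sub_cancel] at h3
    refine HasSum.unique ?_ h3
    simp only [zero_add] at h2
    convert! h2 using 2 with n
    simp [s, FormalMultilinearSeries.ofScalars_apply_eq, mul_comm]
  refine ⟨fun W => s.sum (W - ContinuousMap.const I01 x₀), ?_, ?_, hev⟩
  · refine AnalyticAt.fun_comp (g := s.sum) ?_ (analyticAt_id.sub analyticAt_const)
    simpa using hs.analyticAt
  · ext t
    simpa using hev.self_of_nhds t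

/-! ### Weighted averages over the unit interval. -/

theorem integral_I (g : ℝ → ℝ) : ∫ u : I01, g u = ∫ u in (0 : ℝ)..1, g u := by
  rw [intervalIntegral.integral_of_le zero_le_one, ← integral_Icc_eq_integral_Ioc]
  exact integral_subtype_comap measurableSet_Icc g

theorem integrable_rpow_I {a : ℝ} (ha : -1 < a) :
    Integrable (fun u : I01 => (u : ℝ) ^ a) := by
  have : IntegrableOn (fun u : ℝ => u ^ a) (Icc 0 1) := by
    rw [integrableOn_Icc_iff_integrableOn_Ioc,
      ← intervalIntegrable_iff_integrableOn_Ioc_of_le zero_le_one]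
    exact intervalIntegral.intervalIntegrable_rpow' ha
  exact (integrableOn_iff_comap_subtypeVal measurableSet_Icc).1 this

theorem integrable_rpow_mul_I {a : ℝ} (ha : -1 < a) (f : C(I01, ℝ)) :
    Integrable (fun u : I01 => (u : ℝ) ^ a * f u) := by
  refine ((integrable_rpow_I ha).bdd_mul (c := ‖f‖) f.continuous.aestronglyMeasurable
    (Eventually.of_forall f.norm_coe_le_norm)).congr (Eventually.of_forall fun u => ?_)
  simp [mul_comm]

theorem integral_rpow_I {a : ℝ} (ha : -1 < a) : ∫ u : I01, (u : ℝ) ^ a = 1 / (a + 1) := by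
  rw [integral_I (fun u => u ^ a), integral_rpow (Or.inl ha)]
  simp [Real.zero_rpow (by linarith : a + 1 ≠ 0)]

/-- The path `u ↦ f (u t)` on the unit interval. -/
def dilate (t : I01) (f : C(I01, ℝ)) : C(I01, ℝ) := f.comp ⟨fun u => u * t, by fun_prop⟩

/-- The averaging operator `(avg f)(t) = ∫₀¹ uᵃ f(ut) du`. -/
def avgCLM (a : ℝ) (ha : -1 < a) : C(I01, ℝ) →L[ℝ] C(I01, ℝ) :=
  LinearMap.mkContinuous
    { toFun := fun f =>
        { toFun := fun t => ∫ u : I01, (u : ℝ) ^ a * f (u * t)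
          continuous_toFun := by
            refine continuous_of_dominated (bound := fun u : I01 => (u : ℝ) ^ a * ‖f‖)
              (fun t => (integrable_rpow_mul_I ha (dilate t f)).aestronglyMeasurable)
              (fun t => Eventually.of_forall fun u => ?_) ((integrable_rpow_I ha).mul_const _)
              (Eventually.of_forall fun u => by fun_prop)
            rw [norm_mul, Real.norm_of_nonneg (Real.rpow_nonneg u.2.1 a)]
            exact mul_le_mul_of_nonneg_left (f.norm_coe_le_norm _) (Real.rpow_nonneg u.2.1 a) }
      map_add' := fun f g => by
        ext t
        simp only [ContinuousMap.coe_mk, ContinuousMap.add_apply, mul_add]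
        exact integral_add (integrable_rpow_mul_I ha (dilate t f))
          (integrable_rpow_mul_I ha (dilate t g))
      map_smul' := fun c f => by
        ext t
        simp only [ContinuousMap.coe_mk, ContinuousMap.smul_apply, smul_eq_mul, RingHom.id_apply,
          ← integral_const_mul]
        exact integral_congr_ae (Eventually.of_forall fun u => by ring) }
    (1 / (a + 1)) fun f => by
      have h0 : 0 < a + 1 := by linarith
      refine (ContinuousMap.norm_le _ (by positivity)).2 fun t => ?_
      simp only [LinearMap.coe_mk, AddHom.coe_mk, ContinuousMap.coe_mk]
      rw [← integral_rpow_I ha, ← integral_mul_const]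
      refine norm_integral_le_of_norm_le ((integrable_rpow_I ha).mul_const _)
        (Eventually.of_forall fun u => ?_)
      rw [norm_mul, Real.norm_of_nonneg (Real.rpow_nonneg u.2.1 a)]
      exact mul_le_mul_of_nonneg_left (f.norm_coe_le_norm _) (Real.rpow_nonneg u.2.1 a)

theorem avgCLM_apply {a : ℝ} (ha : -1 < a) (f : C(I01, ℝ)) (t : I01) :
    avgCLM a ha f t = ∫ u : I01, (u : ℝ) ^ a * f (u * t) := rfl

theorem avgCLM_const {a : ℝ} (ha : -1 < a) (c : ℝ) :
    avgCLM a ha (ContinuousMap.const _ c) = ContinuousMap.const _ (c / (a + 1)) := by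
  ext t
  simp only [avgCLM_apply, ContinuousMap.const_apply]
  rw [integral_mul_const, integral_rpow_I ha]; ring

/-- The weighted average `∫₀¹ uᵃ f(uz) du`. -/
def avg (a : ℝ) (f : ℝ → ℝ) (z : ℝ) : ℝ := ∫ u : I01, (u : ℝ) ^ a * f (u * z)

theorem avg_zero {a : ℝ} (ha : -1 < a) (f : ℝ → ℝ) : avg a f 0 = f 0 / (a + 1) := by
  simp only [avg, mul_zero]
  rw [integral_mul_const, integral_rpow_I ha]; ring

/-- Substitution s = uz. It trades a primitive vanishing at 0 for a power of z times an average that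
stays regular at 0. -/
theorem rpow_mul_avg {a : ℝ} (f : ℝ → ℝ) {z : ℝ} (hz : 0 < z) :
    z ^ (a + 1) * avg a f z = ∫ s in (0 : ℝ)..z, s ^ a * f s := by
  have h := intervalIntegral.integral_comp_mul_right (a := 0) (b := 1)
    (fun s => s ^ a * f s) hz.ne'
  simp only [zero_mul, one_mul, smul_eq_mul] at h
  rw [inv_mul_eq_div, eq_div_iff hz.ne'] at h
  rw [← h, avg, integral_I (fun u => u ^ a * f (u * z)), Real.rpow_add hz, Real.rpow_one,
    mul_right_comm, mul_comm _ z, mul_comm _ z,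
    ← intervalIntegral.integral_const_mul]
  congr 1
  refine intervalIntegral.integral_congr fun u hu => ?_
  rw [uIcc_of_le zero_le_one] at hu
  simp only [Real.mul_rpow hu.1 hz.le]
  ring

theorem intervalIntegrable_rpow_mul {a z : ℝ} (ha : -1 < a) {f : ℝ → ℝ} (hz : 0 ≤ z)
    (hf : ContinuousOn f (Icc 0 z)) :
    IntervalIntegrable (fun s => s ^ a * f s) volume 0 z :=
  (intervalIntegral.intervalIntegrable_rpow' ha).mul_continuousOn (by rwa [uIcc_of_le hz])

theorem hasDerivAt_rpow_mul_avg {a ε : ℝ} (ha : -1 < a) {f : ℝ → ℝ}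
    (hf : ContinuousOn f (Icc 0 ε)) {z : ℝ} (hz : z ∈ Ioo 0 ε) :
    HasDerivAt (fun z => z ^ (a + 1) * avg a f z) (z ^ a * f z) z := by
  have h1 : HasDerivAt (fun z => ∫ s in (0 : ℝ)..z, s ^ a * f s) (z ^ a * f z) z := by
    have hfz : ∀ x ∈ Ioo 0 ε, ContinuousAt f x := fun x hx =>
      hf.continuousAt (Icc_mem_nhds hx.1 hx.2)
    have hc : ∀ x ∈ Ioo 0 ε, ContinuousAt (fun s => s ^ a * f s) x := fun x hx =>
      (Real.continuousAt_rpow_const x a (Or.inl hx.1.ne')).mul (hfz x hx)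
    refine intervalIntegral.integral_hasDerivAt_right
      (intervalIntegrable_rpow_mul ha hz.1.le (hf.mono (Icc_subset_Icc_right hz.2.le))) ?_
      (hc z hz)
    exact ContinuousOn.stronglyMeasurableAtFilter isOpen_Ioo
      (fun x hx => (hc x hx).continuousWithinAt) z hz
  refine h1.congr_of_eventuallyEq ?_
  filter_upwards [Ioi_mem_nhds hz.1] with x hx
  exact rpow_mul_avg f hx

/-- A function with derivative `zᵃ f(z)` and limit `0` at `0` is `zᵃ⁺¹` times an average. -/
theorem eq_rpow_mul_avg {a ε : ℝ} (ha : -1 < a) {f F : ℝ → ℝ}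
    (hf : ContinuousOn f (Icc 0 ε)) (hF : ∀ z ∈ Ioo 0 ε, HasDerivAt F (z ^ a * f z) z)
    (hF0 : Tendsto F (𝓝[>] 0) (𝓝 0)) {z : ℝ} (hz : z ∈ Ioo 0 ε) :
    F z = z ^ (a + 1) * avg a f z := by
  rw [rpow_mul_avg f hz.1]
  have hFz : ContinuousWithinAt F (Iio z) z := (hF z hz).continuousAt.continuousWithinAt
  have := intervalIntegral.integral_eq_sub_of_hasDerivAt_of_tendsto hz.1
    (fun x hx => hF x ⟨hx.1, hx.2.trans hz.2⟩)
    (intervalIntegrable_rpow_mul ha hz.1.le (hf.mono (Icc_subset_Icc_right hz.2.le)))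
    hF0 hFz
  rw [this, sub_zero]

end

/-! ### Analytic functions of a parameter and regular singular endpoints -/

section

variable {P : Type*} [NormedAddCommGroup P] [NormedSpace ℝ P]

/-- `f` is, near `0⁺`, an analytic function of the parameter `p z`, uniformly along the paths
`t ↦ f (t z)`. -/
def IsAn (p : ℝ → P) (f : ℝ → ℝ) : Prop :=
  ∃ Ω : P → C(I01, ℝ), AnalyticAt ℝ Ω 0 ∧ Ω 0 = ContinuousMap.const _ (f 0) ∧
    ∀ᶠ z in 𝓝[>] (0 : ℝ), ∀ t : I01, f (t * z) = Ω (p z) t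

namespace IsAn

variable {p : ℝ → P} {f g : ℝ → ℝ}

theorem const (c : ℝ) : IsAn p (fun _ => c) :=
  ⟨fun _ => ContinuousMap.const _ c, analyticAt_const, rfl, Eventually.of_forall fun _ _ => rfl⟩

theorem add (hf : IsAn p f) (hg : IsAn p g) : IsAn p (fun z => f z + g z) := by
  obtain ⟨F, hF, hF0, hFf⟩ := hf
  obtain ⟨G, hG, hG0, hGg⟩ := hg
  refine ⟨fun q => F q + G q, hF.add hG, ?_, ?_⟩
  · simp only [hF0, hG0]; rfl
  · filter_upwards [hFf, hGg] with z h1 h2 t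
    rw [h1, h2]; rfl

theorem mul (hf : IsAn p f) (hg : IsAn p g) : IsAn p (fun z => f z * g z) := by
  obtain ⟨F, hF, hF0, hFf⟩ := hf
  obtain ⟨G, hG, hG0, hGg⟩ := hg
  refine ⟨fun q => F q * G q, hF.mul hG, ?_, ?_⟩
  · simp only [hF0, hG0]; rfl
  · filter_upwards [hFf, hGg] with z h1 h2 t
    rw [h1, h2]; rfl

theorem sub (hf : IsAn p f) (hg : IsAn p g) : IsAn p (fun z => f z - g z) := by
  simpa [sub_eq_add_neg] using hf.add ((const (p := p) (-1)).mul hg)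

/-- At parameter 0 the path is constant, which is where superposition by an analytic function is
known to be analytic. -/
theorem comp (hp : Tendsto p (𝓝[>] 0) (𝓝 0)) {φ : ℝ → ℝ} (hφ : AnalyticAt ℝ φ (f 0))
    (hf : IsAn p f) : IsAn p (fun z => φ (f z)) := by
  obtain ⟨F, hF, hF0, hFf⟩ := hf
  obtain ⟨S, hS, hS0, hSφ⟩ := exists_analytic_superposition hφ
  rw [← hF0] at hS hS0 hSφ
  refine ⟨fun q => S (F q), hS.fun_comp hF, hS0, ?_⟩
  filter_upwards [hFf, (hF.continuousAt.tendsto.comp hp).eventually hSφ] with z h1 h2 t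
  rw [h1]; exact (h2 t).symm

theorem congr (hf : IsAn p f) (h0 : g 0 = f 0) (h : ∀ᶠ z in 𝓝[>] (0 : ℝ), g z = f z) :
    IsAn p g := by
  obtain ⟨F, hF, hF0, hFf⟩ := hf
  refine ⟨F, hF, by rw [hF0, h0], ?_⟩
  obtain ⟨ε, hε, hεg⟩ := mem_nhdsGT_iff_exists_Ioo_subset.1 h
  filter_upwards [hFf, Ioo_mem_nhdsGT hε] with z h1 h2 t
  rw [← h1]
  -- The endpoint t = 0 reads the value at 0, which the one-sided filter does not see; this is what
  -- `h0` is for.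
  rcases t.2.1.eq_or_lt with ht | ht
  · rw [← ht]; simpa using h0
  · exact hεg ⟨mul_pos ht h2.1, (mul_le_of_le_one_left h2.1.le t.2.2).trans_lt h2.2⟩

end IsAn

/-- The average at tz only samples f at the points (ut)z, which lie on the same path, so it acts on
paths independently of z. -/
theorem avg_path {a : ℝ} (ha : -1 < a) {f : ℝ → ℝ} {F : C(I01, ℝ)} {z : ℝ}
    (h : ∀ t : I01, f (t * z) = F t) (t : I01) : avg a f (t * z) = avgCLM a ha F t := by
  rw [avgCLM_apply, avg]
  refine integral_congr_ae (Eventually.of_forall fun u => ?_)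
  have := h (u * t)
  simp only [Icc.coe_mul, mul_assoc] at this
  simp [this]

namespace IsAn

variable {p : ℝ → P} {f g : ℝ → ℝ}

/-- Closure under integration is the reason `IsAn` follows whole paths and not only the value at z:
on paths, averaging is a bounded linear operator. -/
theorem avg {a : ℝ} (ha : -1 < a) (hf : IsAn p f) : IsAn p (avg a f) := by
  obtain ⟨F, hF, hF0, hFf⟩ := hf
  refine ⟨fun q => avgCLM a ha (F q), ((avgCLM a ha).analyticAt _).fun_comp hF, ?_, ?_⟩
  · simp only [hF0, avgCLM_const, avg_zero ha]
  · filter_upwards [hFf] with z h1 t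
    exact avg_path ha h1 t

/-- The path `t ↦ tᵇ`. -/
def _root_.Stellar.powPath (b : ℝ) (hb : 0 ≤ b) : C(I01, ℝ) :=
  ⟨fun t => (t : ℝ) ^ b, by
    exact (Real.continuous_rpow_const hb).comp continuous_subtype_val⟩

theorem rpow {b : ℝ} (hb : 0 < b) (ℓ : P →L[ℝ] ℝ) (hℓ : ∀ z : ℝ, 0 < z → ℓ (p z) = z ^ b) :
    IsAn p (fun z => z ^ b) := by
  refine ⟨fun q => ℓ q • powPath b hb.le, (ℓ.analyticAt _).smul analyticAt_const, ?_, ?_⟩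
  · ext t; simp [Real.zero_rpow hb.ne']
  · filter_upwards [self_mem_nhdsWithin] with z hz t
    rw [hℓ z hz, Real.mul_rpow t.2.1 (le_of_lt hz), mul_comm]; rfl

theorem exists_expansion (hf : IsAn p f) :
    ∃ G : P → ℝ, AnalyticAt ℝ G 0 ∧ G 0 = f 0 ∧ ∀ᶠ z in 𝓝[>] (0 : ℝ), f z = G (p z) := by
  obtain ⟨F, hF, hF0, hFf⟩ := hf
  refine ⟨fun q => ContinuousMap.evalCLM ℝ (1 : I01) (F q),
    ((ContinuousMap.evalCLM ℝ (1 : I01)).analyticAt _).fun_comp hF, by simp [hF0], ?_⟩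
  filter_upwards [hFf] with z h
  simpa using h 1

/-- One admissible ε suffices: the continuous path at parameter p ε, rescaled, is f on [0, ε]. -/
theorem exists_continuousOn (hf : IsAn p f) : ∃ ε > 0, ContinuousOn f (Icc 0 ε) := by
  obtain ⟨F, hF, hF0, hFf⟩ := hf
  obtain ⟨ε, hF, hε⟩ := (hFf.and self_mem_nhdsWithin).exists
  refine ⟨ε, hε, ?_⟩
  have hε' : (0 : ℝ) < ε := hε
  have : ContinuousOn (fun x => F (p ε) (projIcc 0 1 zero_le_one (x / ε))) (Icc 0 ε) :=
    (by fun_prop : Continuous fun x => F (p ε) (projIcc 0 1 zero_le_one (x / ε))).continuousOn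
  refine this.congr fun x hx => ?_
  have hx' : x / ε ∈ Icc (0 : ℝ) 1 :=
    ⟨div_nonneg hx.1 hε'.le, (div_le_one hε').2 hx.2⟩
  simp only [projIcc_of_mem _ hx', ← hF]
  rw [div_mul_cancel₀ _ hε'.ne']

theorem tendsto (hf : IsAn p f) : Tendsto f (𝓝[>] 0) (𝓝 (f 0)) := by
  obtain ⟨ε, hε, h⟩ := hf.exists_continuousOn
  exact ((h 0 ⟨le_rfl, hε.le⟩).mono Ioc_subset_Icc_self).mono_left
    (nhdsWithin_le_iff.2 (Ioc_mem_nhdsGT hε))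

/-- A continuous solution of a fixed point equation with analytic parameters belongs to the
class. -/
theorem of_fixedPoint [CompleteSpace P] (hp : Tendsto p (𝓝[>] 0) (𝓝 0)) (ℓ : P →L[ℝ] ℝ)
    (g : P → C(I01, ℝ))
    (T : P × C(I01, ℝ) → C(I01, ℝ)) (hg : AnalyticAt ℝ g 0)
    (hg0 : g 0 = ContinuousMap.const _ (f 0))
    (hT : AnalyticAt ℝ T (0, g 0)) {ε : ℝ} (hε : 0 < ε) (hf : ContinuousOn f (Icc 0 ε))
    (heq : ∀ᶠ z in 𝓝[>] (0 : ℝ), ∀ W : C(I01, ℝ), (∀ t : I01, f (t * z) = W t) →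
      ∀ t, W t = g (p z) t + ℓ (p z) * T (p z, W) t) : IsAn p f := by
  obtain ⟨Ω, hΩ, hΩ0, -, huniq⟩ := exists_analytic_fixedPoint g ℓ T hg hT
  refine ⟨Ω, hΩ, hΩ0.trans hg0, ?_⟩
  have hfc : Continuous (IccExtend hε.le (domRestrict (Icc 0 ε) f)) :=
    (continuousOn_iff_continuous_domRestrict.1 hf).Icc_extend'
  let fe := IccExtend hε.le (domRestrict (Icc 0 ε) f)
  let W : ℝ → C(I01, ℝ) := fun z => ⟨fun t => fe (t * z), by fun_prop⟩
  have hW : ∀ z ∈ Ioo 0 ε, ∀ t : I01, f (t * z) = W z t := by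
    intro z hz t
    have : (t : ℝ) * z ∈ Icc 0 ε :=
      ⟨mul_nonneg t.2.1 hz.1.le, (mul_le_of_le_one_left hz.1.le t.2.2).trans hz.2.le⟩
    simp only [W, fe, ContinuousMap.coe_mk, IccExtend_of_mem _ _ this, domRestrict_apply]
  have hWc : Continuous W := by
    refine ContinuousMap.continuous_of_continuous_uncurry _ ?_
    exact hfc.comp (by fun_prop : Continuous fun q : ℝ × I01 => (q.2 : ℝ) * q.1)
  have hW0 : W 0 = g 0 := by
    ext t
    simp only [W, fe, ContinuousMap.coe_mk, mul_zero, hg0, ContinuousMap.const_apply]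
    rw [IccExtend_of_mem _ _ ⟨le_rfl, hε.le⟩]; rfl
  -- As z → 0 the actual paths converge uniformly to the constant g 0, so they enter the
  -- neighbourhood in which the fixed point is unique.
  have ht : Tendsto (fun z => (p z, W z)) (𝓝[>] 0) (𝓝 (0, g 0)) :=
    hp.prodMk_nhds (hW0 ▸ hWc.continuousAt.tendsto.mono_left nhdsWithin_le_nhds)
  filter_upwards [ht.eventually huniq, heq, Ioo_mem_nhdsGT hε] with z h1 h2 h3 t
  rw [hW z h3 t, h1 (ContinuousMap.ext fun t => h2 (W z) (hW z h3) t)]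

end IsAn

/-- Existence, near a regular singular endpoint, of a solution of
`(zⁿ⁺¹⁻ᵏ c y')' = zⁿ e y` with `y(0) = 1`, in integrated form. -/
theorem exists_regular_solution [CompleteSpace P] {p : ℝ → P} (hp : Tendsto p (𝓝[>] 0) (𝓝 0))
    (ℓ : P →L[ℝ] ℝ)
    {k n : ℝ} (hk : 0 ≤ k) (hn : -1 < n) (hℓ : ∀ z : ℝ, 0 < z → ℓ (p z) = z ^ (k + 1))
    {c e : ℝ → ℝ} (hc : IsAn p c) (hc0 : c 0 ≠ 0) (he : IsAn p e) :
    ∃ y : ℝ → ℝ, IsAn p y ∧ y 0 = 1 ∧ ∃ ε > 0, ∀ x ∈ Ioo 0 ε,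
      y x = 1 + x ^ (k + 1) * avg k (fun s => (c s)⁻¹ * avg n (fun s => e s * y s) s) x := by
  have hk' : -1 < k := by linarith
  have hk1 : 0 ≤ k + 1 := by linarith
  obtain ⟨C, hC, hC0, hCc⟩ := hc.comp hp (φ := fun x => x⁻¹) (analyticAt_inv hc0)
  obtain ⟨G, hG, hG0, hGe⟩ := he
  -- The equation integrated twice: zᵐ c y' = zⁿ⁺¹ avg n (e y) with m = n + 1 - k, hence y' = zᵏ c⁻¹
  -- avg n (e y). At tz the prefactor (tz)^(k+1) splits into ℓ(p z) and the path t^(k+1).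
  let T : P × C(I01, ℝ) → C(I01, ℝ) := fun q =>
    powPath (k + 1) hk1 * avgCLM k hk' (C q.1 * avgCLM n hn (G q.1 * q.2))
  let g : P → C(I01, ℝ) := fun _ => ContinuousMap.const _ 1
  have hT : AnalyticAt ℝ T (0, g 0) := by
    have h1 : AnalyticAt ℝ (fun q : P × C(I01, ℝ) => C q.1) (0, g 0) :=
      AnalyticAt.fun_comp (g := C) hC analyticAt_fst
    have h2 : AnalyticAt ℝ (fun q : P × C(I01, ℝ) => G q.1) (0, g 0) :=
      AnalyticAt.fun_comp (g := G) hG analyticAt_fst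
    have h3 := ((avgCLM n hn).analyticAt _).fun_comp (h2.mul analyticAt_snd)
    have h4 := ((avgCLM k hk').analyticAt _).fun_comp (h1.mul h3)
    exact analyticAt_const.mul h4
  obtain ⟨Ω, hΩ, hΩ0, hfix, -⟩ := exists_analytic_fixedPoint g ℓ T analyticAt_const hT
  have key : ∀ z : ℝ, 0 < z → (∀ t : I01, (c (t * z))⁻¹ = C (p z) t) →
      (∀ t : I01, e (t * z) = G (p z) t) → ∀ (y : ℝ → ℝ) (W : C(I01, ℝ)),
      (∀ t : I01, y (t * z) = W t) → ∀ t : I01,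
      ((t : ℝ) * z) ^ (k + 1) * avg k (fun s => (c s)⁻¹ * avg n (fun s => e s * y s) s) (t * z)
        = ℓ (p z) * T (p z, W) t := by
    intro z hz h1 h2 y W hy t
    have e1 : ∀ t : I01, avg n (fun s => e s * y s) (t * z) = avgCLM n hn (G (p z) * W) t :=
      avg_path hn (fun t => by rw [h2, hy]; rfl)
    have e2 := avg_path hk' (f := fun s => (c s)⁻¹ * avg n (fun s => e s * y s) s)
      (F := C (p z) * avgCLM n hn (G (p z) * W)) (z := z)
      (fun t => by simp only [h1, e1]; rfl) t
    rw [e2, hℓ z hz, Real.mul_rpow t.2.1 hz.le]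
    simp only [T, ContinuousMap.mul_apply, powPath, ContinuousMap.coe_mk]
    ring
  obtain ⟨ε, ⟨hε1, hε2, hε3⟩, hε⟩ :=
    (((hp.eventually hfix).and (hCc.and hGe)).and self_mem_nhdsWithin).exists
  have hε : 0 < ε := hε
  -- The path at a single ε defines y on all of [0, ε]. That the paths at smaller z agree with Ω is
  -- deduced below from uniqueness of the fixed point.
  let y : ℝ → ℝ := fun x => Ω (p ε) (projIcc 0 1 zero_le_one (x / ε))
  have hyc : Continuous y := by fun_prop
  have hyt : ∀ t : I01, y (t * ε) = Ω (p ε) t := by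
    intro t
    simp only [y, mul_div_cancel_right₀ _ hε.ne']
    rw [projIcc_of_mem _ t.2]
  have hy : ∀ x ∈ Icc 0 ε,
      y x = 1 + x ^ (k + 1) * avg k (fun s => (c s)⁻¹ * avg n (fun s => e s * y s) s) x := by
    intro x hx
    have hx' : x / ε ∈ Icc (0 : ℝ) 1 :=
      ⟨div_nonneg hx.1 hε.le, (div_le_one hε).2 hx.2⟩
    have hxt : ((⟨x / ε, hx'⟩ : I01) : ℝ) * ε = x := div_mul_cancel₀ _ hε.ne'
    have h1 := key ε hε hε2 hε3 y _ hyt ⟨x / ε, hx'⟩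
    have h2 := hyt ⟨x / ε, hx'⟩
    rw [hxt] at h1 h2
    rw [h1, h2]
    conv_lhs => rw [hε1]
    rfl
  have hy0 : y 0 = 1 := by
    rw [hy 0 ⟨le_rfl, hε.le⟩, Real.zero_rpow (by linarith : k + 1 ≠ 0)]; simp
  refine ⟨y, ?_, hy0, ε, hε, fun x hx => hy x ⟨hx.1.le, hx.2.le⟩⟩
  refine IsAn.of_fixedPoint hp ℓ g T analyticAt_const (by rw [hy0]) hT hε hyc.continuousOn ?_
  filter_upwards [hCc, hGe, Ioo_mem_nhdsGT hε] with z h1 h2 h3 W hW t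
  rw [← key z h3.1 h1 h2 y W hW t, ← hW, hy]
  · rfl
  · exact ⟨mul_nonneg t.2.1 h3.1.le, (mul_le_of_le_one_left h3.1.le t.2.2).trans h3.2.le⟩

end

/-! ### The limit point case at a regular singular endpoint -/

section

variable {P : Type*} [NormedAddCommGroup P] [NormedSpace ℝ P]

theorem eq_of_hasDerivAt_zero {f : ℝ → ℝ} {a b : ℝ} (h : ∀ z ∈ Ioo a b, HasDerivAt f 0 z)
    {x y : ℝ} (hx : x ∈ Ioo a b) (hy : y ∈ Ioo a b) : f x = f y :=
  isOpen_Ioo.is_const_of_deriv_eq_zero isPreconnected_Ioo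
    (fun z hz => (h z hz).differentiableAt.differentiableWithinAt)
    (fun z hz => (h z hz).deriv) hx hy

theorem not_integrableOn_inv {δ : ℝ} (hδ : 0 < δ) :
    ¬ IntegrableOn (fun z : ℝ => z⁻¹) (Ioo 0 δ) := by
  intro h
  have : IntervalIntegrable (fun z : ℝ => z⁻¹) volume 0 δ :=
    (intervalIntegrable_iff_integrableOn_Ioo_of_le hδ.le).2 h
  rw [intervalIntegrable_inv_iff] at this
  rcases this with h | h
  · exact hδ.ne h
  · exact h left_mem_uIcc

/-- A function whose derivative near `0⁺` is at least `κ z⁻ᵐ`, `κ > 0`, is not square integrable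
with weight `zⁿ` when `2 m ≥ n + 3`. -/
theorem not_integrableOn_of_deriv_ge {u u' : ℝ → ℝ} {m n κ δ : ℝ} (hδ : 0 < δ) (hκ : 0 < κ)
    (hm : 1 < m) (hmn : n + 3 ≤ 2 * m)
    (hu : ∀ z ∈ Ioo 0 δ, HasDerivAt u (u' z) z) (hu' : ∀ z ∈ Ioo 0 δ, κ * z ^ (-m) ≤ u' z) :
    ¬ IntegrableOn (fun z => z ^ n * u z ^ 2) (Ioo 0 δ) := by
  intro hint
  -- The added term has derivative -κ z⁻ᵐ, so g is nondecreasing. Hence u is at most a constant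
  -- minus κ/(m-1) z^(1-m) near 0.
  let g : ℝ → ℝ := fun z => u z + κ / (m - 1) * z ^ (1 - m)
  have hg : ∀ z ∈ Ioo 0 δ, HasDerivAt g (u' z - κ * z ^ (-m)) z := by
    intro z hz
    have h1 := (Real.hasDerivAt_rpow_const (x := z) (p := 1 - m) (Or.inl hz.1.ne')).const_mul
      (κ / (m - 1))
    refine ((hu z hz).add h1).congr_deriv ?_
    have : m - 1 ≠ 0 := by linarith
    rw [show 1 - m - 1 = -m by ring]
    field_simp
    ring
  have hmono : MonotoneOn g (Ioo 0 δ) := by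
    refine monotoneOn_of_deriv_nonneg (convex_Ioo _ _)
      (fun z hz => (hg z hz).continuousAt.continuousWithinAt) ?_ ?_
    · rw [interior_Ioo]; exact fun z hz => (hg z hz).differentiableAt.differentiableWithinAt
    · rw [interior_Ioo]
      intro z hz
      rw [(hg z hz).deriv]
      linarith [hu' z hz]
  set κ' := κ / (m - 1) with hκ'
  have hκ'0 : 0 < κ' := div_pos hκ (by linarith)
  have htop : Tendsto (fun z : ℝ => z ^ (1 - m)) (𝓝[>] 0) atTop :=
    tendsto_rpow_neg_nhdsGT_zero (by linarith)
  obtain ⟨η, hη, hηs⟩ := mem_nhdsGT_iff_exists_Ioo_subset.1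
    ((htop.eventually (eventually_ge_atTop (2 * |g (δ / 2)| / κ'))).and
      (Ioo_mem_nhdsGT (lt_min (half_pos hδ) one_pos)))
  have hη : 0 < η := hη
  have hηδ : Ioo 0 η ⊆ Ioo 0 δ := fun z hz =>
    ⟨hz.1, ((hηs hz).2.2.trans_le (min_le_left _ _)).trans (half_lt_self hδ)⟩
  refine not_integrableOn_inv hη ?_
  have hbound : ∀ z ∈ Ioo 0 η, z⁻¹ ≤ 4 / κ' ^ 2 * (z ^ n * u z ^ 2) := by
    intro z hz
    obtain ⟨h1, h2, h3⟩ := hηs hz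
    have hz0 : 0 < z := hz.1
    have hle : g z ≤ g (δ / 2) := hmono (hηδ hz) ⟨half_pos hδ, half_lt_self hδ⟩
      (h3.trans_le (min_le_left _ _)).le
    have h4 : |g (δ / 2)| ≤ κ' / 2 * z ^ (1 - m) := by
      have : 2 * |g (δ / 2)| ≤ κ' * z ^ (1 - m) := by
        rwa [div_le_iff₀' hκ'0] at h1
      linarith
    have h5 : κ' / 2 * z ^ (1 - m) ≤ -u z := by
      have := le_abs_self (g (δ / 2))
      simp only [g] at hle this h4
      linarith
    have hpos : 0 ≤ κ' / 2 * z ^ (1 - m) := by positivity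
    have h6 : (κ' / 2 * z ^ (1 - m)) ^ 2 ≤ u z ^ 2 := by
      have := pow_le_pow_left₀ hpos h5 2
      rwa [neg_sq] at this
    -- The condition `hmn` says n + 2(1 - m) ≤ -1, so zⁿ u² dominates a multiple of 1/z.
    have h7 : z ^ (-1 : ℝ) ≤ z ^ (n + 2 * (1 - m)) :=
      Real.rpow_le_rpow_of_exponent_ge hz0 (h3.le.trans (min_le_right _ _)) (by linarith)
    rw [Real.rpow_neg_one, Real.rpow_add hz0, mul_comm 2 (1 - m), Real.rpow_mul hz0.le,
      Real.rpow_two] at h7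
    have h8 : z ^ n * (κ' / 2 * z ^ (1 - m)) ^ 2 ≤ z ^ n * u z ^ 2 :=
      mul_le_mul_of_nonneg_left h6 (Real.rpow_nonneg hz0.le _)
    calc z⁻¹ ≤ z ^ n * (z ^ (1 - m)) ^ 2 := h7
      _ = 4 / κ' ^ 2 * (z ^ n * (κ' / 2 * z ^ (1 - m)) ^ 2) := by field_simp; norm_num
      _ ≤ _ := mul_le_mul_of_nonneg_left h8 (by positivity)
  refine Integrable.mono' ((hint.mono_set hηδ).const_mul (4 / κ' ^ 2))
    measurable_inv.aestronglyMeasurable ?_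
  refine (ae_restrict_iff' measurableSet_Ioo).2 (Eventually.of_forall fun z hz => ?_)
  rw [Real.norm_of_nonneg (inv_nonneg.2 hz.1.le)]
  exact hbound z hz

/-- Every square integrable solution of `(zᵐ c y')' = zⁿ e y` near a regular singular endpoint of
limit point type is a multiple of the regular solution. -/
theorem eq_mul_regular_solution {p : ℝ → P} (hp : Tendsto p (𝓝[>] 0) (𝓝 0))
    {k n m : ℝ} (hk : 0 ≤ k) (hn : -1 < n) (hm : m = n + 1 - k) (hm1 : 1 < m)
    (hmn : n + 3 ≤ 2 * m) {c e y₁ : ℝ → ℝ} (hc : IsAn p c) (hc0 : 0 < c 0) (he : IsAn p e)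
    (hy₁ : IsAn p y₁) (hy₁0 : y₁ 0 = 1)
    (heq : ∃ ε > 0, ∀ x ∈ Ioo 0 ε,
      y₁ x = 1 + x ^ (k + 1) * avg k (fun s => (c s)⁻¹ * avg n (fun s => e s * y₁ s) s) x)
    {y v : ℝ → ℝ} {δ : ℝ} (hδ : 0 < δ)
    (hy : ∀ z ∈ Ioo 0 δ, HasDerivAt y (v z / (z ^ m * c z)) z)
    (hv : ∀ z ∈ Ioo 0 δ, HasDerivAt v (z ^ n * (e z * y z)) z)
    (hint : IntegrableOn (fun z => z ^ n * y z ^ 2) (Ioo 0 δ)) :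
    ∃ C : ℝ, ∀ᶠ z in 𝓝[>] (0 : ℝ), y z = C * y₁ z := by
  have hk' : -1 < k := by linarith
  have hey := he.mul hy₁
  have hf := (hc.comp hp (φ := fun x => x⁻¹) (analyticAt_inv hc0.ne')).mul (hey.avg hn)
  obtain ⟨ε₁, hε₁, heq⟩ := heq
  obtain ⟨ε₂, hε₂, hcey⟩ := hey.exists_continuousOn
  obtain ⟨ε₃, hε₃, hcf⟩ := hf.exists_continuousOn
  obtain ⟨ε₄, hε₄, hcc⟩ := mem_nhdsGT_iff_exists_Ioo_subset.1
    (hc.tendsto.eventually (Ioo_mem_nhds hc0 (lt_add_one (c 0))))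
  obtain ⟨ε₅, hε₅, hyy⟩ := mem_nhdsGT_iff_exists_Ioo_subset.1
    (hy₁.tendsto.eventually (Ioo_mem_nhds (a := 1 / 2) (b := 2) (by rw [hy₁0]; norm_num)
      (by rw [hy₁0]; norm_num)))
  set η := min δ (min ε₁ (min ε₂ (min ε₃ (min ε₄ ε₅)))) with hη
  have hη0 : 0 < η := by
    simp only [hη, lt_min_iff]; exact ⟨hδ, hε₁, hε₂, hε₃, hε₄, hε₅⟩
  have hsub : ∀ z ∈ Ioo 0 η, z ∈ Ioo 0 δ ∧ z ∈ Ioo 0 ε₁ ∧ z ∈ Ioo 0 ε₂ ∧ z ∈ Ioo 0 ε₃ ∧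
      z ∈ Ioo 0 ε₄ ∧ z ∈ Ioo 0 ε₅ := by
    intro z hz
    have := hz.2
    simp only [hη, lt_min_iff] at this
    exact ⟨⟨hz.1, this.1⟩, ⟨hz.1, this.2.1⟩, ⟨hz.1, this.2.2.1⟩, ⟨hz.1, this.2.2.2.1⟩,
      ⟨hz.1, this.2.2.2.2.1⟩, ⟨hz.1, this.2.2.2.2.2⟩⟩
  have hcpos : ∀ z ∈ Ioo 0 η, 0 < c z ∧ c z < c 0 + 1 := fun z hz => hcc (hsub z hz).2.2.2.2.1
  have hy1 : ∀ z ∈ Ioo 0 η, 1 / 2 < y₁ z ∧ y₁ z < 2 := fun z hz => hyy (hsub z hz).2.2.2.2.2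
  let v₁ : ℝ → ℝ := fun z => z ^ (n + 1) * avg n (fun s => e s * y₁ s) z
  have hv₁ : ∀ z ∈ Ioo 0 η, HasDerivAt v₁ (z ^ n * (e z * y₁ z)) z := fun z hz =>
    hasDerivAt_rpow_mul_avg hn hcey (hsub z hz).2.2.1
  have hy₁' : ∀ z ∈ Ioo 0 η, HasDerivAt y₁ (v₁ z / (z ^ m * c z)) z := by
    intro z hz
    have h1 := (hasDerivAt_rpow_mul_avg hk' hcf (hsub z hz).2.2.2.1).const_add 1
    have h2 := h1.congr_of_eventuallyEq (f₁ := y₁) (by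
      filter_upwards [isOpen_Ioo.mem_nhds (hsub z hz).2.1] with x hx using heq x hx)
    refine h2.congr_deriv ?_
    have hzm : z ^ (n + 1) = z ^ k * z ^ m := by
      rw [← Real.rpow_add hz.1, hm]; congr 1; ring
    have := (Real.rpow_pos_of_pos hz.1 m).ne'
    have := (hcpos z hz).1.ne'
    simp only [v₁, hzm]
    field_simp
  have hδ' : ∀ z ∈ Ioo 0 η, z ∈ Ioo 0 δ := fun z hz => (hsub z hz).1
  -- The Wronskian of y and y₁ is constant.
  have hw : ∀ z ∈ Ioo 0 η, HasDerivAt (fun z => v z * y₁ z - y z * v₁ z) 0 z := by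
    intro z hz
    refine (((hv z (hδ' z hz)).mul (hy₁' z hz)).sub
      ((hy z (hδ' z hz)).mul (hv₁ z hz))).congr_deriv ?_
    ring
  have hhalf : η / 2 ∈ Ioo 0 η := ⟨half_pos hη0, half_lt_self hη0⟩
  set w := v (η / 2) * y₁ (η / 2) - y (η / 2) * v₁ (η / 2) with hwdef
  have hwc : ∀ z ∈ Ioo 0 η, v z * y₁ z - y z * v₁ z = w := fun z hz =>
    eq_of_hasDerivAt_zero hw hz hhalf
  have hu : ∀ z ∈ Ioo 0 η, HasDerivAt (fun z => y z / y₁ z) (w / (z ^ m * c z * y₁ z ^ 2)) z := by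
    intro z hz
    have h0 : y₁ z ≠ 0 := by have := (hy1 z hz).1; positivity
    refine ((hy z (hδ' z hz)).div (hy₁' z hz) h0).congr_deriv ?_
    rw [← hwc z hz]
    have := (Real.rpow_pos_of_pos hz.1 m).ne'
    have := (hcpos z hz).1.ne'
    field_simp
  -- The sign σ covers w > 0 and w < 0 at once. The constant in κ comes from c < c 0 + 1 and y₁ < 2;
  -- the lower bound y₁ > 1/2 passes integrability from y to y/y₁.
  have hnint : ∀ σ : ℝ, σ ^ 2 = 1 → ¬ 0 < σ * w := by
    intro σ hσ hpos
    refine not_integrableOn_of_deriv_ge (u := fun z => σ * (y z / y₁ z))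
      (u' := fun z => σ * (w / (z ^ m * c z * y₁ z ^ 2))) (κ := σ * w / ((c 0 + 1) * 4))
      hη0 (by positivity) hm1 hmn (fun z hz => (hu z hz).const_mul σ) ?_ ?_
    · intro z hz
      have h1 := hcpos z hz
      have h2 := hy1 z hz
      have h3 := Real.rpow_pos_of_pos hz.1 m
      have hy0 : 0 < y₁ z := by linarith
      rw [Real.rpow_neg hz.1.le, ← div_eq_mul_inv, div_div, ← mul_div_assoc]
      have h4 : y₁ z ^ 2 ≤ 4 := by nlinarith
      refine div_le_div_of_nonneg_left hpos.le (mul_pos (mul_pos h3 h1.1) (pow_pos hy0 2)) ?_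
      rw [mul_assoc, mul_comm]
      exact mul_le_mul_of_nonneg_right
        (mul_le_mul h1.2.le h4 (sq_nonneg _) (by linarith)) h3.le
    · refine Integrable.mono' ((hint.mono_set hδ').const_mul 4) ?_ ?_
      · refine ContinuousOn.aestronglyMeasurable (fun z hz => ?_) measurableSet_Ioo
        exact ((Real.continuousAt_rpow_const z n (Or.inl hz.1.ne')).mul
          (((hu z hz).continuousAt.const_mul σ).pow 2)).continuousWithinAt
      · refine (ae_restrict_iff' measurableSet_Ioo).2 (Eventually.of_forall fun z hz => ?_)
        have h2 := hy1 z hz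
        have h3 := Real.rpow_pos_of_pos hz.1 n
        rw [Real.norm_of_nonneg (by positivity), mul_pow, hσ, one_mul, div_pow,
          ← mul_div_assoc, div_le_iff₀ (by nlinarith)]
        have h4 : 1 ≤ 4 * y₁ z ^ 2 := by nlinarith
        have h5 : 0 ≤ z ^ n * y z ^ 2 := by positivity
        linarith [mul_le_mul_of_nonneg_left h4 h5]
  have hw0 : w = 0 := by
    rcases lt_trichotomy w 0 with h | h | h
    · exact absurd (by linarith) (hnint (-1) (by norm_num))
    · exact h
    · exact absurd (by linarith) (hnint 1 (by norm_num))
  refine ⟨y (η / 2) / y₁ (η / 2), ?_⟩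
  filter_upwards [Ioo_mem_nhdsGT hη0] with z hz
  have h0 : y₁ z ≠ 0 := by have := (hy1 z hz).1; positivity
  have := eq_of_hasDerivAt_zero (f := fun z => y z / y₁ z)
    (fun z hz => (hu z hz).congr_deriv (by rw [hw0, zero_div])) hz hhalf
  rw [← this, div_mul_cancel₀ _ h0]

end

/-! ### The enthalpy of an equilibrium -/

section

theorem continuousOn_avg {a ε : ℝ} (ha : -1 < a) (hε : 0 < ε) {f : ℝ → ℝ}
    (hf : ContinuousOn f (Icc 0 ε)) : ContinuousOn (avg a f) (Icc 0 ε) := by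
  have hmem : ∀ t : I01, (t : ℝ) * ε ∈ Icc 0 ε := fun t =>
    ⟨mul_nonneg t.2.1 hε.le, mul_le_of_le_one_left hε.le t.2.2⟩
  let F : C(I01, ℝ) := ⟨fun t => f (t * ε),
    hf.comp_continuous (by fun_prop) hmem⟩
  have : ContinuousOn (fun x => avgCLM a ha F (projIcc 0 1 zero_le_one (x / ε))) (Icc 0 ε) :=
    Continuous.continuousOn (by fun_prop)
  refine this.congr fun x hx => ?_
  have hx' : x / ε ∈ Icc (0 : ℝ) 1 :=
    ⟨div_nonneg hx.1 hε.le, (div_le_one hε).2 hx.2⟩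
  have h := avg_path ha (f := f) (F := F) (z := ε) (fun t => rfl) ⟨x / ε, hx'⟩
  simp only [projIcc_of_mem _ hx', ← h, div_mul_cancel₀ _ hε.ne']

theorem avg_pos {a ε : ℝ} (ha : -1 < a) {f : ℝ → ℝ} (hf : ContinuousOn f (Icc 0 ε))
    (hpos : ∀ x ∈ Ioo 0 ε, 0 < f x) {z : ℝ} (hz : z ∈ Ioc 0 ε) : 0 < avg a f z := by
  have h1 := rpow_mul_avg (a := a) f hz.1
  have h2 : 0 < ∫ s in (0 : ℝ)..z, s ^ a * f s := by
    refine intervalIntegral.intervalIntegral_pos_of_pos_on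
      (intervalIntegrable_rpow_mul ha hz.1.le (hf.mono (Icc_subset_Icc_right hz.2)))
      (fun x hx => ?_) hz.1
    exact mul_pos (Real.rpow_pos_of_pos hx.1 a) (hpos x ⟨hx.1, hx.2.trans_le hz.2⟩)
  rw [← h1] at h2
  exact pos_of_mul_pos_right h2 (Real.rpow_pos_of_pos hz.1 _).le

/-- The density, extended by continuity to the closed interval `[0, R]`. -/
def dens (R : ℝ) (ρ : ℝ → ℝ) : ℝ → ℝ := extendFrom (Ioo 0 R) ρ

/-- The enthalpy `Aγ/(γ-1) ρ^(γ-1)`. -/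
def enth (A γ R : ℝ) (ρ : ℝ → ℝ) (r : ℝ) : ℝ := A * γ / (γ - 1) * dens R ρ r ^ (γ - 1)

/-- The gravity divided by the radius, `4πg₀ r⁻³ ∫₀ʳ ρ s² ds`. -/
def grav (g₀ R : ℝ) (ρ : ℝ → ℝ) (r : ℝ) : ℝ := 4 * Real.pi * g₀ * avg 2 (dens R ρ) r

namespace IsEquilibrium

variable {A γ g₀ R ρc : ℝ} {ρ : ℝ → ℝ}

theorem dens_eq (hρ : IsEquilibrium A γ g₀ R ρc ρ) {r : ℝ} (hr : r ∈ Ioo 0 R) :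
    dens R ρ r = ρ r := by
  refine extendFrom_eq (subset_closure hr) ?_
  exact (hρ.contDiffOn.continuousOn r hr)

theorem dens_zero (hρ : IsEquilibrium A γ g₀ R ρc ρ) : dens R ρ 0 = ρc :=
  eq_lim_at_left_extendFrom_Ioo hρ.radius_pos hρ.tendsto_center

theorem dens_radius (hρ : IsEquilibrium A γ g₀ R ρc ρ) : dens R ρ R = 0 :=
  eq_lim_at_right_extendFrom_Ioo hρ.radius_pos hρ.tendsto_surface

theorem continuousOn_dens (hρ : IsEquilibrium A γ g₀ R ρc ρ) :
    ContinuousOn (dens R ρ) (Icc 0 R) :=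
  continuousOn_Icc_extendFrom_Ioo hρ.contDiffOn.continuousOn
    hρ.tendsto_center hρ.tendsto_surface

theorem dens_pos (hρ : IsEquilibrium A γ g₀ R ρc ρ) {r : ℝ} (hr : r ∈ Ico 0 R) :
    0 < dens R ρ r := by
  rcases hr.1.eq_or_lt with h | h
  · rw [← h, hρ.dens_zero]; exact hρ.central_pos
  · rw [hρ.dens_eq ⟨h, hr.2⟩]; exact hρ.pos r ⟨h, hr.2⟩

theorem dens_nonneg (hρ : IsEquilibrium A γ g₀ R ρc ρ) {r : ℝ} (hr : r ∈ Icc 0 R) :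
    0 ≤ dens R ρ r := by
  rcases hr.2.eq_or_lt with h | h
  · rw [h, hρ.dens_radius]
  · exact (hρ.dens_pos ⟨hr.1, h⟩).le

theorem continuousOn_enth (hρ : IsEquilibrium A γ g₀ R ρc ρ) (hγ : 1 < γ) :
    ContinuousOn (enth A γ R ρ) (Icc 0 R) :=
  continuousOn_const.mul (hρ.continuousOn_dens.rpow_const fun _ _ => Or.inr (by linarith))

theorem enth_pos (hρ : IsEquilibrium A γ g₀ R ρc ρ) (hA : 0 < A) (hγ : 1 < γ) {r : ℝ}
    (hr : r ∈ Ico 0 R) : 0 < enth A γ R ρ r := by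
  have h1 : 0 < γ - 1 := by linarith
  have := Real.rpow_pos_of_pos (hρ.dens_pos hr) (γ - 1)
  unfold enth
  positivity

theorem enth_radius (hρ : IsEquilibrium A γ g₀ R ρc ρ) (hγ : 1 < γ) : enth A γ R ρ R = 0 := by
  rw [enth, hρ.dens_radius, Real.zero_rpow (by linarith), mul_zero]

theorem dens_eq_enth (hρ : IsEquilibrium A γ g₀ R ρc ρ) (hA : 0 < A) (hγ : 1 < γ) {r : ℝ}
    (hr : r ∈ Icc 0 R) :
    dens R ρ r = ((γ - 1) / (A * γ) * enth A γ R ρ r) ^ (1 / (γ - 1)) := by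
  have h1 : γ - 1 ≠ 0 := by linarith
  have h2 : γ ≠ 0 := by linarith
  rw [enth, ← mul_assoc, show (γ - 1) / (A * γ) * (A * γ / (γ - 1)) = 1 by field_simp, one_mul,
    ← Real.rpow_mul (hρ.dens_nonneg hr), mul_one_div_cancel h1, Real.rpow_one]

theorem continuousOn_grav (hρ : IsEquilibrium A γ g₀ R ρc ρ) :
    ContinuousOn (grav g₀ R ρ) (Icc 0 R) :=
  continuousOn_const.mul (continuousOn_avg (by norm_num) hρ.radius_pos hρ.continuousOn_dens)

theorem grav_pos (hρ : IsEquilibrium A γ g₀ R ρc ρ) (hg₀ : 0 < g₀) {r : ℝ}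
    (hr : r ∈ Ioc 0 R) : 0 < grav g₀ R ρ r :=
  mul_pos (by positivity) (avg_pos (by norm_num) hρ.continuousOn_dens
    (fun _ hx => hρ.dens_pos ⟨hx.1.le, hx.2⟩) hr)

theorem hasDerivAt_mass (hρ : IsEquilibrium A γ g₀ R ρc ρ) {r : ℝ} (hr : r ∈ Ioo 0 R) :
    HasDerivAt (fun r => r ^ 3 * grav g₀ R ρ r) (4 * Real.pi * g₀ * (r ^ 2 * ρ r)) r := by
  have h := (hasDerivAt_rpow_mul_avg (a := 2) (by norm_num) hρ.continuousOn_dens hr).const_mul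
    (4 * Real.pi * g₀)
  rw [hρ.dens_eq hr, Real.rpow_two] at h
  refine h.congr_of_eventuallyEq (Eventually.of_forall fun x => ?_)
  have : x ^ ((2 : ℝ) + 1) = x ^ 3 := by
    rw [← Real.rpow_natCast]; congr 1; norm_num
  simp only [this, grav]
  ring

theorem hasDerivAt_dens (hρ : IsEquilibrium A γ g₀ R ρc ρ) {r : ℝ} (hr : r ∈ Ioo 0 R) :
    HasDerivAt ρ (deriv ρ r) r :=
  ((hρ.contDiffOn.contDiffAt (isOpen_Ioo.mem_nhds hr)).differentiableAt
    (by norm_num)).hasDerivAt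

theorem contDiffOn_pressure (hρ : IsEquilibrium A γ g₀ R ρc ρ) :
    ContDiffOn ℝ 2 (pressure A γ ρ) (Ioo 0 R) :=
  contDiffOn_const.mul (hρ.contDiffOn.rpow_const_of_ne fun r hr => (hρ.pos r hr).ne')

theorem hasDerivAt_enth_aux (hρ : IsEquilibrium A γ g₀ R ρc ρ) (hγ : 1 < γ) {r : ℝ}
    (hr : r ∈ Ioo 0 R) :
    HasDerivAt (enth A γ R ρ) (1 / ρ r * deriv (pressure A γ ρ) r) r := by
  have hp := hρ.pos r hr
  have h1 : γ - 1 ≠ 0 := by linarith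
  have hP : deriv (pressure A γ ρ) r = A * (deriv ρ r * γ * ρ r ^ (γ - 1)) :=
    (((hρ.hasDerivAt_dens hr).rpow_const (Or.inl hp.ne')).const_mul A).deriv
  have hh := ((hρ.hasDerivAt_dens hr).rpow_const (p := γ - 1) (Or.inl hp.ne')).const_mul
    (A * γ / (γ - 1))
  have hh' := hh.congr_of_eventuallyEq (f₁ := enth A γ R ρ) (by
    filter_upwards [isOpen_Ioo.mem_nhds hr] with x hx
    rw [enth, hρ.dens_eq hx])
  refine hh'.congr_deriv ?_
  rw [hP, show ρ r ^ (γ - 1 - 1) = ρ r ^ (γ - 1) / ρ r by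
    rw [Real.rpow_sub hp (γ - 1) 1, Real.rpow_one]]
  field_simp

/-- Integrating the structure equation once leaves a constant c, a point mass at the centre, with h'
= c/r² - r·`grav`. A nonzero c would make h blow up like 1/r, against the finite central density. -/
theorem hasDerivAt_enth (hρ : IsEquilibrium A γ g₀ R ρc ρ) (hγ : 1 < γ) {r : ℝ}
    (hr : r ∈ Ioo 0 R) :
    HasDerivAt (enth A γ R ρ) (-(r * grav g₀ R ρ r)) r := by
  have hR := hρ.radius_pos
  have hflux : ∀ r ∈ Ioo 0 R, HasDerivAt (fun s => s ^ 2 / ρ s * deriv (pressure A γ ρ) s)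
      (-(4 * Real.pi * g₀ * (r ^ 2 * ρ r))) r := by
    intro r hr
    have hd : DifferentiableAt ℝ (fun s => s ^ 2 / ρ s * deriv (pressure A γ ρ) s) r := by
      have h1 : DifferentiableAt ℝ (deriv (pressure A γ ρ)) r :=
        ((hρ.contDiffOn_pressure.deriv_of_isOpen (m := 1) isOpen_Ioo
          (by norm_num)).differentiableOn (by norm_num)).differentiableAt (isOpen_Ioo.mem_nhds hr)
      have h2 := (hρ.hasDerivAt_dens hr).differentiableAt
      exact ((differentiableAt_id.pow 2).div h2 (hρ.pos r hr).ne').mul h1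
    have h := hρ.equation r hr
    refine hd.hasDerivAt.congr_deriv ?_
    have hr0 : r ≠ 0 := hr.1.ne'
    generalize deriv (fun s => s ^ 2 / ρ s * deriv (pressure A γ ρ) s) r = X at h ⊢
    field_simp at h
    linear_combination -h
  have hc : ∀ r ∈ Ioo 0 R, HasDerivAt
      (fun s => s ^ 2 / ρ s * deriv (pressure A γ ρ) s + s ^ 3 * grav g₀ R ρ s) 0 r :=
    fun r hr => ((hflux r hr).add (hρ.hasDerivAt_mass hr)).congr_deriv (by ring)
  have hhalf : R / 2 ∈ Ioo 0 R := ⟨half_pos hR, half_lt_self hR⟩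
  set c := (R / 2) ^ 2 / ρ (R / 2) * deriv (pressure A γ ρ) (R / 2) +
    (R / 2) ^ 3 * grav g₀ R ρ (R / 2) with hcdef
  have hcc : ∀ r ∈ Ioo 0 R, 1 / ρ r * deriv (pressure A γ ρ) r = c / r ^ 2 - r * grav g₀ R ρ r := by
    intro r hr
    have h := eq_of_hasDerivAt_zero hc hr hhalf
    simp only [← hcdef] at h
    rw [← h]
    have hr0 : r ≠ 0 := hr.1.ne'
    have hr1 : ρ r ≠ 0 := (hρ.pos r hr).ne'
    field_simp
    ring
  have hprim : ∀ r ∈ Ioo 0 R, HasDerivAt (fun s => enth A γ R ρ s + c / s +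
      s ^ ((1 : ℝ) + 1) * avg 1 (grav g₀ R ρ) s) 0 r := by
    intro r hr
    have h1 := hρ.hasDerivAt_enth_aux hγ hr
    have h2 := (hasDerivAt_inv hr.1.ne').const_mul c
    have h3 := hasDerivAt_rpow_mul_avg (a := 1) (by norm_num) hρ.continuousOn_grav hr
    refine ((h1.add h2).add h3).congr_deriv ?_
    rw [hcc r hr, Real.rpow_one]
    ring
  set D := enth A γ R ρ (R / 2) + c / (R / 2) +
      (R / 2) ^ ((1 : ℝ) + 1) * avg 1 (grav g₀ R ρ) (R / 2) with hD
  -- The conserved quantity D multiplied by s and solved for c: the right side tends to 0 because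
  -- the enthalpy and the averages are bounded near 0.
  have hlim : Tendsto (fun s => s * D - s * enth A γ R ρ s -
      s * (s ^ ((1 : ℝ) + 1) * avg 1 (grav g₀ R ρ) s)) (𝓝[Icc 0 R] 0) (𝓝 0) := by
    have h0 : (0 : ℝ) ∈ Icc 0 R := ⟨le_rfl, hR.le⟩
    have hcont : ContinuousOn (fun s => s * D - s * enth A γ R ρ s -
        s * (s ^ ((1 : ℝ) + 1) * avg 1 (grav g₀ R ρ) s)) (Icc 0 R) := by
      refine ((continuousOn_id.mul continuousOn_const).sub
        (continuousOn_id.mul (hρ.continuousOn_enth hγ))).sub (continuousOn_id.mul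
        (ContinuousOn.mul ?_ (continuousOn_avg (by norm_num) hR hρ.continuousOn_grav)))
      exact continuousOn_id.rpow_const fun _ _ => Or.inr (by norm_num)
    simpa using (hcont 0 h0).tendsto
  have hc0 : c = 0 := by
    have h1 : Tendsto (fun s => s * D - s * enth A γ R ρ s -
        s * (s ^ ((1 : ℝ) + 1) * avg 1 (grav g₀ R ρ) s)) (𝓝[>] 0) (𝓝 0) :=
      hlim.mono_left (nhdsWithin_le_iff.2 (Icc_mem_nhdsGT hR))
    refine tendsto_nhds_unique (tendsto_const_nhds.congr' ?_) h1
    filter_upwards [Ioo_mem_nhdsGT hR] with s hs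
    have h := eq_of_hasDerivAt_zero hprim hs hhalf
    simp only [← hD] at h
    have hs0 : s ≠ 0 := hs.1.ne'
    rw [← h]
    field_simp
    ring
  refine (hρ.hasDerivAt_enth_aux hγ hr).congr_deriv ?_
  rw [hcc r hr, hc0]
  ring

theorem deriv_pressure (hρ : IsEquilibrium A γ g₀ R ρc ρ) (hγ : 1 < γ) {r : ℝ}
    (hr : r ∈ Ioo 0 R) :
    deriv (pressure A γ ρ) r = -(ρ r * (r * grav g₀ R ρ r)) := by
  have h := (hρ.hasDerivAt_enth_aux hγ hr).unique (hρ.hasDerivAt_enth hγ hr)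
  have := (hρ.pos r hr).ne'
  field_simp at h
  linear_combination h

theorem pressure_eq (hρ : IsEquilibrium A γ g₀ R ρc ρ) (hγ : 1 < γ) {r : ℝ}
    (hr : r ∈ Ioo 0 R) : γ * pressure A γ ρ r = (γ - 1) * (ρ r * enth A γ R ρ r) := by
  have h1 : γ - 1 ≠ 0 := by linarith
  have hp := hρ.pos r hr
  rw [enth, pressure, hρ.dens_eq hr, show ρ r ^ (γ - 1) = ρ r ^ γ / ρ r by
    rw [Real.rpow_sub hp, Real.rpow_one]]
  field_simp

end IsEquilibrium

end

/-! ### Expansions of an equilibrium at the centre and at the surface -/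

section

theorem analyticAt_const_mul_rpow {B a x : ℝ} (hB : 0 < B) (hx : 0 < x) :
    AnalyticAt ℝ (fun x => (B * x) ^ a) x := by
  have h : AnalyticAt ℝ (fun x : ℝ => Real.exp (Real.log (B * x) * a)) x :=
    (((analyticAt_const.mul analyticAt_id).log (mul_pos hB hx)).mul analyticAt_const).rexp
  refine h.congr ?_
  filter_upwards [Ioi_mem_nhds hx] with y hy
  rw [Real.rpow_def_of_pos (mul_pos hB hy)]

theorem analyticAt_rpow_const {a x : ℝ} (hx : 0 < x) : AnalyticAt ℝ (fun x => x ^ a) x := by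
  simpa using analyticAt_const_mul_rpow (B := 1) (a := a) one_pos hx

/-- The parameter `r²` at the centre. -/
def centerPar (r : ℝ) : ℝ := r ^ 2

theorem tendsto_centerPar : Tendsto centerPar (𝓝[>] 0) (𝓝 0) :=
  (Continuous.tendsto' (by unfold centerPar; fun_prop) 0 0
    (by simp [centerPar])).mono_left nhdsWithin_le_nhds

theorem centerPar_eq (z : ℝ) (_ : 0 < z) :
    ContinuousLinearMap.id ℝ ℝ (centerPar z) = z ^ ((1 : ℝ) + 1) := by
  rw [ContinuousLinearMap.id_apply, centerPar, ← Real.rpow_natCast]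
  congr 1; norm_num

/-- The parameters `(z, zᵇ)` at the surface. -/
def surfacePar (b z : ℝ) : ℝ × ℝ := (z, z ^ b)

theorem tendsto_surfacePar {b : ℝ} (hb : 0 < b) : Tendsto (surfacePar b) (𝓝[>] 0) (𝓝 0) :=
  (Continuous.tendsto' (by
    have := Real.continuous_rpow_const hb.le
    unfold surfacePar; fun_prop) 0 0
    (by simp [surfacePar, Real.zero_rpow hb.ne'])).mono_left nhdsWithin_le_nhds

theorem isAn_id {b : ℝ} : IsAn (surfacePar b) (fun z => z) := by
  have := IsAn.rpow (p := surfacePar b) one_pos (ContinuousLinearMap.fst ℝ ℝ ℝ)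
    (fun z _ => by simp [surfacePar])
  simpa using this

theorem isAn_rpow {b : ℝ} (hb : 0 < b) : IsAn (surfacePar b) (fun z => z ^ b) :=
  IsAn.rpow hb (ContinuousLinearMap.snd ℝ ℝ ℝ) (fun z _ => by simp [surfacePar])

namespace IsEquilibrium

variable {A γ g₀ R ρc : ℝ} {ρ : ℝ → ℝ}

theorem enth_center (hρ : IsEquilibrium A γ g₀ R ρc ρ) (hγ : 1 < γ) {r : ℝ}
    (hr : r ∈ Ioo 0 R) :
    enth A γ R ρ r = enth A γ R ρ 0 - r ^ ((1 : ℝ) + 1) * avg 1 (grav g₀ R ρ) r := by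
  have h := eq_rpow_mul_avg (a := 1) (by norm_num) hρ.continuousOn_grav
    (F := fun r => enth A γ R ρ 0 - enth A γ R ρ r)
    (fun z hz => ((hρ.hasDerivAt_enth hγ hz).const_sub _).congr_deriv (by
      rw [Real.rpow_one]; ring)) ?_ hr
  · linarith
  · have h1 := (hρ.continuousOn_enth hγ 0 ⟨le_rfl, hρ.radius_pos.le⟩).tendsto.mono_left
      (nhdsWithin_le_iff.2 (Icc_mem_nhdsGT hρ.radius_pos))
    simpa using h1.const_sub (enth A γ R ρ 0)

/-- The density is an analytic function of h near h(0) > 0, so h = h(0) - r² avg 1 (4πg₀ avg 2 ρ(h))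
is a fixed point equation with small parameter r². -/
theorem isAn_enth_center (hρ : IsEquilibrium A γ g₀ R ρc ρ) (hA : 0 < A) (hγ : 1 < γ) :
    IsAn centerPar (enth A γ R ρ) := by
  have hR := hρ.radius_pos
  have hB : 0 < (γ - 1) / (A * γ) := div_pos (by linarith) (by nlinarith)
  obtain ⟨S, hS, hS0, hSφ⟩ := exists_analytic_superposition
    (analyticAt_const_mul_rpow (a := 1 / (γ - 1)) hB
      (hρ.enth_pos hA hγ ⟨le_rfl, hρ.radius_pos⟩))
  let T : ℝ × C(I01, ℝ) → C(I01, ℝ) := fun q =>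
    ContinuousMap.const _ (-(4 * Real.pi * g₀)) * (powPath (1 + 1) (by norm_num) *
      avgCLM 1 (by norm_num) (avgCLM 2 (by norm_num) (S q.2)))
  have hT : AnalyticAt ℝ T (0, ContinuousMap.const _ (enth A γ R ρ 0)) := by
    have h1 : AnalyticAt ℝ (fun q : ℝ × C(I01, ℝ) => S q.2)
        (0, ContinuousMap.const _ (enth A γ R ρ 0)) :=
      AnalyticAt.fun_comp (g := S) hS analyticAt_snd
    exact analyticAt_const.mul (analyticAt_const.mul
      (((avgCLM 1 (by norm_num)).analyticAt _).fun_comp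
        (((avgCLM 2 (by norm_num)).analyticAt _).fun_comp h1)))
  -- By continuity of h at 0, short paths are uniformly close to the constant h(0), where S
  -- coincides with pointwise application of the power.
  have hSd : ∀ᶠ z in 𝓝[>] (0 : ℝ), ∀ W : C(I01, ℝ), (∀ t : I01, enth A γ R ρ (t * z) = W t) →
      ∀ t : I01, dens R ρ (t * z) = S W t := by
    have hcont := hρ.continuousOn_enth hγ
    obtain ⟨η, hη, hηs⟩ := Metric.eventually_nhds_iff.1 hSφ
    obtain ⟨ε, hε, hεs⟩ := Metric.continuousOn_iff.1 hcont 0 ⟨le_rfl, hR.le⟩ (η / 2) (half_pos hη)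
    filter_upwards [Ioo_mem_nhdsGT (lt_min hε hR)] with z hz W hW t
    have hmem : ∀ t : I01, (t : ℝ) * z ∈ Icc 0 R ∧ dist ((t : ℝ) * z) 0 < ε := by
      intro t
      have h1 := mul_le_of_le_one_left hz.1.le t.2.2
      have h2 := mul_nonneg t.2.1 hz.1.le
      refine ⟨⟨h2, h1.trans (hz.2.le.trans (min_le_right _ _))⟩, ?_⟩
      rw [Real.dist_0_eq_abs, abs_of_nonneg h2]
      exact h1.trans_lt (hz.2.trans_le (min_le_left _ _))
    have hd : dist W (ContinuousMap.const _ (enth A γ R ρ 0)) < η := by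
      refine lt_of_le_of_lt ((ContinuousMap.dist_le (half_pos hη).le).2 fun t => ?_)
        (half_lt_self hη)
      rw [← hW]
      exact (hεs _ (hmem t).1 (hmem t).2).le
    rw [hηs hd t, ← hW, hρ.dens_eq_enth hA hγ (hmem t).1]
  refine IsAn.of_fixedPoint tendsto_centerPar (ContinuousLinearMap.id ℝ ℝ)
    (fun _ => ContinuousMap.const _ (enth A γ R ρ 0)) T analyticAt_const rfl hT hρ.radius_pos
    (hρ.continuousOn_enth hγ) ?_
  filter_upwards [hSd, Ioo_mem_nhdsGT hR] with z h1 hz W hW t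
  have h2 := avg_path (a := 2) (by norm_num) (h1 W hW)
  have h3 : ∀ t : I01, grav g₀ R ρ (t * z) =
      (ContinuousMap.const _ (4 * Real.pi * g₀) * avgCLM 2 (by norm_num) (S W) : C(I01, ℝ)) t := by
    intro t; rw [grav, h2]; rfl
  have h4 := avg_path (a := 1) (by norm_num) h3 t
  have h5 : (ContinuousMap.const _ (4 * Real.pi * g₀) * avgCLM 2 (by norm_num) (S W) : C(I01, ℝ))
      = (4 * Real.pi * g₀) • avgCLM 2 (by norm_num) (S W) := by ext; rfl
  rw [h5, map_smul, ContinuousMap.smul_apply, smul_eq_mul] at h4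
  rw [centerPar_eq z hz.1, ← hW]
  simp only [T, ContinuousMap.mul_apply, ContinuousMap.const_apply, powPath, ContinuousMap.coe_mk]
  rcases t.2.1.eq_or_lt with ht | ht
  · rw [← ht]; simp [Real.zero_rpow]
  · rw [hρ.enth_center hγ ⟨mul_pos ht hz.1,
      (mul_le_of_le_one_left hz.1.le t.2.2).trans_lt hz.2⟩, h4, Real.mul_rpow t.2.1 hz.1.le]
    ring

theorem isAn_dens_center (hρ : IsEquilibrium A γ g₀ R ρc ρ) (hA : 0 < A) (hγ : 1 < γ) :
    IsAn centerPar (dens R ρ) := by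
  have hB : 0 < (γ - 1) / (A * γ) := div_pos (by linarith) (by nlinarith)
  have h := (hρ.isAn_enth_center hA hγ).comp tendsto_centerPar
    (analyticAt_const_mul_rpow (a := 1 / (γ - 1)) hB
      (hρ.enth_pos hA hγ ⟨le_rfl, hρ.radius_pos⟩))
  refine h.congr (hρ.dens_eq_enth hA hγ ⟨le_rfl, hρ.radius_pos.le⟩) ?_
  filter_upwards [Icc_mem_nhdsGT hρ.radius_pos] with r hr using hρ.dens_eq_enth hA hγ hr

theorem isAn_grav_center (hρ : IsEquilibrium A γ g₀ R ρc ρ) (hA : 0 < A) (hγ : 1 < γ) :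
    IsAn centerPar (grav g₀ R ρ) :=
  (IsAn.const _).mul ((hρ.isAn_dens_center hA hγ).avg (by norm_num))

end IsEquilibrium

/-- The gravity as a function of the depth `z = R - r`. -/
def surfGrav (g₀ R : ℝ) (ρ : ℝ → ℝ) (z : ℝ) : ℝ := (R - z) * grav g₀ R ρ (R - z)

/-- The enthalpy divided by the depth `z = R - r`. -/
def surfEnth (g₀ R : ℝ) (ρ : ℝ → ℝ) : ℝ → ℝ := avg 0 (surfGrav g₀ R ρ)

namespace IsEquilibrium

variable {A γ g₀ R ρc : ℝ} {ρ : ℝ → ℝ}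

theorem continuousOn_surfGrav (hρ : IsEquilibrium A γ g₀ R ρc ρ) :
    ContinuousOn (surfGrav g₀ R ρ) (Icc 0 R) :=
  (continuousOn_const.sub continuousOn_id).mul (hρ.continuousOn_grav.comp
    (continuousOn_const.sub continuousOn_id) fun _ hz =>
      ⟨sub_nonneg.2 hz.2, sub_le_self _ hz.1⟩)

theorem continuousOn_surfEnth (hρ : IsEquilibrium A γ g₀ R ρc ρ) :
    ContinuousOn (surfEnth g₀ R ρ) (Icc 0 R) :=
  continuousOn_avg (by norm_num) hρ.radius_pos hρ.continuousOn_surfGrav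

theorem surfEnth_zero : surfEnth g₀ R ρ 0 = surfGrav g₀ R ρ 0 := by
  rw [surfEnth, avg_zero (by norm_num)]; norm_num

theorem surfGrav_zero_pos (hρ : IsEquilibrium A γ g₀ R ρc ρ) (hg₀ : 0 < g₀) :
    0 < surfGrav g₀ R ρ 0 := by
  rw [surfGrav, sub_zero]
  exact mul_pos hρ.radius_pos (hρ.grav_pos hg₀ ⟨hρ.radius_pos, le_rfl⟩)

theorem _root_.Stellar.hasDerivAt_comp_const_sub {f : ℝ → ℝ} {f' R z : ℝ}
    (hf : HasDerivAt f f' (R - z)) : HasDerivAt (fun z => f (R - z)) (-f') z := by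
  exact hf.comp_const_sub R z

theorem _root_.Stellar.sub_mem_Ioo {R z : ℝ} (hz : z ∈ Ioo 0 R) : R - z ∈ Ioo 0 R :=
  ⟨sub_pos.2 hz.2, sub_lt_self _ hz.1⟩

/-- The enthalpy vanishes at R and its derivative in the depth is the surface gravity, so it is the
integral of that gravity over (0, z). -/
theorem enth_surface (hρ : IsEquilibrium A γ g₀ R ρc ρ) (hγ : 1 < γ) {z : ℝ}
    (hz : z ∈ Ioo 0 R) : enth A γ R ρ (R - z) = z * surfEnth g₀ R ρ z := by
  have hR := hρ.radius_pos
  have h := eq_rpow_mul_avg (a := 0) (by norm_num) hρ.continuousOn_surfGrav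
    (F := fun z => enth A γ R ρ (R - z))
    (fun z hz => (hasDerivAt_comp_const_sub (hρ.hasDerivAt_enth hγ (sub_mem_Ioo hz))).congr_deriv
      (by rw [Real.rpow_zero, surfGrav]; ring)) ?_ hz
  · simpa [surfEnth] using h
  · have h1 : ContinuousOn (fun z => enth A γ R ρ (R - z)) (Icc 0 R) :=
      (hρ.continuousOn_enth hγ).comp (continuousOn_const.sub continuousOn_id) fun z hz =>
        ⟨sub_nonneg.2 hz.2, sub_le_self _ hz.1⟩
    have h2 := (h1 0 ⟨le_rfl, hR.le⟩).tendsto.mono_left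
      (nhdsWithin_le_iff.2 (Icc_mem_nhdsGT hR))
    simpa [hρ.enth_radius hγ] using h2

theorem surfEnth_pos (hρ : IsEquilibrium A γ g₀ R ρc ρ) (hA : 0 < A) (hγ : 1 < γ)
    (hg₀ : 0 < g₀) {z : ℝ} (hz : z ∈ Ico 0 R) : 0 < surfEnth g₀ R ρ z := by
  rcases hz.1.eq_or_lt with h | h
  · rw [← h, surfEnth_zero]; exact hρ.surfGrav_zero_pos hg₀
  · have hz' : z ∈ Ioo 0 R := ⟨h, hz.2⟩
    have h1 := hρ.enth_pos hA hγ (Ioo_subset_Ico_self (sub_mem_Ioo hz'))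
    rw [hρ.enth_surface hγ hz'] at h1
    exact pos_of_mul_pos_right h1 h.le

/-- Only the factor z^(1/(γ-1)) is singular: the other base stays positive up to z = 0, where its
power is analytic. -/
theorem dens_surface (hρ : IsEquilibrium A γ g₀ R ρc ρ) (hA : 0 < A) (hγ : 1 < γ)
    (hg₀ : 0 < g₀) {z : ℝ} (hz : z ∈ Ioo 0 R) :
    ρ (R - z) = z ^ (1 / (γ - 1)) *
      ((γ - 1) / (A * γ) * surfEnth g₀ R ρ z) ^ (1 / (γ - 1)) := by
  have hB : 0 < (γ - 1) / (A * γ) := div_pos (by linarith) (by nlinarith)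
  have hq := hρ.surfEnth_pos hA hγ hg₀ (Ioo_subset_Ico_self hz)
  rw [← hρ.dens_eq (sub_mem_Ioo hz), hρ.dens_eq_enth hA hγ (Ioo_subset_Icc_self (sub_mem_Ioo hz)),
    hρ.enth_surface hγ hz, ← Real.mul_rpow hz.1.le (by positivity)]
  congr 1; ring

/-- `4πg₀ r² ρ / z^(1/(γ-1))` at `r = R - z`. -/
def _root_.Stellar.surfSource (A γ g₀ R : ℝ) (ρ : ℝ → ℝ) (z : ℝ) : ℝ :=
  4 * Real.pi * g₀ * (R - z) ^ 2 * ((γ - 1) / (A * γ) * surfEnth g₀ R ρ z) ^ (1 / (γ - 1))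

theorem continuousOn_surfSource (hρ : IsEquilibrium A γ g₀ R ρc ρ) (hγ : 1 < γ) :
    ContinuousOn (surfSource A γ g₀ R ρ) (Icc 0 R) := by
  refine ContinuousOn.mul (by fun_prop) ?_
  refine (continuousOn_const.mul hρ.continuousOn_surfEnth).rpow_const fun _ _ => Or.inr ?_
  exact one_div_nonneg.2 (by linarith)

/-- The mass inside R - z is the total mass minus that of the outer shell. The shell integrates a
density of order z^(1/(γ-1)), which is the source of the second parameter z^(γ/(γ-1)). -/
theorem surfGrav_eq (hρ : IsEquilibrium A γ g₀ R ρc ρ) (hA : 0 < A) (hγ : 1 < γ)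
    (hg₀ : 0 < g₀) {z : ℝ} (hz : z ∈ Ioo 0 R) :
    surfGrav g₀ R ρ z = ((R - z) ^ 2)⁻¹ * (R ^ 2 * surfGrav g₀ R ρ 0 -
      z ^ (1 / (γ - 1) + 1) * avg (1 / (γ - 1)) (surfSource A γ g₀ R ρ) z) := by
  have hR := hρ.radius_pos
  have hν : -1 < 1 / (γ - 1) := lt_trans (by norm_num) (one_div_pos.2 (sub_pos.2 hγ))
  have h := eq_rpow_mul_avg hν (hρ.continuousOn_surfSource hγ)
    (F := fun z => R ^ 2 * surfGrav g₀ R ρ 0 - (R - z) ^ 3 * grav g₀ R ρ (R - z))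
    (fun z hz => ((hasDerivAt_comp_const_sub
      (hρ.hasDerivAt_mass (sub_mem_Ioo hz))).const_sub _).congr_deriv (by
        rw [hρ.dens_surface hA hγ hg₀ hz, surfSource]; ring)) ?_ hz
  · have : R - z ≠ 0 := (sub_mem_Ioo hz).1.ne'
    rw [← h, surfGrav]
    field_simp
    ring
  · have h1 : ContinuousOn (fun z => (R - z) ^ 2 * surfGrav g₀ R ρ z) (Icc 0 R) :=
      ContinuousOn.mul (by fun_prop) hρ.continuousOn_surfGrav
    have h2 := ((h1 0 ⟨le_rfl, hR.le⟩).tendsto.mono_left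
      (nhdsWithin_le_iff.2 (Icc_mem_nhdsGT hR))).const_sub (R ^ 2 * surfGrav g₀ R ρ 0)
    simp only [sub_zero, sub_self] at h2
    refine h2.congr fun z => ?_
    simp only [surfGrav]; ring

/-- Inserting the shell formula into q = avg 0 (`surfGrav`) closes the equation for q = h/z. The
unknown enters only through the shell mass, hence with the small factor ℓ = z^(γ/(γ-1)); everything
else depends on z alone. -/
theorem isAn_surfEnth (hρ : IsEquilibrium A γ g₀ R ρc ρ) (hA : 0 < A) (hγ : 1 < γ)
    (hg₀ : 0 < g₀) : IsAn (surfacePar (1 / (γ - 1) + 1)) (surfEnth g₀ R ρ) := by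
  have hR := hρ.radius_pos
  have hν0 : 0 < 1 / (γ - 1) := one_div_pos.2 (sub_pos.2 hγ)
  have hν : -1 < 1 / (γ - 1) := by linarith
  set ν := 1 / (γ - 1) with hνdef
  have hb : 0 < ν + 1 := by linarith
  have hB : 0 < (γ - 1) / (A * γ) := div_pos (by linarith) (by nlinarith)
  have hp := tendsto_surfacePar hb
  have hq0 : 0 < surfEnth g₀ R ρ 0 := surfEnth_zero (ρ := ρ) ▸ hρ.surfGrav_zero_pos hg₀
  have hRz : IsAn (surfacePar (ν + 1)) (fun z => R - z) := (IsAn.const R).sub isAn_id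
  have hinv : IsAn (surfacePar (ν + 1)) (fun z => ((R - z) ^ 2)⁻¹) :=
    hRz.comp hp (φ := fun x => (x ^ 2)⁻¹)
      ((analyticAt_id.pow 2).inv (by simpa using hR.ne'))
  have hsq : IsAn (surfacePar (ν + 1)) (fun z => 4 * Real.pi * g₀ * (R - z) ^ 2) :=
    (IsAn.const _).mul (hRz.comp hp (φ := fun x => x ^ 2) (analyticAt_id.pow 2))
  obtain ⟨I2, hI2, hI20, hI2z⟩ := hinv
  obtain ⟨J, hJ, -, hJz⟩ := hsq
  obtain ⟨S, hS, hS0, hSφ⟩ := exists_analytic_superposition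
    (analyticAt_const_mul_rpow (a := ν) hB hq0)
  let T : (ℝ × ℝ) × C(I01, ℝ) → C(I01, ℝ) := fun q =>
    -avgCLM 0 (by norm_num) (I2 q.1 * (powPath (ν + 1) hb.le * avgCLM ν hν (J q.1 * S q.2)))
  let g : ℝ × ℝ → C(I01, ℝ) := fun q =>
    avgCLM 0 (by norm_num) (I2 q * ContinuousMap.const _ (R ^ 2 * surfGrav g₀ R ρ 0))
  have hg : AnalyticAt ℝ g 0 :=
    ((avgCLM 0 (by norm_num)).analyticAt _).fun_comp (hI2.mul analyticAt_const)
  have hg0 : g 0 = ContinuousMap.const _ (surfEnth g₀ R ρ 0) := by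
    simp only [g, hI20]
    have : (ContinuousMap.const I01 (((R - 0) ^ 2)⁻¹) *
        ContinuousMap.const I01 (R ^ 2 * surfGrav g₀ R ρ 0)) =
        ContinuousMap.const I01 (surfEnth g₀ R ρ 0) := by
      ext t
      simp only [ContinuousMap.mul_apply, ContinuousMap.const_apply, surfEnth_zero, sub_zero]
      field_simp
    rw [this, avgCLM_const]; simp
  have hT : AnalyticAt ℝ T (0, g 0) := by
    rw [hg0]
    have h1 : AnalyticAt ℝ (fun q : (ℝ × ℝ) × C(I01, ℝ) => S q.2)
        (0, ContinuousMap.const _ (surfEnth g₀ R ρ 0)) :=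
      AnalyticAt.fun_comp (g := S) hS analyticAt_snd
    have h2 : AnalyticAt ℝ (fun q : (ℝ × ℝ) × C(I01, ℝ) => I2 q.1)
        (0, ContinuousMap.const _ (surfEnth g₀ R ρ 0)) :=
      AnalyticAt.fun_comp (g := I2) hI2 analyticAt_fst
    have h3 : AnalyticAt ℝ (fun q : (ℝ × ℝ) × C(I01, ℝ) => J q.1)
        (0, ContinuousMap.const _ (surfEnth g₀ R ρ 0)) :=
      AnalyticAt.fun_comp (g := J) hJ analyticAt_fst
    have h4 := ((avgCLM ν hν).analyticAt _).fun_comp (h3.mul h1)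
    exact (((avgCLM 0 (by norm_num)).analyticAt _).fun_comp
      (h2.mul (analyticAt_const.mul h4))).neg
  have hcont := hρ.continuousOn_surfEnth
  have hSd : ∀ᶠ z in 𝓝[>] (0 : ℝ), ∀ W : C(I01, ℝ),
      (∀ t : I01, surfEnth g₀ R ρ (t * z) = W t) →
      ∀ t : I01, ((γ - 1) / (A * γ) * surfEnth g₀ R ρ (t * z)) ^ ν = S W t := by
    obtain ⟨η, hη, hηs⟩ := Metric.eventually_nhds_iff.1 hSφ
    obtain ⟨ε, hε, hεs⟩ := Metric.continuousOn_iff.1 hcont 0 ⟨le_rfl, hR.le⟩ (η / 2) (half_pos hη)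
    filter_upwards [Ioo_mem_nhdsGT (lt_min hε hR)] with z hz W hW t
    have hmem : ∀ t : I01, (t : ℝ) * z ∈ Icc 0 R ∧ dist ((t : ℝ) * z) 0 < ε := by
      intro t
      have h1 := mul_le_of_le_one_left hz.1.le t.2.2
      have h2 := mul_nonneg t.2.1 hz.1.le
      refine ⟨⟨h2, h1.trans (hz.2.le.trans (min_le_right _ _))⟩, ?_⟩
      rw [Real.dist_0_eq_abs, abs_of_nonneg h2]
      exact h1.trans_lt (hz.2.trans_le (min_le_left _ _))
    have hd : dist W (ContinuousMap.const _ (surfEnth g₀ R ρ 0)) < η := by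
      refine lt_of_le_of_lt ((ContinuousMap.dist_le (half_pos hη).le).2 fun t => ?_)
        (half_lt_self hη)
      rw [← hW]
      exact (hεs _ (hmem t).1 (hmem t).2).le
    rw [hηs hd t, ← hW]
  refine IsAn.of_fixedPoint hp (ContinuousLinearMap.snd ℝ ℝ ℝ) g T hg hg0 hT hR hcont ?_
  filter_upwards [hSd, hI2z, hJz, Ioo_mem_nhdsGT hR] with z h1 h2 h3 hz W hW t
  have h4 : ∀ t : I01, surfSource A γ g₀ R ρ (t * z) = (J (surfacePar (ν + 1) z) * S W) t := by
    intro t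
    rw [surfSource, h1 W hW, h3]; rfl
  have h5 := avg_path hν h4
  have h6 : ∀ t : I01, surfGrav g₀ R ρ (t * z) =
      (I2 (surfacePar (ν + 1) z) * ContinuousMap.const _ (R ^ 2 * surfGrav g₀ R ρ 0) -
        (z ^ (ν + 1)) • (I2 (surfacePar (ν + 1) z) * (powPath (ν + 1) hb.le *
          avgCLM ν hν (J (surfacePar (ν + 1) z) * S W))) : C(I01, ℝ)) t := by
    intro t
    simp only [ContinuousMap.sub_apply, ContinuousMap.smul_apply, ContinuousMap.mul_apply,
      ContinuousMap.const_apply, powPath, ContinuousMap.coe_mk, smul_eq_mul, ← h5, ← h2]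
    rcases t.2.1.eq_or_lt with ht | ht
    · rw [← ht]; simp [Real.zero_rpow hb.ne', hR.ne']
    · rw [hρ.surfGrav_eq hA hγ hg₀ ⟨mul_pos ht hz.1,
        (mul_le_of_le_one_left hz.1.le t.2.2).trans_lt hz.2⟩, ← hνdef,
        Real.mul_rpow t.2.1 hz.1.le]
      ring
  have h7 := avg_path (a := 0) (by norm_num) h6 t
  rw [map_sub, map_smul] at h7
  rw [← hW, surfEnth, h7]
  simp only [g, T, ContinuousMap.sub_apply, ContinuousMap.smul_apply, ContinuousMap.neg_apply,
    smul_eq_mul, ContinuousLinearMap.coe_snd', surfacePar]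
  ring

theorem isAn_surfGrav (hρ : IsEquilibrium A γ g₀ R ρc ρ) (hA : 0 < A) (hγ : 1 < γ)
    (hg₀ : 0 < g₀) : IsAn (surfacePar (1 / (γ - 1) + 1)) (surfGrav g₀ R ρ) := by
  have hR := hρ.radius_pos
  have hν0 : 0 < 1 / (γ - 1) := one_div_pos.2 (sub_pos.2 hγ)
  have hb : 0 < 1 / (γ - 1) + 1 := by linarith
  have hB : 0 < (γ - 1) / (A * γ) := div_pos (by linarith) (by nlinarith)
  have hp := tendsto_surfacePar hb
  have hq0 : 0 < surfEnth g₀ R ρ 0 := surfEnth_zero (ρ := ρ) ▸ hρ.surfGrav_zero_pos hg₀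
  have hRz : IsAn (surfacePar (1 / (γ - 1) + 1)) (fun z => R - z) := (IsAn.const R).sub isAn_id
  have hinv : IsAn (surfacePar (1 / (γ - 1) + 1)) (fun z => ((R - z) ^ 2)⁻¹) :=
    hRz.comp hp (φ := fun x => (x ^ 2)⁻¹)
      ((analyticAt_id.pow 2).inv (by simpa using hR.ne'))
  have hsrc : IsAn (surfacePar (1 / (γ - 1) + 1)) (surfSource A γ g₀ R ρ) :=
    ((IsAn.const _).mul (hRz.comp hp (φ := fun x => x ^ 2) (analyticAt_id.pow 2))).mul
      ((hρ.isAn_surfEnth hA hγ hg₀).comp hp (analyticAt_const_mul_rpow hB hq0))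
  have h := hinv.mul ((IsAn.const (R ^ 2 * surfGrav g₀ R ρ 0)).sub
    ((isAn_rpow hb).mul (hsrc.avg (a := 1 / (γ - 1)) (by linarith))))
  refine h.congr ?_ ?_
  · rw [Real.zero_rpow hb.ne', zero_mul, sub_zero, sub_zero]
    field_simp
  · filter_upwards [Ioo_mem_nhdsGT hR] with z hz using hρ.surfGrav_eq hA hγ hg₀ hz

end IsEquilibrium

end

/-! ### Solutions near the centre and near the surface -/

section

/-- Uniqueness for the linear system `y' = a v`, `v' = b y`. -/
theorem linear_system_eq_zero {a b y v : ℝ → ℝ} {s R : ℝ} (ha : ContinuousOn a (Ioo s R))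
    (hb : ContinuousOn b (Ioo s R)) (hy : ∀ r ∈ Ioo s R, HasDerivAt y (a r * v r) r)
    (hv : ∀ r ∈ Ioo s R, HasDerivAt v (b r * y r) r) {r₀ : ℝ} (hr₀ : r₀ ∈ Ioo s R)
    (hy0 : y r₀ = 0) (hv0 : v r₀ = 0) {r : ℝ} (hr : r ∈ Ioo s R) : y r = 0 := by
  -- A compact subinterval around r and r₀ gives bounded coefficients, hence one Lipschitz constant,
  -- although the coefficients may blow up at s and R.
  obtain ⟨s', hs', hs'1⟩ := exists_between (lt_min hr.1 hr₀.1)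
  obtain ⟨R', hR'1, hR'⟩ := exists_between (max_lt hr.2 hr₀.2)
  rw [lt_min_iff] at hs'1
  rw [max_lt_iff] at hR'1
  have hsub : Icc s' R' ⊆ Ioo s R := fun x hx => ⟨hs'.trans_le hx.1, hx.2.trans_lt hR'⟩
  obtain ⟨K₁, hK₁⟩ := isCompact_Icc.exists_bound_of_continuousOn (ha.mono hsub)
  obtain ⟨K₂, hK₂⟩ := isCompact_Icc.exists_bound_of_continuousOn (hb.mono hsub)
  have hK : 0 ≤ max K₁ K₂ :=
    (norm_nonneg _).trans ((hK₁ r ⟨hs'1.1.le, hR'1.1.le⟩).trans (le_max_left _ _))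
  have hlip : ∀ t ∈ Ioo s' R', LipschitzOnWith ⟨max K₁ K₂, hK⟩
      (fun q : ℝ × ℝ => (a t * q.2, b t * q.1)) univ := by
    intro t ht
    refine (LipschitzWith.of_dist_le_mul fun q q' => ?_).lipschitzOnWith
    have h1 := hK₁ t (Ioo_subset_Icc_self ht)
    have h2 := hK₂ t (Ioo_subset_Icc_self ht)
    simp only [Prod.dist_eq, Real.dist_eq, ← mul_sub, abs_mul]
    refine max_le ?_ ?_
    · exact mul_le_mul (h1.trans (le_max_left _ _)) (le_max_right _ _) (abs_nonneg _) hK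
    · exact mul_le_mul (h2.trans (le_max_right _ _)) (le_max_left _ _) (abs_nonneg _) hK
  have h := ODE_solution_unique_of_mem_Ioo (v := fun (t : ℝ) (q : ℝ × ℝ) => (a t * q.2, b t * q.1))
    (s := fun _ => univ) (f := fun t => (y t, v t)) (g := fun _ => (0, 0)) (t₀ := r₀)
    hlip ⟨hs'1.2, hR'1.2⟩
    (fun t ht => ⟨(hy t (hsub (Ioo_subset_Icc_self ht))).prodMk
      (hv t (hsub (Ioo_subset_Icc_self ht))), mem_univ _⟩)
    (fun t ht => ⟨(hasDerivAt_const t ((0 : ℝ), (0 : ℝ))).congr_deriv (by simp; rfl), mem_univ _⟩)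
    (by simp [hy0, hv0])
  exact congrArg Prod.fst (h ⟨hs'1.1, hR'1.1⟩)

/-- The flux `γ r⁴ P y'`. -/
def flux (A γ : ℝ) (ρ y : ℝ → ℝ) (r : ℝ) : ℝ := γ * r ^ 4 * pressure A γ ρ r * deriv y r

/-- The coefficient `e` in `(γ r⁴ P y')' = r⁴ e y`. -/
def potential (γ g₀ R lam : ℝ) (ρ : ℝ → ℝ) (r : ℝ) : ℝ :=
  -(dens R ρ r * ((4 - 3 * γ) * grav g₀ R ρ r + lam))

namespace IsEquilibrium

variable {A γ g₀ R ρc : ℝ} {ρ : ℝ → ℝ}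

theorem pressure_pos (hρ : IsEquilibrium A γ g₀ R ρc ρ) (hA : 0 < A) {r : ℝ}
    (hr : r ∈ Ioo 0 R) : 0 < pressure A γ ρ r :=
  mul_pos hA (Real.rpow_pos_of_pos (hρ.pos r hr) _)

theorem flux_coeff_pos (hρ : IsEquilibrium A γ g₀ R ρc ρ) (hA : 0 < A) (hγ : 1 < γ) {r : ℝ}
    (hr : r ∈ Ioo 0 R) : 0 < γ * r ^ 4 * pressure A γ ρ r := by
  have := hρ.pressure_pos hA hr
  have := hr.1
  positivity

variable {lam s : ℝ} {y : ℝ → ℝ}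

theorem hasDerivAt_solution (hρ : IsEquilibrium A γ g₀ R ρc ρ) (hA : 0 < A) (hγ : 1 < γ)
    (hs : 0 ≤ s) (hy : IsSolution A γ R ρ lam s y) {r : ℝ} (hr : r ∈ Ioo s R) :
    HasDerivAt y ((γ * r ^ 4 * pressure A γ ρ r)⁻¹ * flux A γ ρ y r) r := by
  have h := (hρ.flux_coeff_pos hA hγ (Ioo_subset_Ioo_left hs hr)).ne'
  rw [flux, inv_mul_cancel_left₀ h]
  exact ((hy.1.contDiffAt (isOpen_Ioo.mem_nhds hr)).differentiableAt (by norm_num)).hasDerivAt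

/-- Hydrostatic balance P' = -ρ r·`grav` turns the zero-order term of `opL` into a multiple of
`grav`, so `potential` has no singularity at the centre. -/
theorem hasDerivAt_flux (hρ : IsEquilibrium A γ g₀ R ρc ρ) (hγ : 1 < γ)
    (hs : 0 ≤ s) (hy : IsSolution A γ R ρ lam s y) {r : ℝ} (hr : r ∈ Ioo s R) :
    HasDerivAt (flux A γ ρ y) (r ^ 4 * potential γ g₀ R lam ρ r * y r) r := by
  have hr' : r ∈ Ioo 0 R := Ioo_subset_Ioo_left hs hr
  have hd : DifferentiableAt ℝ (flux A γ ρ y) r := by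
    have h1 : DifferentiableAt ℝ (deriv y) r :=
      ((hy.1.deriv_of_isOpen (m := 1) isOpen_Ioo
        (by norm_num)).differentiableOn (by norm_num)).differentiableAt (isOpen_Ioo.mem_nhds hr)
    have h2 : DifferentiableAt ℝ (pressure A γ ρ) r :=
      (hρ.contDiffOn_pressure.contDiffAt (isOpen_Ioo.mem_nhds hr')).differentiableAt (by norm_num)
    exact (((differentiableAt_id.pow 4).const_mul γ).mul h2).mul h1
  have h := hy.2 r hr
  refine hd.hasDerivAt.congr_deriv ?_
  rw [opL, hρ.deriv_pressure hγ hr'] at h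
  change -(1 / (ρ r * r ^ 4)) * deriv (flux A γ ρ y) r + _ = _ at h
  rw [potential, hρ.dens_eq hr']
  have hr0 : r ≠ 0 := hr'.1.ne'
  have hp0 : ρ r ≠ 0 := (hρ.pos r hr').ne'
  field_simp at h
  linear_combination -h

theorem continuousOn_potential (hρ : IsEquilibrium A γ g₀ R ρc ρ) :
    ContinuousOn (potential γ g₀ R lam ρ) (Icc 0 R) :=
  (hρ.continuousOn_dens.mul ((continuousOn_const.mul hρ.continuousOn_grav).add
    continuousOn_const)).neg

/-- Two solutions that are proportional on a subinterval are proportional. -/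
theorem solution_proportional (hρ : IsEquilibrium A γ g₀ R ρc ρ) (hA : 0 < A) (hγ : 1 < γ)
    {s₁ s₂ : ℝ} {y₁ y₂ : ℝ → ℝ} (hs₁ : 0 ≤ s₁) (hs₂ : 0 ≤ s₂) (h₁ : IsSolution A γ R ρ lam s₁ y₁)
    (h₂ : IsSolution A γ R ρ lam s₂ y₂) {c r₀ : ℝ} (hr₀ : r₀ ∈ Ioo (max s₁ s₂) R)
    (heq : ∀ᶠ r in 𝓝 r₀, y₁ r = c * y₂ r) {r : ℝ} (hr : r ∈ Ioo (max s₁ s₂) R) :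
    y₁ r = c * y₂ r := by
  have hsub₁ : Ioo (max s₁ s₂) R ⊆ Ioo s₁ R := Ioo_subset_Ioo_left (le_max_left _ _)
  have hsub₂ : Ioo (max s₁ s₂) R ⊆ Ioo s₂ R := Ioo_subset_Ioo_left (le_max_right _ _)
  have hsub : Ioo (max s₁ s₂) R ⊆ Ioo 0 R := hsub₁.trans (Ioo_subset_Ioo_left hs₁)
  have hcP : ContinuousOn (fun r => γ * r ^ 4 * pressure A γ ρ r) (Ioo (max s₁ s₂) R) :=
    ContinuousOn.mul (by fun_prop) (hρ.contDiffOn_pressure.continuousOn.mono hsub)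
  have h := linear_system_eq_zero (y := fun r => y₁ r - c * y₂ r)
    (v := fun r => flux A γ ρ y₁ r - c * flux A γ ρ y₂ r)
    (a := fun r => (γ * r ^ 4 * pressure A γ ρ r)⁻¹)
    (b := fun r => r ^ 4 * potential γ g₀ R lam ρ r)
    (hcP.inv₀ fun r hr => (hρ.flux_coeff_pos hA hγ (hsub hr)).ne')
    (ContinuousOn.mul (by fun_prop) (hρ.continuousOn_potential.mono
      (hsub.trans Ioo_subset_Icc_self)))
    (fun r hr => ((hρ.hasDerivAt_solution hA hγ hs₁ h₁ (hsub₁ hr)).sub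
      ((hρ.hasDerivAt_solution hA hγ hs₂ h₂ (hsub₂ hr)).const_mul c)).congr_deriv (by ring))
    (fun r hr => ((hρ.hasDerivAt_flux hγ hs₁ h₁ (hsub₁ hr)).sub
      ((hρ.hasDerivAt_flux hγ hs₂ h₂ (hsub₂ hr)).const_mul c)).congr_deriv (by ring))
    hr₀ (by rw [heq.self_of_nhds, sub_self]) ?_ hr
  · exact sub_eq_zero.1 h
  · have hd : deriv y₁ r₀ = c * deriv y₂ r₀ := by
      rw [EventuallyEq.deriv_eq (f := fun r => c * y₂ r) heq, deriv_const_mul_field]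
    simp only [flux, hd]
    ring

theorem integrableOn_of_memLp (hρ : IsEquilibrium A γ g₀ R ρc ρ) {t : ℝ} (ht : 0 ≤ t)
    (hy : MemLp y 2 ((weight R ρ).restrict (Ioo t R))) :
    IntegrableOn (fun r => r ^ 4 * ρ r * y r ^ 2) (Ioo t R) := by
  have h1 := hy.integrable_sq
  have hsub : Ioo t R ⊆ Ioo 0 R := Ioo_subset_Ioo_left ht
  rw [weight, restrict_withDensity measurableSet_Ioo,
    Measure.restrict_restrict measurableSet_Ioo, inter_eq_left.2 hsub,
    integrable_withDensity_iff_integrable_smul₀' _ (by simp)] at h1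
  · refine IntegrableOn.congr_fun h1 (fun r hr => ?_) measurableSet_Ioo
    have h2 : 0 ≤ r ^ 4 * ρ r :=
      mul_nonneg (pow_nonneg (hsub hr).1.le 4) (hρ.pos r (hsub hr)).le
    simp only [ENNReal.toReal_ofReal h2, smul_eq_mul]
  · refine AEMeasurable.ennreal_ofReal (ContinuousOn.aemeasurable ?_ measurableSet_Ioo)
    exact ContinuousOn.mul (by fun_prop) (hρ.contDiffOn.continuousOn.mono hsub)

/-- Near the centre, solutions in `L²` are multiples of one analytic function of `r²`. -/
theorem exists_center_solution (hρ : IsEquilibrium A γ g₀ R ρc ρ) (hA : 0 < A) (hγ : 1 < γ)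
    (lam : ℝ) :
    ∃ y₁ : ℝ → ℝ, IsAn centerPar y₁ ∧ y₁ 0 = 1 ∧ ∀ y, IsSolution A γ R ρ lam 0 y →
      MemLp y 2 ((weight R ρ).restrict (Ioo 0 R)) →
      ∃ C : ℝ, ∀ᶠ r in 𝓝[>] (0 : ℝ), y r = C * y₁ r := by
  have hR := hρ.radius_pos
  have hc : IsAn centerPar (fun r => (γ - 1) * (dens R ρ r * enth A γ R ρ r)) :=
    (IsAn.const _).mul ((hρ.isAn_dens_center hA hγ).mul (hρ.isAn_enth_center hA hγ))
  have he : IsAn centerPar (potential γ g₀ R lam ρ) := by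
    have := (IsAn.const (-1)).mul ((hρ.isAn_dens_center hA hγ).mul
      (((IsAn.const (4 - 3 * γ)).mul (hρ.isAn_grav_center hA hγ)).add (IsAn.const lam)))
    refine this.congr ?_ (Eventually.of_forall fun r => ?_) <;> rw [potential] <;> ring
  have h0 : (0 : ℝ) ∈ Ico 0 R := ⟨le_rfl, hR⟩
  have hc0 : 0 < (γ - 1) * (dens R ρ 0 * enth A γ R ρ 0) :=
    mul_pos (by linarith) (mul_pos (hρ.dens_pos h0) (hρ.enth_pos hA hγ h0))
  obtain ⟨y₁, hy₁, hy₁0, heq⟩ := exists_regular_solution (k := 1) (n := 4) tendsto_centerPar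
    (ContinuousLinearMap.id ℝ ℝ) (by norm_num) (by norm_num) centerPar_eq hc hc0.ne' he
  refine ⟨y₁, hy₁, hy₁0, fun y hy hL => ?_⟩
  have hcoef : ∀ z ∈ Ioo 0 R, z ^ (4 : ℝ) * ((γ - 1) * (dens R ρ z * enth A γ R ρ z)) =
      γ * z ^ 4 * pressure A γ ρ z := by
    intro z hz
    have h4 : z ^ (4 : ℝ) = z ^ 4 := by rw [← Real.rpow_natCast]; norm_num
    rw [h4, hρ.dens_eq hz, ← hρ.pressure_eq hγ hz]; ring
  -- The limit point inequality n + 3 ≤ 2m is 7 ≤ 8.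
  refine eq_mul_regular_solution (k := 1) (n := 4) (m := 4) (δ := R / 2) (v := flux A γ ρ y)
    tendsto_centerPar (by norm_num) (by norm_num) (by norm_num) (by norm_num) (by norm_num)
    hc hc0 he hy₁ hy₁0 heq (half_pos hR) (fun z hz => ?_) (fun z hz => ?_) ?_
  · have hz' : z ∈ Ioo 0 R := ⟨hz.1, hz.2.trans (half_lt_self hR)⟩
    rw [hcoef z hz']
    exact (hρ.hasDerivAt_solution hA hγ le_rfl hy hz').congr_deriv (inv_mul_eq_div _ _)
  · have hz' : z ∈ Ioo 0 R := ⟨hz.1, hz.2.trans (half_lt_self hR)⟩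
    refine (hρ.hasDerivAt_flux hγ le_rfl hy hz').congr_deriv ?_
    have h4 : z ^ (4 : ℝ) = z ^ 4 := by rw [← Real.rpow_natCast]; norm_num
    rw [h4]; ring
  -- On (0, R/2) the density is bounded away from 0, so it can be divided out of the weight, leaving
  -- r⁴.
  · have h1 := (hρ.integrableOn_of_memLp le_rfl hL).mono_set
      (Ioo_subset_Ioo_right (half_le_self hR.le) : Ioo 0 (R / 2) ⊆ Ioo 0 R)
    rw [← intervalIntegrable_iff_integrableOn_Ioo_of_le (half_pos hR).le] at h1 ⊢
    have hd : ContinuousOn (fun r => (dens R ρ r)⁻¹) (uIcc 0 (R / 2)) := by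
      rw [uIcc_of_le (half_pos hR).le]
      exact (hρ.continuousOn_dens.mono (Icc_subset_Icc_right (half_le_self hR.le))).inv₀
        fun r hr => (hρ.dens_pos ⟨hr.1, hr.2.trans_lt (half_lt_self hR)⟩).ne'
    have h2 := h1.mul_continuousOn hd
    rw [intervalIntegrable_iff_integrableOn_Ioo_of_le (half_pos hR).le] at h2 ⊢
    refine h2.congr_fun (fun z hz => ?_) measurableSet_Ioo
    have hz' : z ∈ Ioo 0 R := ⟨hz.1, hz.2.trans (half_lt_self hR)⟩
    have h4 : z ^ (4 : ℝ) = z ^ 4 := by rw [← Real.rpow_natCast]; norm_num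
    have := (hρ.pos z hz').ne'
    simp only [hρ.dens_eq hz', h4]
    field_simp

/-- Near the surface, solutions in `L²` are multiples of one analytic function of the depth `z`
and `z^(γ/(γ-1))`. -/
theorem exists_surface_solution (hρ : IsEquilibrium A γ g₀ R ρc ρ) (hA : 0 < A) (hg₀ : 0 < g₀)
    (hγ : 1 < γ) (hγ' : γ ≤ 2) (lam : ℝ) :
    ∃ y₁ : ℝ → ℝ, IsAn (surfacePar (1 / (γ - 1) + 1)) y₁ ∧ y₁ 0 = 1 ∧
      ∀ s, 0 ≤ s → ∀ y, IsSolution A γ R ρ lam s y → ∀ t ∈ Ico s R,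
      MemLp y 2 ((weight R ρ).restrict (Ioo t R)) →
      ∃ C : ℝ, ∀ᶠ z in 𝓝[>] (0 : ℝ), y (R - z) = C * y₁ z := by
  have hR := hρ.radius_pos
  -- This is where γ ≤ 2 enters: with n = ν and m = ν + 1, the limit point inequality ν + 3 ≤ 2(ν +
  -- 1) is exactly ν ≥ 1.
  have hν1 : 1 ≤ 1 / (γ - 1) := by rw [le_div_iff₀ (by linarith)]; linarith
  have hν : -1 < 1 / (γ - 1) := by linarith
  set ν := 1 / (γ - 1) with hνdef
  have hb : 0 < ν + 1 := by linarith
  have hB : 0 < (γ - 1) / (A * γ) := div_pos (by linarith) (by nlinarith)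
  have hp := tendsto_surfacePar hb
  have hq := hρ.isAn_surfEnth hA hγ hg₀
  have h0 : (0 : ℝ) ∈ Ico 0 R := ⟨le_rfl, hR⟩
  have hqpos := fun z hz => hρ.surfEnth_pos (z := z) hA hγ hg₀ hz
  have hRz : IsAn (surfacePar (ν + 1)) (fun z => R - z) := (IsAn.const R).sub isAn_id
  let d : ℝ → ℝ := fun z => (R - z) ^ 4 * ((γ - 1) / (A * γ) * surfEnth g₀ R ρ z) ^ ν
  have hd : IsAn (surfacePar (ν + 1)) d :=
    (hRz.comp hp (φ := fun x => x ^ 4) (analyticAt_id.pow 4)).mul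
      (hq.comp hp (analyticAt_const_mul_rpow hB (hqpos 0 h0)))
  have hdpos : ∀ z ∈ Ico 0 R, 0 < d z := fun z hz => by
    have := hqpos z hz
    have : 0 < R - z := sub_pos.2 hz.2
    positivity
  have hdρ : ∀ z ∈ Ioo 0 R, (R - z) ^ 4 * ρ (R - z) = z ^ ν * d z := fun z hz => by
    rw [hρ.dens_surface hA hγ hg₀ hz]; simp only [d]; ring
  let c : ℝ → ℝ := fun z => (γ - 1) * (d z * surfEnth g₀ R ρ z)
  have hc : IsAn (surfacePar (ν + 1)) c := (IsAn.const _).mul (hd.mul hq)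
  have hc0 : 0 < c 0 := mul_pos (by linarith) (mul_pos (hdpos 0 h0) (hqpos 0 h0))
  let e : ℝ → ℝ := fun z =>
    -1 * (d z * ((4 - 3 * γ) * (surfGrav g₀ R ρ z * (R - z)⁻¹) + lam))
  have he : IsAn (surfacePar (ν + 1)) e :=
    (IsAn.const _).mul (hd.mul (((IsAn.const _).mul ((hρ.isAn_surfGrav hA hγ hg₀).mul
      (hRz.comp hp (φ := fun x => x⁻¹) (analyticAt_inv (by simpa using hR.ne'))))).add
      (IsAn.const _)))
  obtain ⟨y₁, hy₁, hy₁0, heq⟩ := exists_regular_solution (k := 0) (n := ν) hp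
    (ContinuousLinearMap.fst ℝ ℝ ℝ) le_rfl hν (fun z _ => by simp [surfacePar]) hc hc0.ne' he
  refine ⟨y₁, hy₁, hy₁0, fun s hs y hy t ht hL => ?_⟩
  have ht0 : 0 ≤ t := hs.trans ht.1
  have hRt : 0 < R - t := sub_pos.2 ht.2
  -- Half the available depth keeps z away from R, where the factor d would vanish when t = 0.
  set δ := (R - t) / 2 with hδdef
  have hδ : 0 < δ := half_pos hRt
  have hδt : ∀ z ∈ Ioo 0 δ, R - z ∈ Ioo s R := fun z hz =>
    ⟨by linarith [ht.1, hz.2, half_lt_self hRt], sub_lt_self _ hz.1⟩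
  have hδR : δ < R := by linarith
  have hz0 : ∀ z ∈ Ioo 0 δ, z ∈ Ioo 0 R := fun z hz => ⟨hz.1, hz.2.trans hδR⟩
  -- The depth decreases as r grows, hence the sign in v = -flux.
  refine eq_mul_regular_solution (k := 0) (n := ν) (m := ν + 1) (δ := δ)
    (y := fun z => y (R - z)) (v := fun z => -flux A γ ρ y (R - z))
    hp le_rfl hν (by ring) (by linarith) (by linarith) hc hc0 he hy₁ hy₁0 heq hδ
    (fun z hz => ?_) (fun z hz => ?_) ?_
  · have hcoef : γ * (R - z) ^ 4 * pressure A γ ρ (R - z) = z ^ (ν + 1) * c z := by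
      have h1 := hρ.pressure_eq hγ (sub_mem_Ioo (hz0 z hz))
      have h2 := hdρ z (hz0 z hz)
      rw [hρ.enth_surface hγ (hz0 z hz)] at h1
      rw [Real.rpow_add hz.1, Real.rpow_one]
      simp only [c]
      linear_combination (R - z) ^ 4 * h1 + (γ - 1) * z * surfEnth g₀ R ρ z * h2
    rw [← hcoef]
    refine (hasDerivAt_comp_const_sub (hρ.hasDerivAt_solution hA hγ hs hy
      (hδt z hz))).congr_deriv ?_
    rw [inv_mul_eq_div, neg_div]
  · refine ((hasDerivAt_comp_const_sub (hρ.hasDerivAt_flux hγ hs hy (hδt z hz))).neg).congr_deriv ?_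
    have h2 := hdρ z (hz0 z hz)
    have hne : R - z ≠ 0 := (sub_mem_Ioo (hz0 z hz)).1.ne'
    have h3 : surfGrav g₀ R ρ z * (R - z)⁻¹ = grav g₀ R ρ (R - z) := by
      rw [surfGrav]; field_simp
    simp only [e, potential, h3, hρ.dens_eq (sub_mem_Ioo (hz0 z hz))]
    linear_combination -((4 - 3 * γ) * grav g₀ R ρ (R - z) + lam) * y (R - z) * h2
  · have h1 := hρ.integrableOn_of_memLp ht0 hL
    rw [← intervalIntegrable_iff_integrableOn_Ioo_of_le ht.2.le] at h1
    have h2 := h1.comp_sub_left R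
    rw [sub_self] at h2
    have h3 : IntervalIntegrable
        (fun z => (R - z) ^ 4 * ρ (R - z) * y (R - z) ^ 2) volume 0 δ :=
      h2.symm.mono_set (by
        rw [uIcc_of_le hδ.le, uIcc_of_le hRt.le]
        exact Icc_subset_Icc_right (half_le_self hRt.le))
    have hdc : ContinuousOn (fun z => (d z)⁻¹) (uIcc 0 δ) := by
      rw [uIcc_of_le hδ.le]
      refine ContinuousOn.inv₀ ?_ fun z hz => (hdpos z ⟨hz.1, hz.2.trans_lt hδR⟩).ne'
      refine ContinuousOn.mul (by fun_prop) ((continuousOn_const.mul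
        (hρ.continuousOn_surfEnth.mono (Icc_subset_Icc_right hδR.le))).rpow_const
        fun _ _ => Or.inr (by linarith))
    have h4 := h3.mul_continuousOn hdc
    rw [intervalIntegrable_iff_integrableOn_Ioo_of_le hδ.le] at h4
    refine h4.congr_fun (fun z hz => ?_) measurableSet_Ioo
    have := (hdpos z (Ioo_subset_Ico_self (hz0 z hz))).ne'
    simp only [hdρ z (hz0 z hz)]
    field_simp

end IsEquilibrium

end

/-! ### Interior regularity of distributional solutions -/

section

variable {R : ℝ}

theorem exists_Ioo_of_isCompact {K : Set ℝ} (hK : IsCompact K) (hKR : K ⊆ Ioo 0 R) {r₀ : ℝ}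
    (hr₀ : r₀ ∈ Ioo 0 R) : ∃ c d, 0 < c ∧ d < R ∧ r₀ ∈ Ioo c d ∧ K ⊆ Ioo c d := by
  have hK' : IsCompact (insert r₀ K) := hK.insert r₀
  have hne : (insert r₀ K).Nonempty := ⟨r₀, mem_insert _ _⟩
  have hsub : insert r₀ K ⊆ Ioo 0 R := insert_subset hr₀ hKR
  obtain ⟨c, hc0, hc⟩ := exists_between (hsub (hK'.sInf_mem hne)).1
  obtain ⟨d, hd, hdR⟩ := exists_between (hsub (hK'.sSup_mem hne)).2
  have h : insert r₀ K ⊆ Ioo c d := fun x hx =>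
    ⟨hc.trans_le (csInf_le hK'.bddBelow hx), (le_csSup hK'.bddAbove hx).trans_lt hd⟩
  exact ⟨c, d, hc0, hdR, h (mem_insert _ _), (subset_insert _ _).trans h⟩

namespace IsTest

variable {φ ψ : ℝ → ℝ}

theorem deriv (hφ : IsTest R φ) : IsTest R (deriv φ) :=
  ⟨(contDiff_infty_iff_deriv.1 hφ.1).2, hφ.2.1.deriv, tsupport_deriv_subset.trans hφ.2.2⟩

theorem sub_const_mul (hφ : IsTest R φ) (hψ : IsTest R ψ) (c : ℝ) :
    IsTest R (fun r => φ r - c * ψ r) := by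
  have h1 : tsupport (fun r => φ r - c * ψ r) ⊆ tsupport φ ∪ tsupport ψ := by
    refine closure_minimal (fun x hx => ?_) ((isClosed_tsupport _).union (isClosed_tsupport _))
    by_contra h
    rw [mem_union, not_or] at h
    exact hx (by simp [image_eq_zero_of_notMem_tsupport h.1, image_eq_zero_of_notMem_tsupport h.2])
  refine ⟨hφ.1.sub (contDiff_const.mul hψ.1), ?_, h1.trans (union_subset hφ.2.2 hψ.2.2)⟩
  exact (hφ.2.1.isCompact.union hψ.2.1.isCompact).of_isClosed_subset (isClosed_tsupport _) h1

theorem hasDerivAt (hφ : IsTest R φ) (r : ℝ) : HasDerivAt φ (_root_.deriv φ r) r :=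
  (hφ.1.differentiable (by simp) r).hasDerivAt

theorem continuous (hφ : IsTest R φ) : Continuous φ := hφ.1.continuous

theorem eq_zero (hφ : IsTest R φ) {r : ℝ} (hr : r ∉ Ioo 0 R) : φ r = 0 :=
  image_eq_zero_of_notMem_tsupport fun h => hr (hφ.2.2 h)

theorem integrable_mul (hφ : IsTest R φ) {f : ℝ → ℝ} (hf : LocallyIntegrableOn f (Ioo 0 R)) :
    Integrable (fun r => f r * φ r) := by
  have h1 : IntegrableOn f (tsupport φ) := hf.integrableOn_compact_subset hφ.2.2 hφ.2.1
  have h2 : IntegrableOn (fun r => f r * φ r) (tsupport φ) :=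
    h1.mul_continuousOn hφ.continuous.continuousOn hφ.2.1
  refine (integrableOn_iff_integrable_of_support_subset fun x hx => ?_).1 h2
  by_contra h
  exact hx (by simp [image_eq_zero_of_notMem_tsupport h])

theorem integral_mul_eq (_ : IsTest R φ) (f : ℝ → ℝ) {c d : ℝ} (hcd : c ≤ d)
    (hsub : tsupport φ ⊆ Ioo c d) : ∫ r, f r * φ r = ∫ r in c..d, f r * φ r := by
  rw [intervalIntegral.integral_of_le hcd]
  refine (setIntegral_eq_integral_of_forall_compl_eq_zero fun x hx => ?_).symm
  have : x ∉ tsupport φ := fun h => hx (Ioo_subset_Ioc_self (hsub h))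
  simp [image_eq_zero_of_notMem_tsupport this]

/-- The primitive started left of the support vanishes again to its right exactly because the total
integral is 0. -/
theorem exists_primitive (hφ : IsTest R φ) (hR : 0 < R) (h0 : ∫ r, φ r = 0) :
    ∃ ψ, IsTest R ψ ∧ _root_.deriv ψ = φ := by
  obtain ⟨c, d, hc, hd, hr, hsub⟩ := exists_Ioo_of_isCompact hφ.2.1 hφ.2.2
    (r₀ := R / 2) ⟨half_pos hR, half_lt_self hR⟩
  have hcd : c < d := hr.1.trans hr.2
  have hder : ∀ r, HasDerivAt (fun r => ∫ s in c..r, φ s) (φ r) r := fun r =>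
    intervalIntegral.integral_hasDerivAt_right (hφ.continuous.intervalIntegrable _ _)
      hφ.continuous.stronglyMeasurable.stronglyMeasurableAtFilter hφ.continuous.continuousAt
  have hd' : _root_.deriv (fun r => ∫ s in c..r, φ s) = φ := funext fun r => (hder r).deriv
  have hzero : ∀ r, r ∉ Icc c d → ∫ s in c..r, φ s = 0 := by
    intro r hr
    rw [mem_Icc, not_and_or, not_le, not_le] at hr
    rcases hr with hr | hr
    · refine (intervalIntegral.integral_congr (g := fun _ => 0) fun x hx => ?_).trans (by simp)
      rw [uIcc_of_ge hr.le] at hx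
      exact image_eq_zero_of_notMem_tsupport fun h => absurd (hsub h).1 (not_lt.2 hx.2)
    · have h1 := hφ.integral_mul_eq (fun _ => 1) (hcd.le.trans hr.le)
        (hsub.trans (Ioo_subset_Ioo_right hr.le))
      simpa [h0] using h1.symm
  have hts : tsupport (fun r => ∫ s in c..r, φ s) ⊆ Icc c d := by
    refine closure_minimal (fun x hx => ?_) isClosed_Icc
    by_contra h
    exact hx (hzero x h)
  refine ⟨fun r => ∫ s in c..r, φ s, ⟨?_, ?_, hts.trans fun x hx => ?_⟩, hd'⟩
  · refine contDiff_infty_iff_deriv.2 ⟨fun r => (hder r).differentiableAt, ?_⟩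
    rw [hd']; exact hφ.1
  · exact isCompact_Icc.of_isClosed_subset (isClosed_tsupport _) hts
  · exact ⟨hc.trans_le hx.1, hx.2.trans_lt hd⟩

end IsTest

theorem exists_isTest_integral_one (hR : 0 < R) : ∃ φ, IsTest R φ ∧ ∫ r, φ r = 1 := by
  let b : ContDiffBump (R / 2) := ⟨R / 8, R / 4, by positivity, by linarith⟩
  refine ⟨b.normed volume, ⟨b.contDiff_normed, b.hasCompactSupport_normed, ?_⟩, b.integral_normed⟩
  rw [b.tsupport_normed_eq]
  intro x hx
  rw [Metric.mem_closedBall, Real.dist_eq, abs_le] at hx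
  simp only [b] at hx
  constructor <;> linarith [hx.1, hx.2]

theorem locallyIntegrableOn_of_continuousOn {f : ℝ → ℝ} (hf : ContinuousOn f (Ioo 0 R)) :
    LocallyIntegrableOn f (Ioo 0 R) := hf.locallyIntegrableOn measurableSet_Ioo

theorem ae_eq_zero_of_integral_test {f : ℝ → ℝ} (hf : LocallyIntegrableOn f (Ioo 0 R))
    (h : ∀ φ, IsTest R φ → ∫ r, f r * φ r = 0) : ∀ᵐ r, r ∈ Ioo 0 R → f r = 0 := by
  refine isOpen_Ioo.ae_eq_zero_of_integral_contDiff_smul_eq_zero hf fun φ h1 h2 h3 => ?_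
  rw [← h φ ⟨h1, h2, h3⟩]
  simp only [smul_eq_mul, mul_comm]

/-- The lemma of du Bois-Reymond. -/
theorem ae_eq_const_of_integral_deriv_test (hR : 0 < R) {f : ℝ → ℝ}
    (hf : LocallyIntegrableOn f (Ioo 0 R))
    (h : ∀ φ, IsTest R φ → ∫ r, f r * deriv φ r = 0) :
    ∃ c, ∀ᵐ r, r ∈ Ioo 0 R → f r = c := by
  obtain ⟨ψ₀, hψ₀, hψ₀1⟩ := exists_isTest_integral_one hR
  have hint : ∀ φ, IsTest R φ → Integrable φ := fun φ hφ =>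
    hφ.continuous.integrable_of_hasCompactSupport hφ.2.1
  refine ⟨∫ r, f r * ψ₀ r, ?_⟩
  set c := ∫ r, f r * ψ₀ r with hc
  have h1 := ae_eq_zero_of_integral_test (f := fun r => f r - c)
    (hf.sub (locallyIntegrableOn_of_continuousOn continuousOn_const)) fun φ hφ => ?_
  · filter_upwards [h1] with r hr hr'
    exact sub_eq_zero.1 (hr hr')
  -- Subtracting a multiple of the unit-mass bump removes the mean, which makes the difference the
  -- derivative of a test function.
  · have hχ := hφ.sub_const_mul hψ₀ (∫ r, φ r)
    obtain ⟨ψ, hψ, hψd⟩ := hχ.exists_primitive hR (by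
      rw [integral_sub (hint φ hφ) ((hint ψ₀ hψ₀).const_mul _), integral_const_mul, hψ₀1]; ring)
    have h2 := h ψ hψ
    rw [hψd] at h2
    have e1 : ∀ r, f r * (φ r - (∫ r, φ r) * ψ₀ r) =
        f r * φ r - (∫ r, φ r) * (f r * ψ₀ r) := fun r => by ring
    simp only [e1] at h2
    rw [integral_sub (hφ.integrable_mul hf) ((hψ₀.integrable_mul hf).const_mul _),
      integral_const_mul, ← hc] at h2
    have e2 : ∀ r, (f r - c) * φ r = f r * φ r - c * φ r := fun r => by ring
    simp only [e2]
    rw [integral_sub (hφ.integrable_mul hf) ((hint φ hφ).const_mul _), integral_const_mul]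
    linarith

/-- The lemma of du Bois-Reymond for second derivatives. -/
theorem ae_eq_affine_of_integral_deriv_deriv_test (hR : 0 < R) {f : ℝ → ℝ}
    (hf : LocallyIntegrableOn f (Ioo 0 R))
    (h : ∀ φ, IsTest R φ → ∫ r, f r * deriv (deriv φ) r = 0) :
    ∃ α β, ∀ᵐ r, r ∈ Ioo 0 R → f r = α + β * r := by
  obtain ⟨ψ₀, hψ₀, hψ₀1⟩ := exists_isTest_integral_one hR
  have hint : ∀ φ, IsTest R φ → Integrable φ := fun φ hφ =>
    hφ.continuous.integrable_of_hasCompactSupport hφ.2.1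
  have hid : LocallyIntegrableOn (fun r : ℝ => r) (Ioo 0 R) :=
    locallyIntegrableOn_of_continuousOn continuousOn_id
  set k := ∫ r, f r * deriv ψ₀ r with hk
  -- Testing against a mean-corrected primitive gives ∫ f φ' = k ∫ φ. As ∫ r φ' = -∫ φ, the
  -- correction k r reduces matters to the first-order lemma.
  have hf' : LocallyIntegrableOn (fun r => f r + k * r) (Ioo 0 R) :=
    hf.add (locallyIntegrableOn_of_continuousOn (by fun_prop))
  obtain ⟨α, hα⟩ := ae_eq_const_of_integral_deriv_test hR hf' fun φ hφ => by
    have hχ := hφ.sub_const_mul hψ₀ (∫ r, φ r)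
    obtain ⟨ψ, hψ, hψd⟩ := hχ.exists_primitive hR (by
      rw [integral_sub (hint φ hφ) ((hint ψ₀ hψ₀).const_mul _), integral_const_mul, hψ₀1]; ring)
    have h2 := h ψ hψ
    have hd : deriv (deriv ψ) = fun r => deriv φ r - (∫ r, φ r) * deriv ψ₀ r := by
      rw [hψd]
      funext r
      exact ((hφ.hasDerivAt r).sub ((hψ₀.hasDerivAt r).const_mul _)).deriv
    rw [hd] at h2
    have e1 : ∀ r, f r * (deriv φ r - (∫ r, φ r) * deriv ψ₀ r) =
        f r * deriv φ r - (∫ r, φ r) * (f r * deriv ψ₀ r) := fun r => by ring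
    simp only [e1] at h2
    rw [integral_sub (hφ.deriv.integrable_mul hf) ((hψ₀.deriv.integrable_mul hf).const_mul _),
      integral_const_mul, ← hk] at h2
    have hparts : ∫ r, r * deriv φ r = -∫ r, φ r := by
      have := integral_mul_deriv_eq_deriv_mul_of_integrable (u := fun r : ℝ => r) (u' := fun _ => 1)
        (v := φ) (v' := deriv φ) (fun r _ => hasDerivAt_id r) (fun r _ => hφ.hasDerivAt r)
        (hφ.deriv.integrable_mul hid) ((hint φ hφ).congr (Eventually.of_forall fun r => by simp)) (hφ.integrable_mul hid)
      simpa using this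
    have e2 : ∀ r, (f r + k * r) * deriv φ r = f r * deriv φ r + k * (r * deriv φ r) :=
      fun r => by ring
    simp only [e2]
    rw [integral_add (hφ.deriv.integrable_mul hf) ((hφ.deriv.integrable_mul hid).const_mul _),
      integral_const_mul, hparts]
    linarith
  refine ⟨α, -k, ?_⟩
  filter_upwards [hα] with r hr hr'
  linarith [hr hr']

theorem intervalIntegrable_of_locallyIntegrableOn {f : ℝ → ℝ}
    (hf : LocallyIntegrableOn f (Ioo 0 R)) {c d : ℝ} (hc : c ∈ Ioo 0 R) (hd : d ∈ Ioo 0 R) :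
    IntervalIntegrable f volume c d := by
  rw [intervalIntegrable_iff]
  exact (hf.integrableOn_compact_subset (ordConnected_Ioo.uIcc_subset hc hd)
    isCompact_uIcc).mono_set uIoc_subset_uIcc

theorem continuousOn_primitive {f : ℝ → ℝ} (hf : LocallyIntegrableOn f (Ioo 0 R)) {r₀ : ℝ}
    (hr₀ : r₀ ∈ Ioo 0 R) : ContinuousOn (fun r => ∫ s in r₀..r, f s) (Ioo 0 R) := by
  intro r hr
  obtain ⟨c, d, hc, hd, hr₀', hsub⟩ := exists_Ioo_of_isCompact (isCompact_singleton (x := r))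
    (singleton_subset_iff.2 hr) hr₀
  have hcd : c < d := hr₀'.1.trans hr₀'.2
  have hint := intervalIntegrable_of_locallyIntegrableOn hf (c := c) (d := d)
    ⟨hc, hcd.trans hd⟩ ⟨hc.trans hcd, hd⟩
  have h := (hint.absolutelyContinuousOnInterval_intervalIntegral (c := r₀)
    (by rw [uIcc_of_le hcd.le]; exact Ioo_subset_Icc_self hr₀')).continuousOn
  rw [uIcc_of_le hcd.le] at h
  have hr' : r ∈ Ioo c d := hsub rfl
  exact (h.continuousAt (Icc_mem_nhds hr'.1 hr'.2)).continuousWithinAt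

theorem hasDerivAt_primitive {f : ℝ → ℝ} (hf : ContinuousOn f (Ioo 0 R)) {r₀ r : ℝ}
    (hr₀ : r₀ ∈ Ioo 0 R) (hr : r ∈ Ioo 0 R) :
    HasDerivAt (fun r => ∫ s in r₀..r, f s) (f r) r :=
  intervalIntegral.integral_hasDerivAt_right
    (intervalIntegrable_of_locallyIntegrableOn (locallyIntegrableOn_of_continuousOn hf) hr₀ hr)
    (hf.stronglyMeasurableAtFilter isOpen_Ioo r hr) (hf.continuousAt (isOpen_Ioo.mem_nhds hr))

theorem primitive_congr {f g : ℝ → ℝ} (h : ∀ᵐ r, r ∈ Ioo 0 R → f r = g r) {r₀ r : ℝ}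
    (hr₀ : r₀ ∈ Ioo 0 R) (hr : r ∈ Ioo 0 R) : ∫ s in r₀..r, f s = ∫ s in r₀..r, g s := by
  refine intervalIntegral.integral_congr_ae ?_
  filter_upwards [h] with s hs hs'
  exact hs (ordConnected_Ioo.uIcc_subset hr₀ hr (uIoc_subset_uIcc hs'))

/-- Integration by parts against a test function. -/
theorem integral_mul_test_eq {f φ : ℝ → ℝ} (hf : LocallyIntegrableOn f (Ioo 0 R))
    (hφ : IsTest R φ) {r₀ : ℝ} (hr₀ : r₀ ∈ Ioo 0 R) :
    ∫ r, f r * φ r = -∫ r, (∫ s in r₀..r, f s) * deriv φ r := by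
  obtain ⟨c, d, hc, hd, hr₀', hsub⟩ := exists_Ioo_of_isCompact hφ.2.1 hφ.2.2 hr₀
  have hcd : c < d := hr₀'.1.trans hr₀'.2
  have hint := intervalIntegrable_of_locallyIntegrableOn hf (c := c) (d := d)
    ⟨hc, hcd.trans hd⟩ ⟨hc.trans hcd, hd⟩
  have hr₀u : r₀ ∈ uIcc c d := by rw [uIcc_of_le hcd.le]; exact Ioo_subset_Icc_self hr₀'
  have hF := hint.absolutelyContinuousOnInterval_intervalIntegral hr₀u
  have hφ' : AbsolutelyContinuousOnInterval φ c d :=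
    (hφ.1.of_le (by norm_cast)).contDiffOn.absolutelyContinuousOnInterval
  have h := hF.integral_mul_deriv_eq_deriv_mul hφ'
  have hφc : φ c = 0 := image_eq_zero_of_notMem_tsupport fun h => (hsub h).1.false
  have hφd : φ d = 0 := image_eq_zero_of_notMem_tsupport fun h => (hsub h).2.false
  rw [hφc, hφd, mul_zero, mul_zero, sub_zero, zero_sub] at h
  rw [hφ.integral_mul_eq f hcd.le hsub, hφ.deriv.integral_mul_eq _ hcd.le
    (tsupport_deriv_subset.trans hsub), h, neg_neg]
  refine intervalIntegral.integral_congr_ae ?_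
  filter_upwards [hint.ae_hasDerivAt_integral] with x hx hx'
  rw [(hx (uIoc_subset_uIcc hx') r₀ hr₀u).deriv]

/-- Interior regularity of distributional solutions of `(p u')' = w u`. -/
theorem exists_classical_solution (hR : 0 < R) {p w u : ℝ → ℝ} (hp : ContDiffOn ℝ 2 p (Ioo 0 R))
    (hpos : ∀ r ∈ Ioo 0 R, 0 < p r) (hw : ContinuousOn w (Ioo 0 R))
    (hu : LocallyIntegrableOn u (Ioo 0 R))
    (h : ∀ φ, IsTest R φ →
      ∫ r, u r * (p r * deriv (deriv φ) r + deriv p r * deriv φ r - w r * φ r) = 0) :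
    ∃ y : ℝ → ℝ, (∀ᵐ r, r ∈ Ioo 0 R → u r = y r) ∧ ContDiffOn ℝ 2 y (Ioo 0 R) ∧
      ∀ r ∈ Ioo 0 R, HasDerivAt (fun r => p r * deriv y r) (w r * y r) r := by
  have hp1 : ContDiffOn ℝ 1 (deriv p) (Ioo 0 R) :=
    hp.deriv_of_isOpen isOpen_Ioo (by norm_num)
  have hpd : ∀ r ∈ Ioo 0 R, HasDerivAt p (deriv p r) r := fun r hr =>
    ((hp.contDiffAt (isOpen_Ioo.mem_nhds hr)).differentiableAt (by norm_num)).hasDerivAt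
  have hmulc : ∀ {g : ℝ → ℝ}, ContinuousOn g (Ioo 0 R) →
      LocallyIntegrableOn (fun r => u r * g r) (Ioo 0 R) := fun hg =>
    hu.mul_continuousOn hg isOpen_Ioo.isLocallyClosed
  have hr₀ : R / 2 ∈ Ioo 0 R := ⟨half_pos hR, half_lt_self hR⟩
  set r₀ := R / 2
  have hup := hmulc hp.continuousOn
  have hup' := hmulc hp1.continuousOn
  have huw := hmulc hw
  -- B is a primitive of u w and D of u p' + B. Integrating by parts with them moves all derivatives
  -- onto φ'', leaving ∫ (u p - D) φ'' = 0, so u p - D is affine.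
  let B : ℝ → ℝ := fun r => ∫ s in r₀..r, u s * w s
  have hB : ContinuousOn B (Ioo 0 R) := continuousOn_primitive huw hr₀
  have hE : LocallyIntegrableOn (fun r => u r * deriv p r + B r) (Ioo 0 R) :=
    hup'.add (locallyIntegrableOn_of_continuousOn hB)
  let D : ℝ → ℝ := fun r => ∫ s in r₀..r, (u s * deriv p s + B s)
  have hD : ContinuousOn D (Ioo 0 R) := continuousOn_primitive hE hr₀
  have hDl := locallyIntegrableOn_of_continuousOn hD
  obtain ⟨α, β, hαβ⟩ := ae_eq_affine_of_integral_deriv_deriv_test hR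
    (f := fun r => u r * p r - D r) (hup.sub hDl) fun φ hφ => by
      have h1 := h φ hφ
      have i1 := hφ.deriv.deriv.integrable_mul hup
      have i2 := hφ.deriv.integrable_mul hup'
      have i3 := hφ.integrable_mul huw
      have i4 := hφ.deriv.integrable_mul (locallyIntegrableOn_of_continuousOn hB)
      have e1 : ∀ r, u r * (p r * deriv (deriv φ) r + deriv p r * deriv φ r - w r * φ r) =
          u r * p r * deriv (deriv φ) r + u r * deriv p r * deriv φ r - u r * w r * φ r :=
        fun r => by ring
      simp only [e1] at h1
      rw [integral_sub (f := fun r => u r * p r * deriv (deriv φ) r + u r * deriv p r * deriv φ r)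
        (i1.add i2) i3, integral_add i1 i2, integral_mul_test_eq huw hφ hr₀] at h1
      have h2 := integral_mul_test_eq hE hφ.deriv hr₀
      have e2 : ∀ r, (u r * deriv p r + B r) * deriv φ r =
          u r * deriv p r * deriv φ r + B r * deriv φ r := fun r => by ring
      simp only [e2] at h2
      rw [integral_add i2 i4] at h2
      have e3 : ∀ r, (u r * p r - D r) * deriv (deriv φ) r =
          u r * p r * deriv (deriv φ) r - D r * deriv (deriv φ) r := fun r => by ring
      simp only [e3]
      rw [integral_sub i1 (hφ.deriv.deriv.integrable_mul hDl)]
      simp only [B, D] at h1 h2 ⊢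
      linarith
  -- The continuous representative of u. Bootstrap: continuity of y makes B and D differentiable, so
  -- p y' = B + β, whose derivative is w y; hence y is C².
  let y : ℝ → ℝ := fun r => (D r + (α + β * r)) / p r
  have huy : ∀ᵐ r, r ∈ Ioo 0 R → u r = y r := by
    filter_upwards [hαβ] with r hr hr'
    have := (hpos r hr').ne'
    simp only [y]
    rw [eq_div_iff this]
    linarith [hr hr']
  have hyc : ContinuousOn y (Ioo 0 R) :=
    (hD.add (by fun_prop)).div hp.continuousOn fun r hr => (hpos r hr).ne'
  have hB' : ∀ r ∈ Ioo 0 R, HasDerivAt B (y r * w r) r := by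
    intro r hr
    refine (hasDerivAt_primitive (hyc.mul hw) hr₀ hr).congr_of_eventuallyEq ?_
    filter_upwards [isOpen_Ioo.mem_nhds hr] with x hx
    refine primitive_congr ?_ hr₀ hx
    filter_upwards [huy] with s hs hs'
    rw [hs hs']; rfl
  have hD' : ∀ r ∈ Ioo 0 R, HasDerivAt D (y r * deriv p r + B r) r := by
    intro r hr
    refine (hasDerivAt_primitive ((hyc.mul hp1.continuousOn).add hB) hr₀ hr).congr_of_eventuallyEq
      ?_
    filter_upwards [isOpen_Ioo.mem_nhds hr] with x hx
    refine primitive_congr ?_ hr₀ hx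
    filter_upwards [huy] with s hs hs'
    rw [hs hs']; rfl
  have hy' : ∀ r ∈ Ioo 0 R, HasDerivAt y ((B r + β) / p r) r := by
    intro r hr
    have hne := (hpos r hr).ne'
    have h1 := ((hD' r hr).add (((hasDerivAt_id r).const_mul β).const_add α)).div (hpd r hr) hne
    refine h1.congr_deriv ?_
    have : D r + (α + β * r) = y r * p r := (div_mul_cancel₀ _ hne).symm
    simp only [Pi.add_apply, id_eq, this]
    field_simp
    ring
  have hdy : EqOn (deriv y) (fun r => (B r + β) / p r) (Ioo 0 R) := fun r hr => (hy' r hr).deriv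
  have hBC : ContDiffOn ℝ 1 B (Ioo 0 R) := by
    refine (contDiffOn_succ_iff_deriv_of_isOpen (n := 0) isOpen_Ioo).2 ⟨fun r hr =>
      (hB' r hr).differentiableAt.differentiableWithinAt, by simp, ?_⟩
    exact contDiffOn_zero.2 ((hyc.mul hw).congr fun r hr => (hB' r hr).deriv)
  refine ⟨y, huy, ?_, fun r hr => ?_⟩
  · refine (contDiffOn_succ_iff_deriv_of_isOpen (n := 1) isOpen_Ioo).2 ⟨fun r hr =>
      (hy' r hr).differentiableAt.differentiableWithinAt, by simp, ?_⟩
    refine ContDiffOn.congr ?_ hdy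
    exact (hBC.add contDiffOn_const).div (hp.of_le (by norm_num)) fun r hr => (hpos r hr).ne'
  · refine (((hB' r hr).add_const β).congr_of_eventuallyEq ?_).congr_deriv (mul_comm _ _)
    filter_upwards [isOpen_Ioo.mem_nhds hr] with x hx
    rw [hdy hx, mul_div_cancel₀ _ (hpos x hx).ne']

end

/-! ### Elements of the Friedrichs graph -/

section

namespace IsEquilibrium

variable {A γ g₀ R ρc : ℝ} {ρ : ℝ → ℝ}

theorem weight_density_pos (hρ : IsEquilibrium A γ g₀ R ρc ρ) {r : ℝ} (hr : r ∈ Ioo 0 R) :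
    0 < r ^ 4 * ρ r :=
  mul_pos (pow_pos hr.1 4) (hρ.pos r hr)

theorem continuousOn_weight_density (hρ : IsEquilibrium A γ g₀ R ρc ρ) :
    ContinuousOn (fun r => r ^ 4 * ρ r) (Ioo 0 R) :=
  ContinuousOn.mul (by fun_prop) hρ.contDiffOn.continuousOn

theorem aemeasurable_weight_density (hρ : IsEquilibrium A γ g₀ R ρc ρ) :
    AEMeasurable (fun r => ENNReal.ofReal (r ^ 4 * ρ r)) (volume.restrict (Ioo 0 R)) :=
  (hρ.continuousOn_weight_density.aemeasurable measurableSet_Ioo).ennreal_ofReal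

theorem integral_weight (hρ : IsEquilibrium A γ g₀ R ρc ρ) (f : ℝ → ℝ) :
    ∫ r, f r ∂(weight R ρ) = ∫ r in Ioo 0 R, r ^ 4 * ρ r * f r := by
  rw [weight, integral_withDensity_eq_integral_toReal_smul₀ hρ.aemeasurable_weight_density
    (by simp)]
  refine setIntegral_congr_fun measurableSet_Ioo fun r hr => ?_
  simp only [ENNReal.toReal_ofReal (hρ.weight_density_pos hr).le, smul_eq_mul]

theorem weight_absolutelyContinuous : weight R ρ ≪ volume.restrict (Ioo 0 R) :=
  withDensity_absolutelyContinuous _ _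

theorem absolutelyContinuous_weight (hρ : IsEquilibrium A γ g₀ R ρc ρ) :
    volume.restrict (Ioo 0 R) ≪ weight R ρ := by
  refine withDensity_absolutelyContinuous' hρ.aemeasurable_weight_density ?_
  refine (ae_restrict_iff' measurableSet_Ioo).2 (Eventually.of_forall fun r hr => ?_)
  exact (ENNReal.ofReal_pos.2 (hρ.weight_density_pos hr)).ne'

theorem weight_restrict : (weight R ρ).restrict (Ioo 0 R) = weight R ρ := by
  rw [weight, restrict_withDensity measurableSet_Ioo, Measure.restrict_restrict measurableSet_Ioo,
    inter_self]

/-- On compacts of (0, R) the weight is bounded below, and |u| ≤ 1 + u². -/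
theorem locallyIntegrableOn_of_memLp (hρ : IsEquilibrium A γ g₀ R ρc ρ) {u : ℝ → ℝ}
    (hu : MemLp u 2 (weight R ρ)) : LocallyIntegrableOn u (Ioo 0 R) := by
  have h1 := hρ.integrableOn_of_memLp le_rfl (y := u) (by rwa [weight_restrict])
  have hm : AEStronglyMeasurable u (volume.restrict (Ioo 0 R)) :=
    hu.1.mono_ac hρ.absolutelyContinuous_weight
  refine (locallyIntegrableOn_iff isOpen_Ioo.isLocallyClosed).2 fun K hKs hK => ?_
  have h2 := (h1.mono_set hKs).mul_continuousOn (g' := fun r => (r ^ 4 * ρ r)⁻¹)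
    ((hρ.continuousOn_weight_density.inv₀ fun r hr => (hρ.weight_density_pos hr).ne').mono hKs) hK
  have h3 : IntegrableOn (fun _ : ℝ => (1 : ℝ)) K :=
    continuousOn_const.integrableOn_compact hK
  refine Integrable.mono' (h3.add h2) (hm.mono_set hKs) ?_
  refine (ae_restrict_iff' hK.measurableSet).2 (Eventually.of_forall fun r hr => ?_)
  have hne := (hρ.weight_density_pos (hKs hr)).ne'
  have e : r ^ 4 * ρ r * u r ^ 2 * (r ^ 4 * ρ r)⁻¹ = u r ^ 2 := by
    rw [mul_right_comm, mul_inv_cancel₀ hne, one_mul]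
  simp only [Pi.add_apply, e, Real.norm_eq_abs]
  nlinarith [sq_abs (u r), sq_nonneg (|u r| - 1), sq_nonneg (u r)]

/-- Functions in the domain of the Friedrichs extension satisfying `𝓛 u = lam u` are classical
solutions. -/
theorem exists_solution_ae_eq (hρ : IsEquilibrium A γ g₀ R ρc ρ) (hA : 0 < A) (hγ : 1 < γ)
    {lam : ℝ} {u : ℝ → ℝ} (hu : FriedrichsGraph A γ R ρ u fun r => lam * u r) :
    ∃ y : ℝ → ℝ, u =ᵐ[weight R ρ] y ∧ IsSolution A γ R ρ lam 0 y := by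
  obtain ⟨hu2, -, -, hweak⟩ := hu
  have hloc := hρ.locallyIntegrableOn_of_memLp hu2
  have hp : ContDiffOn ℝ 2 (fun r => γ * r ^ 4 * pressure A γ ρ r) (Ioo 0 R) :=
    ContDiffOn.mul (ContDiff.contDiffOn (by fun_prop)) hρ.contDiffOn_pressure
  have hp1 : ContinuousOn (deriv fun r => γ * r ^ 4 * pressure A γ ρ r) (Ioo 0 R) :=
    hp.continuousOn_deriv_of_isOpen isOpen_Ioo (by norm_num)
  have hw : ContinuousOn (fun r => r ^ 4 * potential γ g₀ R lam ρ r) (Ioo 0 R) :=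
    ContinuousOn.mul (by fun_prop) (hρ.continuousOn_potential.mono Ioo_subset_Icc_self)
  obtain ⟨y, huy, hyC, hy⟩ := exists_classical_solution hρ.radius_pos hp
    (fun r hr => hρ.flux_coeff_pos hA hγ hr) hw hloc fun φ hφ => by
      have h := hweak φ hφ
      rw [hρ.integral_weight, hρ.integral_weight, ← sub_eq_zero] at h
      have hmul : ∀ {g : ℝ → ℝ}, ContinuousOn g (Ioo 0 R) →
          LocallyIntegrableOn (fun r => u r * g r) (Ioo 0 R) := fun hg =>
        hloc.mul_continuousOn hg isOpen_Ioo.isLocallyClosed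
      have hdiff : ∀ r ∈ Ioo 0 R,
          deriv (fun s => γ * s ^ 4 * pressure A γ ρ s * deriv φ s) r =
          deriv (fun r => γ * r ^ 4 * pressure A γ ρ r) r * deriv φ r +
          γ * r ^ 4 * pressure A γ ρ r * deriv (deriv φ) r := fun r hr =>
        (((hp.contDiffAt (isOpen_Ioo.mem_nhds hr)).differentiableAt
          (by norm_num)).hasDerivAt.mul (hφ.deriv.hasDerivAt r)).deriv
      have i1 : Integrable (fun r => u r * (γ * r ^ 4 * pressure A γ ρ r) * deriv (deriv φ) r) :=
        hφ.deriv.deriv.integrable_mul (hmul hp.continuousOn)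
      have i2 := hφ.deriv.integrable_mul (hmul hp1)
      have i3 := hφ.integrable_mul (hmul (g := fun r => lam * (r ^ 4 * ρ r))
        (continuousOn_const.mul hρ.continuousOn_weight_density))
      have i4 := hφ.integrable_mul (hmul hw)
      have hA' : ∀ r ∈ Ioo 0 R, r ^ 4 * ρ r * (u r * opL A γ ρ φ r) =
          -(u r * (γ * r ^ 4 * pressure A γ ρ r) * deriv (deriv φ) r) -
          (u r * deriv (fun r => γ * r ^ 4 * pressure A γ ρ r) r * deriv φ r) +
          u r * (r ^ 4 * potential γ g₀ R lam ρ r) * φ r + u r * (lam * (r ^ 4 * ρ r)) * φ r := by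
        intro r hr
        rw [opL, hdiff r hr, hρ.deriv_pressure hγ hr, potential, hρ.dens_eq hr]
        have h1 := hr.1.ne'
        have h2 := (hρ.pos r hr).ne'
        field_simp
        ring
      have hL : IntegrableOn (fun r => r ^ 4 * ρ r * (u r * opL A γ ρ φ r)) (Ioo 0 R) :=
        IntegrableOn.congr_fun (((i1.neg.sub i2).add i4).add i3).integrableOn
          (fun r hr => (hA' r hr).symm) measurableSet_Ioo
      have hr' : IntegrableOn (fun r => r ^ 4 * ρ r * (lam * u r * φ r)) (Ioo 0 R) :=
        IntegrableOn.congr_fun i3.integrableOn (fun r _ => by ring) measurableSet_Ioo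
      rw [← integral_sub hL hr'] at h
      have hzero : ∀ r, r ∉ Ioo 0 R → u r * (γ * r ^ 4 * pressure A γ ρ r * deriv (deriv φ) r +
          deriv (fun r => γ * r ^ 4 * pressure A γ ρ r) r * deriv φ r -
          r ^ 4 * potential γ g₀ R lam ρ r * φ r) = 0 := fun r hr => by
        simp [hφ.eq_zero hr, hφ.deriv.eq_zero hr, hφ.deriv.deriv.eq_zero hr]
      rw [← setIntegral_eq_integral_of_forall_compl_eq_zero hzero, ← neg_eq_zero,
        ← integral_neg]
      refine Eq.trans (setIntegral_congr_fun measurableSet_Ioo fun r hr => ?_) h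
      simp only [hA' r hr]
      ring
  refine ⟨y, ?_, hyC, fun r hr => ?_⟩
  · exact (weight_absolutelyContinuous (ρ := ρ)).ae_le
      ((ae_restrict_iff' (μ := volume) (measurableSet_Ioo (a := (0 : ℝ)) (b := R))).2 huy)
  · have h1 := hr.1.ne'
    have h2 := (hρ.pos r hr).ne'
    rw [opL, (hy r hr).deriv, hρ.deriv_pressure hγ hr, potential, hρ.dens_eq hr]
    field_simp
    ring

end IsEquilibrium

end

/-! ### The Liouville variable -/

section

/-- `sin² t = t² S(t²)` with `S` analytic. -/
theorem exists_analytic_sin_sq :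
    ∃ S : ℝ → ℝ, AnalyticAt ℝ S 0 ∧ 0 < S 0 ∧
      ∀ᶠ t in 𝓝 (0 : ℝ), Real.sin t ^ 2 = t ^ 2 * S (t ^ 2) := by
  -- The coefficients of cos t as a power series in t².
  let a : ℕ → ℝ := fun n => (-1) ^ n / (2 * n).factorial
  let s := FormalMultilinearSeries.ofScalars ℝ (𝕜 := ℝ) a
  have hrad : (1 : ENNReal) ≤ s.radius := by
    refine s.le_radius_of_bound (r := 1) 1 fun n => ?_
    have h1 : (1 : ℝ) ≤ (2 * n).factorial := by exact_mod_cast (2 * n).factorial_pos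
    simp only [s, FormalMultilinearSeries.ofScalars_norm, a, NNReal.coe_one, one_pow, mul_one,
      norm_div, norm_pow, norm_neg, norm_one, RCLike.norm_natCast]
    exact div_le_one_of_le₀ h1 (by positivity)
  have hs := s.hasFPowerSeriesOnBall (one_pos.trans_le hrad)
  have hcos : ∀ t : ℝ, |t| < 1 → s.sum (t ^ 2) = Real.cos t := by
    intro t ht
    have hmem : t ^ 2 ∈ Metric.eball (0 : ℝ) s.radius := by
      refine Metric.eball_subset_eball hrad ?_
      have : ‖t ^ 2‖ < 1 := by
        rw [norm_pow, Real.norm_eq_abs]; exact pow_lt_one₀ (abs_nonneg _) ht two_ne_zero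
      rw [Metric.mem_eball, edist_eq_enorm_sub, sub_zero, ← ofReal_norm]
      simpa using (ENNReal.ofReal_lt_ofReal_iff one_pos).2 this
    have h1 := hs.hasSum hmem
    refine HasSum.unique ?_ (Real.hasSum_cos t)
    rw [zero_add] at h1
    convert! h1 using 2 with n
    simp [s, a, pow_mul]
    ring
  -- Half-angle formula: C(t²) = (1 - cos 2t)/2 = sin² t, with 4 t² = (2t)². Since C 0 = 0 and C'(0)
  -- = 1, its difference quotient at 0 is the required S.
  let C : ℝ → ℝ := fun x => (1 - s.sum (4 * x)) / 2
  have hsA : AnalyticAt ℝ s.sum (4 * 0) := by simpa using hs.analyticAt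
  have hC : AnalyticAt ℝ C 0 :=
    (analyticAt_const.sub (hsA.fun_comp (analyticAt_const.mul analyticAt_id))).div
      analyticAt_const two_ne_zero
  have hsum0 : s.sum 0 = 1 := by simpa using hcos 0 (by simp)
  have hC0 : C 0 = 0 := by simp [C, hsum0]
  have hderiv : HasDerivAt C 1 0 := by
    have h1 : HasDerivAt s.sum (-1 / 2) (4 * 0) := by
      have := hs.hasFPowerSeriesAt.hasDerivAt
      simp only [s, FormalMultilinearSeries.ofScalars_apply_eq, a] at this
      norm_num [Nat.factorial] at this ⊢
      exact this
    have h2 := ((h1.comp (0 : ℝ) ((hasDerivAt_id (0 : ℝ)).const_mul 4)).const_sub 1).div_const 2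
    refine h2.congr_deriv (by norm_num)
  obtain ⟨q, hq⟩ := hC
  refine ⟨dslope C 0, ⟨_, hq.has_fpower_series_dslope_fslope⟩, ?_, ?_⟩
  · rw [dslope_same, hderiv.deriv]; exact one_pos
  · filter_upwards [Metric.ball_mem_nhds (0 : ℝ) (half_pos one_pos)] with t ht
    have ht' : |2 * t| < 1 := by
      rw [Metric.mem_ball, Real.dist_0_eq_abs] at ht
      rw [abs_mul, abs_two]; linarith
    have h1 := sub_smul_dslope C 0 (t ^ 2)
    simp only [sub_zero, smul_eq_mul, hC0] at h1
    have h2 := hcos (2 * t) ht'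
    rw [mul_pow] at h2
    norm_num at h2
    rw [h1]
    simp only [C, h2, Real.cos_two_mul, Real.sin_sq]
    ring

theorem tan_sq_eq_sin_sq {t : ℝ} (h : t ∈ Ioo (-(Real.pi / 2)) (Real.pi / 2)) :
    Real.tan t ^ 2 / (1 + Real.tan t ^ 2) = Real.sin t ^ 2 :=
  Real.tan_sq_div_one_add_tan_sq (Real.cos_pos_of_mem_Ioo h).ne'

/-- `((γ - 1) h)^(-1/2)`, the integrand of the Liouville variable. -/
def slowness (A γ R : ℝ) (ρ : ℝ → ℝ) (r : ℝ) : ℝ := ((γ - 1) * enth A γ R ρ r) ^ (-(1 / 2) : ℝ)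

/-- The integrand of the Liouville variable at depth `z`, times `√z`. -/
def surfSlowness (γ g₀ R : ℝ) (ρ : ℝ → ℝ) (z : ℝ) : ℝ :=
  ((γ - 1) * surfEnth g₀ R ρ z) ^ (-(1 / 2) : ℝ)

namespace IsEquilibrium

variable {A γ g₀ R ρc : ℝ} {ρ : ℝ → ℝ}

theorem sqrt_eq_slowness (hρ : IsEquilibrium A γ g₀ R ρc ρ) (hA : 0 < A) (hγ : 1 < γ) {r : ℝ}
    (hr : r ∈ Ioo 0 R) : √(ρ r / (γ * pressure A γ ρ r)) = slowness A γ R ρ r := by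
  have h1 := hρ.pos r hr
  have h2 := hρ.enth_pos hA hγ (Ioo_subset_Ico_self hr)
  have h3 : 0 < γ - 1 := by linarith
  rw [hρ.pressure_eq hγ hr, slowness, Real.rpow_neg (by positivity), ← Real.sqrt_eq_rpow,
    ← Real.sqrt_inv]
  congr 1
  field_simp

theorem slowness_surface (hρ : IsEquilibrium A γ g₀ R ρc ρ) (hA : 0 < A) (hγ : 1 < γ)
    (hg₀ : 0 < g₀) {z : ℝ} (hz : z ∈ Ioo 0 R) :
    slowness A γ R ρ (R - z) = z ^ (-(1 / 2) : ℝ) * surfSlowness γ g₀ R ρ z := by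
  have h1 := hρ.surfEnth_pos hA hγ hg₀ (Ioo_subset_Ico_self hz)
  have h3 : 0 < γ - 1 := by linarith
  rw [slowness, surfSlowness, hρ.enth_surface hγ hz, ← Real.mul_rpow hz.1.le (by positivity)]
  congr 1; ring

theorem continuousOn_slowness (hρ : IsEquilibrium A γ g₀ R ρc ρ) (hA : 0 < A) (hγ : 1 < γ) :
    ContinuousOn (slowness A γ R ρ) (Ico 0 R) :=
  (continuousOn_const.mul ((hρ.continuousOn_enth hγ).mono Ico_subset_Icc_self)).rpow_const
    fun _ hr => Or.inl (mul_pos (by linarith) (hρ.enth_pos hA hγ hr)).ne'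

theorem continuousOn_surfSlowness (hρ : IsEquilibrium A γ g₀ R ρc ρ) (hA : 0 < A) (hγ : 1 < γ)
    (hg₀ : 0 < g₀) : ContinuousOn (surfSlowness γ g₀ R ρ) (Ico 0 R) :=
  (continuousOn_const.mul (hρ.continuousOn_surfEnth.mono Ico_subset_Icc_self)).rpow_const
    fun _ hr => Or.inl (mul_pos (by linarith) (hρ.surfEnth_pos hA hγ hg₀ hr)).ne'

theorem xi_center (hρ : IsEquilibrium A γ g₀ R ρc ρ) (hA : 0 < A) (hγ : 1 < γ) {r : ℝ}
    (hr : r ∈ Ioo 0 R) : xi A γ ρ r = r * avg 0 (slowness A γ R ρ) r := by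
  have h := rpow_mul_avg (a := 0) (slowness A γ R ρ) hr.1
  simp only [zero_add, Real.rpow_one, Real.rpow_zero, one_mul] at h
  rw [h, xi]
  refine intervalIntegral.integral_congr_ae (Eventually.of_forall fun s hs => ?_)
  rw [uIoc_of_le hr.1.le] at hs
  exact hρ.sqrt_eq_slowness hA hγ ⟨hs.1, hs.2.trans_lt hr.2⟩

/-- The integrand is continuous up to the centre, and at the surface it is z^(-1/2) times a
continuous function; the two halves are joined at R/2. -/
theorem intervalIntegrable_xi (hρ : IsEquilibrium A γ g₀ R ρc ρ) (hA : 0 < A) (hγ : 1 < γ)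
    (hg₀ : 0 < g₀) :
    IntervalIntegrable (fun s => √(ρ s / (γ * pressure A γ ρ s))) volume 0 R := by
  have hR := hρ.radius_pos
  have hhalf := half_pos hR
  have hlt := half_lt_self hR
  have hsub : Icc 0 (R / 2) ⊆ Ico 0 R := fun x hx => ⟨hx.1, hx.2.trans_lt hlt⟩
  have h1 : IntervalIntegrable (slowness A γ R ρ) volume 0 (R / 2) :=
    ((hρ.continuousOn_slowness hA hγ).mono hsub).intervalIntegrable_of_Icc hhalf.le
  have h2 := intervalIntegrable_rpow_mul (a := -(1 / 2)) (by norm_num) hhalf.le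
    ((hρ.continuousOn_surfSlowness hA hγ hg₀).mono hsub)
  have h3 := (h2.comp_sub_left R).symm
  rw [sub_half, sub_zero] at h3
  refine (h1.trans (h3.congr_ae ?_)).congr_ae ?_
  · refine (ae_restrict_iff' measurableSet_uIoc).2 ?_
    filter_upwards [compl_mem_ae_iff.2 (measure_singleton R)] with s hsR hs
    rw [uIoc_of_le hlt.le] at hs
    have hs' : R - s ∈ Ioo 0 R :=
      ⟨sub_pos.2 (lt_of_le_of_ne hs.2 hsR), sub_lt_self _ (hhalf.trans hs.1)⟩
    rw [← hρ.slowness_surface hA hγ hg₀ hs', sub_sub_cancel]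
  · refine (ae_restrict_iff' measurableSet_uIoc).2 ?_
    filter_upwards [compl_mem_ae_iff.2 (measure_singleton R)] with s hsR hs
    rw [uIoc_of_le hR.le] at hs
    exact (hρ.sqrt_eq_slowness hA hγ ⟨hs.1, lt_of_le_of_ne hs.2 hsR⟩).symm

theorem xi_surface (hρ : IsEquilibrium A γ g₀ R ρc ρ) (hA : 0 < A) (hγ : 1 < γ)
    (hg₀ : 0 < g₀) {z : ℝ} (hz : z ∈ Ioo 0 R) :
    xi A γ ρ R - xi A γ ρ (R - z) =
      z ^ (1 / 2 : ℝ) * avg (-(1 / 2)) (surfSlowness γ g₀ R ρ) z := by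
  have hi := hρ.intervalIntegrable_xi hA hγ hg₀
  have hR := hρ.radius_pos
  have hz' := sub_mem_Ioo hz
  have h := rpow_mul_avg (a := -(1 / 2)) (surfSlowness γ g₀ R ρ) hz.1
  rw [show (-(1 / 2) : ℝ) + 1 = 1 / 2 by norm_num] at h
  have hi2 : IntervalIntegrable (fun s => √(ρ s / (γ * pressure A γ ρ s))) volume 0 (R - z) :=
    hi.mono_set (by
      rw [uIcc_of_le hR.le, uIcc_of_le hz'.1.le]; exact Icc_subset_Icc_right hz'.2.le)
  rw [h, xi, xi, intervalIntegral.integral_interval_sub_left hi hi2]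
  have h1 := intervalIntegral.integral_comp_sub_left (a := 0) (b := z)
    (fun s => √(ρ s / (γ * pressure A γ ρ s))) R
  rw [sub_zero] at h1
  rw [← h1]
  refine intervalIntegral.integral_congr_ae (Eventually.of_forall fun s hs => ?_)
  rw [uIoc_of_le hz.1.le] at hs
  have hs' : s ∈ Ioo 0 R := ⟨hs.1, hs.2.trans_lt hz.2⟩
  rw [hρ.sqrt_eq_slowness hA hγ (sub_mem_Ioo hs'), hρ.slowness_surface hA hγ hg₀ hs']

theorem xi_radius_pos (hρ : IsEquilibrium A γ g₀ R ρc ρ) (hA : 0 < A) (hγ : 1 < γ)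
    (hg₀ : 0 < g₀) : 0 < xi A γ ρ R :=
  intervalIntegral.intervalIntegral_pos_of_pos_on (hρ.intervalIntegrable_xi hA hγ hg₀)
    (fun r hr => by
      have := hρ.pressure_pos hA hr
      have := hρ.pos r hr
      positivity) hρ.radius_pos

/-- Near the centre `x = r² G(r²)` with `G` analytic and positive. -/
theorem exists_xvar_center (hρ : IsEquilibrium A γ g₀ R ρc ρ) (hA : 0 < A) (hγ : 1 < γ)
    (hg₀ : 0 < g₀) : ∃ G : ℝ → ℝ, AnalyticAt ℝ G 0 ∧ 0 < G 0 ∧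
      ∀ᶠ r in 𝓝[>] (0 : ℝ), xvar A γ R ρ r = r ^ 2 * G (r ^ 2) := by
  have hR := hρ.radius_pos
  have hξ := hρ.xi_radius_pos hA hγ hg₀
  have h0 : (0 : ℝ) ∈ Ico 0 R := ⟨le_rfl, hR⟩
  obtain ⟨S, hS, hS0, hSs⟩ := exists_analytic_sin_sq
  let M : ℝ → ℝ := fun r => Real.pi / xi A γ ρ R / 2 * avg 0 (slowness A γ R ρ) r
  have hsl : IsAn centerPar (slowness A γ R ρ) := (hρ.isAn_enth_center hA hγ).comp
    tendsto_centerPar (φ := fun x => ((γ - 1) * x) ^ (-(1 / 2) : ℝ))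
    (analyticAt_const_mul_rpow (a := -(1 / 2)) (sub_pos.2 hγ)
      (hρ.enth_pos hA hγ h0))
  have hM : IsAn centerPar M := (IsAn.const _).mul (hsl.avg (by norm_num))
  have hM0 : 0 < M 0 := by
    have h1 : 0 < γ - 1 := by linarith
    have h2 := hρ.enth_pos hA hγ h0
    have : 0 < avg 0 (slowness A γ R ρ) 0 := by
      rw [avg_zero (by norm_num), slowness]; positivity
    simp only [M]; positivity
  have hM2 : IsAn centerPar (fun r => M r ^ 2) :=
    hM.comp tendsto_centerPar (φ := fun x => x ^ 2) (analyticAt_id.pow 2)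
  obtain ⟨F, hF, hF0, hFM⟩ := hM2.exists_expansion
  have hang : ∀ᶠ r in 𝓝[>] (0 : ℝ), angle A γ R ρ r = r * M r := by
    filter_upwards [Ioo_mem_nhdsGT hR] with r hr
    rw [angle, hρ.xi_center hA hγ hr]; simp only [M]; ring
  have hlim : Tendsto (fun r => r * M r) (𝓝[>] 0) (𝓝 0) := by
    simpa using (tendsto_id.mono_left nhdsWithin_le_nhds).mul hM.tendsto
  -- Here θ = r M and M² = F(r²), so x = sin²θ = θ² S(θ²) with θ² = r² F(r²).
  refine ⟨fun p => F p * S (p * F p), ?_, ?_, ?_⟩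
  · refine hF.mul (AnalyticAt.fun_comp (g := S) ?_ (analyticAt_id.mul hF))
    simpa using hS
  · simp only [hF0, zero_mul]; positivity
  · have hpi := half_pos Real.pi_pos
    filter_upwards [hang, hlim.eventually hSs, hFM,
      hlim.eventually (Ioo_mem_nhds (neg_lt_zero.2 hpi) hpi)] with r h1 h2 h3 h4
    rw [xvar, h1, tan_sq_eq_sin_sq h4, h2, mul_pow, h3]
    simp only [centerPar]
    ring

/-- Near the surface `1 - x = z G(z, zᵇ)`, `b = γ/(γ-1)`, with `G` analytic and positive. -/
theorem exists_xvar_surface (hρ : IsEquilibrium A γ g₀ R ρc ρ) (hA : 0 < A) (hγ : 1 < γ)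
    (hg₀ : 0 < g₀) : ∃ G : ℝ × ℝ → ℝ, AnalyticAt ℝ G 0 ∧ 0 < G 0 ∧
      ∀ᶠ z in 𝓝[>] (0 : ℝ),
        1 - xvar A γ R ρ (R - z) = z * G (surfacePar (1 / (γ - 1) + 1) z) := by
  have hR := hρ.radius_pos
  have hξ := hρ.xi_radius_pos hA hγ hg₀
  have h0 : (0 : ℝ) ∈ Ico 0 R := ⟨le_rfl, hR⟩
  have hν0 : 0 < 1 / (γ - 1) := one_div_pos.2 (sub_pos.2 hγ)
  have hp := tendsto_surfacePar (b := 1 / (γ - 1) + 1) (by linarith)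
  obtain ⟨S, hS, hS0, hSs⟩ := exists_analytic_sin_sq
  let M : ℝ → ℝ := fun z =>
    Real.pi / xi A γ ρ R / 2 * avg (-(1 / 2)) (surfSlowness γ g₀ R ρ) z
  have hsl : IsAn (surfacePar (1 / (γ - 1) + 1)) (surfSlowness γ g₀ R ρ) :=
    (hρ.isAn_surfEnth hA hγ hg₀).comp hp
      (φ := fun x => ((γ - 1) * x) ^ (-(1 / 2) : ℝ)) (analyticAt_const_mul_rpow (a := -(1 / 2)) (sub_pos.2 hγ)
        (hρ.surfEnth_pos hA hγ hg₀ h0))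
  have hM : IsAn (surfacePar (1 / (γ - 1) + 1)) M := (IsAn.const _).mul (hsl.avg (by norm_num))
  have hM0 : 0 < M 0 := by
    have h1 : 0 < γ - 1 := by linarith
    have h2 := hρ.surfEnth_pos hA hγ hg₀ h0
    have : 0 < avg (-(1 / 2)) (surfSlowness γ g₀ R ρ) 0 := by
      rw [avg_zero (by norm_num), surfSlowness]
      exact div_pos (by positivity) (by norm_num)
    simp only [M]; positivity
  have hM2 := hM.comp hp (φ := fun x => x ^ 2) (analyticAt_id.pow 2)
  obtain ⟨F, hF, hF0, hFM⟩ := hM2.exists_expansion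
  have hang : ∀ᶠ z in 𝓝[>] (0 : ℝ),
      angle A γ R ρ (R - z) = Real.pi / 2 - z ^ (1 / 2 : ℝ) * M z := by
    filter_upwards [Ioo_mem_nhdsGT hR] with z hz
    have h1 := hρ.xi_surface hA hγ hg₀ hz
    have h2 : xi A γ ρ (R - z) =
        xi A γ ρ R - z ^ (1 / 2 : ℝ) * avg (-(1 / 2)) (surfSlowness γ g₀ R ρ) z := by linarith
    rw [angle, h2]
    simp only [M]
    field_simp
  have hlim : Tendsto (fun z : ℝ => z ^ (1 / 2 : ℝ) * M z) (𝓝[>] 0) (𝓝 0) := by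
    have h1 : Tendsto (fun z : ℝ => z ^ (1 / 2 : ℝ)) (𝓝[>] 0) (𝓝 0) :=
      ((Real.continuous_rpow_const (by norm_num)).tendsto' 0 0
        (Real.zero_rpow (by norm_num))).mono_left nhdsWithin_le_nhds
    simpa using h1.mul hM.tendsto
  -- Now π/2 - θ = √z M and 1 - x = cos²θ = sin²(√z M). Only the square of √z M occurs, so the half
  -- power of z disappears.
  refine ⟨fun p => F p * S (p.1 * F p), ?_, ?_, ?_⟩
  · refine hF.mul (AnalyticAt.fun_comp (g := S) ?_ (analyticAt_fst.mul hF))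
    simpa using hS
  · simp only [hF0, Prod.fst_zero, zero_mul]; positivity
  · filter_upwards [hang, hlim.eventually hSs, hFM, hlim.eventually (gt_mem_nhds Real.pi_pos),
      self_mem_nhdsWithin, hM.tendsto.eventually (lt_mem_nhds hM0)] with z h1 h2 h3 h4 h5 h6
    have hz : 0 < z := h5
    have hpos : 0 < z ^ (1 / 2 : ℝ) * M z := by positivity
    have hsq : (z ^ (1 / 2 : ℝ)) ^ 2 = z := by
      rw [← Real.rpow_natCast, ← Real.rpow_mul hz.le]; norm_num
    rw [xvar, h1, tan_sq_eq_sin_sq ⟨by linarith, by linarith⟩, Real.sin_pi_div_two_sub,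
      ← Real.sin_sq, h2, mul_pow, hsq, h3]
    simp only [surfacePar]
    ring

end IsEquilibrium

end

/-! ### Inversion of the variable change -/

section

theorem tendsto_depth (R : ℝ) : Tendsto (fun r => R - r) (𝓝[<] R) (𝓝[>] 0) := by
  refine tendsto_nhdsWithin_iff.2 ⟨?_, ?_⟩
  · exact ((continuous_const.sub continuous_id).tendsto' R 0 (by simp)).mono_left
      nhdsWithin_le_nhds
  · filter_upwards [self_mem_nhdsWithin] with r hr
    exact mem_Ioi.2 (sub_pos.2 (mem_Iio.1 hr))

/-- Near the centre `r²` is an analytic function of `x`. -/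
theorem exists_inverse_center {G : ℝ → ℝ} (hG : AnalyticAt ℝ G 0) (hG0 : 0 < G 0) :
    ∃ K : ℝ → ℝ, AnalyticAt ℝ K 0 ∧ K 0 = 0 ∧ ∀ᶠ p in 𝓝 (0 : ℝ), K (p * G p) = p := by
  have hH : AnalyticAt ℝ (fun p => p * G p) 0 := analyticAt_id.mul hG
  let L : ℝ ≃L[ℝ] ℝ := ContinuousLinearEquiv.unitsEquivAut ℝ (Units.mk0 (G 0) hG0.ne')
  have hL : HasFDerivAt (fun p => p * G p) (L : ℝ →L[ℝ] ℝ) 0 := by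
    have h1 := (hasDerivAt_id (0 : ℝ)).mul hG.differentiableAt.hasDerivAt
    have h2 : HasDerivAt (fun p => p * G p) (G 0) 0 := h1.congr_deriv (by simp)
    refine h2.hasFDerivAt.congr_fderiv ?_
    ext; simp [L]
  obtain ⟨K, hK, hKl, -, hK0⟩ := exists_analytic_inverse hH L hL
  simp only [zero_mul] at hK hK0
  exact ⟨K, hK, hK0, hKl⟩

/-- Near the surface `(z, zᵇ)` is an analytic function of `(1 - x, (1 - x)ᵇ)`. -/
theorem exists_inverse_surface {b : ℝ} {G : ℝ × ℝ → ℝ} (hG : AnalyticAt ℝ G 0) (hG0 : 0 < G 0) :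
    ∃ K : ℝ × ℝ → ℝ × ℝ, AnalyticAt ℝ K 0 ∧ K 0 = 0 ∧
      ∀ᶠ p in 𝓝 (0 : ℝ × ℝ), K (p.1 * G p, p.2 * G p ^ b) = p := by
  have hGb : AnalyticAt ℝ (fun p => G p ^ b) 0 :=
    AnalyticAt.fun_comp (g := fun x : ℝ => x ^ b) (analyticAt_rpow_const hG0) hG
  have hGb0 : 0 < G 0 ^ b := Real.rpow_pos_of_pos hG0 b
  have hH : AnalyticAt ℝ (fun p : ℝ × ℝ => (p.1 * G p, p.2 * G p ^ b)) 0 :=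
    (analyticAt_fst.mul hG).prod (analyticAt_snd.mul hGb)
  -- At the origin the derivatives of G are multiplied by 0, so the derivative is diagonal with the
  -- nonzero entries G 0 and G 0 ^ b.
  let L : (ℝ × ℝ) ≃L[ℝ] ℝ × ℝ :=
    (ContinuousLinearEquiv.unitsEquivAut ℝ (Units.mk0 (G 0) hG0.ne')).prodCongr
      (ContinuousLinearEquiv.unitsEquivAut ℝ (Units.mk0 (G 0 ^ b) hGb0.ne'))
  have hL : HasFDerivAt (fun p : ℝ × ℝ => (p.1 * G p, p.2 * G p ^ b))
      (L : (ℝ × ℝ) →L[ℝ] ℝ × ℝ) 0 := by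
    have h1 := (hasFDerivAt_fst (𝕜 := ℝ) (p := (0 : ℝ × ℝ))).mul hG.differentiableAt.hasFDerivAt
    have h2 := (hasFDerivAt_snd (𝕜 := ℝ) (p := (0 : ℝ × ℝ))).mul hGb.differentiableAt.hasFDerivAt
    refine (h1.prodMk h2).congr_fderiv ?_
    ext <;> simp [L]
  obtain ⟨K, hK, hKl, -, hK0⟩ := exists_analytic_inverse hH L hL
  have e : ((0 : ℝ × ℝ).1 * G 0, (0 : ℝ × ℝ).2 * G 0 ^ b) = 0 := by simp
  rw [e] at hK hK0
  exact ⟨K, hK, hK0, hKl⟩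

end

end

end Stellar

/-! ### Assembly of the theorem. -/

open Stellar in
theorem proposition4 (A γ g₀ R ρc : ℝ) (ρ : ℝ → ℝ) (hA : 0 < A) (hg₀ : 0 < g₀)
    (hγ : 6 / 5 < γ) (hγ' : γ ≤ 2) (hρ : Stellar.IsEquilibrium A γ g₀ R ρc ρ)
    (lam : ℝ) (Φ : ℝ → ℝ) (hΦ : Stellar.IsEigenfunction A γ R ρ lam Φ) :
    ∃ Ψ : ℝ → ℝ, Φ =ᵐ[Stellar.weight R ρ] Ψ ∧ Stellar.IsSolution A γ R ρ lam 0 Ψ ∧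
      (∃ C₀ : ℝ, C₀ ≠ 0 ∧
        (∃ f : ℝ → ℝ, Stellar.IsSeriesOne f ∧
          ∀ᶠ r in 𝓝[>] (0 : ℝ), Ψ r = C₀ * (1 + f (r ^ 2))) ∧
        (∃ f : ℝ → ℝ, Stellar.IsSeriesOne f ∧
          ∀ᶠ r in 𝓝[>] (0 : ℝ), Ψ r = C₀ * (1 + f (Stellar.xvar A γ R ρ r)))) ∧
      (∃ C₁ : ℝ, C₁ ≠ 0 ∧
        (∃ g : ℝ × ℝ → ℝ, Stellar.IsSeriesTwo g ∧
          ∀ᶠ r in 𝓝[<] R, Ψ r = C₁ * (1 + g (R - r, (R - r) ^ (γ / (γ - 1))))) ∧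
        (∃ g : ℝ × ℝ → ℝ, Stellar.IsSeriesTwo g ∧
          ∀ᶠ r in 𝓝[<] R, Ψ r = C₁ * (1 + g (1 - Stellar.xvar A γ R ρ r,
            (1 - Stellar.xvar A γ R ρ r) ^ (Stellar.indexN γ / 2))))) ∧
      (∀ s ∈ Ico (0 : ℝ) R, ∀ y : ℝ → ℝ, Stellar.IsSolution A γ R ρ lam s y →
        (¬ ∃ c : ℝ, ∀ r ∈ Ioo s R, y r = c * Ψ r) →
        ∀ t ∈ Ico s R, ¬ MemLp y 2 ((Stellar.weight R ρ).restrict (Ioo t R))) := by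
  have hγ1 : 1 < γ := by linarith
  have hR := hρ.radius_pos
  obtain ⟨hgraph, hne⟩ := hΦ
  obtain ⟨Ψ, hae, hΨ⟩ := hρ.exists_solution_ae_eq hA hγ1 hgraph
  have hΨL : MemLp Ψ 2 ((weight R ρ).restrict (Ioo 0 R)) := by
    rw [IsEquilibrium.weight_restrict]; exact hgraph.1.ae_eq hae
  -- A solution vanishing near one point vanishes identically, against Φ ≠ 0. This excludes C₀ = 0
  -- and C₁ = 0 below.
  have hΨ0 : ∀ r₀ ∈ Ioo 0 R, ¬ ∀ᶠ r in 𝓝 r₀, Ψ r = 0 := by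
    intro r₀ hr₀ h
    refine hne (hae.trans ?_)
    have hz : ∀ r ∈ Ioo 0 R, Ψ r = 0 := fun r hr => by
      have := hρ.solution_proportional hA hγ1 le_rfl le_rfl hΨ hΨ (c := 0) (r₀ := r₀)
        (by rwa [max_self]) (by simpa using h) (r := r) (by rwa [max_self])
      simpa using this
    exact (IsEquilibrium.weight_absolutelyContinuous (ρ := ρ)).ae_le
      ((ae_restrict_iff' measurableSet_Ioo).2 (Eventually.of_forall hz))
  obtain ⟨y₀, hy₀, hy₀0, hy₀u⟩ := hρ.exists_center_solution hA hγ1 lam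
  obtain ⟨y₁, hy₁, hy₁0, hy₁u⟩ := hρ.exists_surface_solution hA hg₀ hγ1 hγ' lam
  obtain ⟨C₀, hC₀⟩ := hy₀u Ψ hΨ hΨL
  obtain ⟨C₁, hC₁⟩ := hy₁u 0 le_rfl Ψ hΨ 0 ⟨le_rfl, hR⟩ hΨL
  have hC₀0 : C₀ ≠ 0 := by
    rintro rfl
    obtain ⟨ε, hε, hεs⟩ := mem_nhdsGT_iff_exists_Ioo_subset.1
      (hC₀.and (Ioo_mem_nhdsGT hR))
    have hmem : ε / 2 ∈ Ioo 0 ε := ⟨half_pos hε, half_lt_self hε⟩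
    refine hΨ0 (ε / 2) (hεs hmem).2 ?_
    filter_upwards [isOpen_Ioo.mem_nhds hmem] with r hr
    simpa using (hεs hr).1
  have hsurf : ∀ᶠ r in 𝓝[<] R, Ψ r = C₁ * y₁ (R - r) := by
    filter_upwards [(tendsto_depth R).eventually hC₁] with r hr
    rwa [sub_sub_cancel] at hr
  have hC₁0 : C₁ ≠ 0 := by
    rintro rfl
    obtain ⟨l, hl, hls⟩ := mem_nhdsLT_iff_exists_Ioo_subset.1
      (hsurf.and (Ioo_mem_nhdsLT hR))
    obtain ⟨r₀, hr₀⟩ := exists_between (show l < R from hl)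
    refine hΨ0 r₀ (hls hr₀).2 ?_
    filter_upwards [isOpen_Ioo.mem_nhds (show r₀ ∈ Ioo l R from hr₀)] with r hr
    simpa using (hls hr).1
  have hb : γ / (γ - 1) = 1 / (γ - 1) + 1 := by
    have : γ - 1 ≠ 0 := by linarith
    field_simp; ring
  have hbpos : 0 < γ / (γ - 1) := div_pos (by linarith) (by linarith)
  rw [← hb] at hy₁
  have hp := tendsto_surfacePar hbpos
  refine ⟨Ψ, hae, hΨ, ⟨C₀, hC₀0, ?_, ?_⟩, ⟨C₁, hC₁0, ?_, ?_⟩, ?_⟩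
  · obtain ⟨F, hF, hF0, hFy⟩ := hy₀.exists_expansion
    refine ⟨fun p => F p - 1, ⟨hF.sub analyticAt_const, by simp [hF0, hy₀0]⟩, ?_⟩
    filter_upwards [hC₀, hFy] with r h1 h2
    rw [h1, h2]; simp [centerPar]
  · obtain ⟨F, hF, hF0, hFy⟩ := hy₀.exists_expansion
    obtain ⟨G, hG, hG0, hGx⟩ := hρ.exists_xvar_center hA hγ1 hg₀
    obtain ⟨K, hK, hK0, hKG⟩ := exists_inverse_center hG hG0
    refine ⟨fun x => F (K x) - 1, ⟨(AnalyticAt.fun_comp (g := F) (by rwa [hK0]) hK).sub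
      analyticAt_const, by simp [hK0, hF0, hy₀0]⟩, ?_⟩
    filter_upwards [hC₀, hFy, hGx, tendsto_centerPar.eventually hKG] with r h1 h2 h3 h4
    rw [centerPar] at h4
    rw [h1, h2, h3, h4]; simp [centerPar]
  · obtain ⟨F, hF, hF0, hFy⟩ := hy₁.exists_expansion
    refine ⟨fun p => F p - 1, ⟨hF.sub analyticAt_const, ?_⟩, ?_⟩
    · change F 0 - 1 = 0
      rw [hF0, hy₁0, sub_self]
    · filter_upwards [hsurf, (tendsto_depth R).eventually hFy] with r h1 h2
      rw [h1, h2]; simp [surfacePar]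
  · obtain ⟨F, hF, hF0, hFy⟩ := hy₁.exists_expansion
    obtain ⟨G, hG, hG0, hGx⟩ := hρ.exists_xvar_surface hA hγ1 hg₀
    rw [← hb] at hGx
    obtain ⟨K, hK, hK0, hKG⟩ := exists_inverse_surface (b := γ / (γ - 1)) hG hG0
    refine ⟨fun x => F (K x) - 1, ⟨(AnalyticAt.fun_comp (g := F) (by rwa [hK0]) hK).sub analyticAt_const, ?_⟩, ?_⟩
    · change F (K 0) - 1 = 0
      rw [hK0, hF0, hy₁0, sub_self]
    · have hN : indexN γ / 2 = γ / (γ - 1) := by rw [indexN]; ring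
      have hGpos := hp.eventually (hG.continuousAt.eventually (lt_mem_nhds hG0))
      filter_upwards [hsurf, (tendsto_depth R).eventually (hFy.and (hGx.and
        ((hp.eventually hKG).and (hGpos.and self_mem_nhdsWithin))))] with r h1 h2
      obtain ⟨h2, h3, h4, h5, h6⟩ := h2
      rw [sub_sub_cancel] at h3
      -- With 1 - x = z G > 0, the power (1 - x)^(N/2) equals z^b G^b for b = γ/(γ-1), which is the
      -- second component of the map inverted by K.
      rw [h1, h2, h3, hN, Real.mul_rpow (le_of_lt h6) (le_of_lt h5)]
      change _ = C₁ * (1 + (F (K ((surfacePar (γ / (γ - 1)) (R - r)).1 *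
        G (surfacePar (γ / (γ - 1)) (R - r)), (surfacePar (γ / (γ - 1)) (R - r)).2 *
        G (surfacePar (γ / (γ - 1)) (R - r)) ^ (γ / (γ - 1)))) - 1))
      rw [h4, add_sub_cancel]
  -- An L² solution y is, like Ψ, a multiple of y₁ near R. Hence y = (C/C₁) Ψ there, and by ODE
  -- uniqueness on all of (s, R).
  · intro s hs y hy hnot t ht hL
    obtain ⟨C, hC⟩ := hy₁u s hs.1 y hy t ht hL
    refine hnot ⟨C / C₁, fun r hr => ?_⟩
    have heq : ∀ᶠ r in 𝓝[<] R, y r = C / C₁ * Ψ r := by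
      filter_upwards [hsurf, (tendsto_depth R).eventually hC] with r h1 h2
      rw [sub_sub_cancel] at h2
      rw [h2, h1]; field_simp
    obtain ⟨l, hl, hls⟩ := mem_nhdsLT_iff_exists_Ioo_subset.1 (heq.and (Ioo_mem_nhdsLT hs.2))
    obtain ⟨r₀, hr₀⟩ := exists_between (show l < R from hl)
    have hmax : max s 0 = s := max_eq_left hs.1
    refine hρ.solution_proportional hA hγ1 hs.1 le_rfl hy hΨ (r₀ := r₀)
      (by rw [hmax]; exact (hls hr₀).2) ?_ (by rwa [hmax])
    filter_upwards [isOpen_Ioo.mem_nhds (show r₀ ∈ Ioo l R from hr₀)] with r hr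
    exact (hls hr).1
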